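/- **Setting.** Let $\widehat g=\mathrm{diag}(-1,1,1,1)$ on $\mathbb R^4$, $\square=\widehat g^{pq}\partial_p\partial_q$, and write $\widehat g(\xi,\zeta)=\widehat g^{jk}\xi_j\zeta_k$ for covectors. A covector $\xi\neq0$ is light-like if $\widehat g(\xi,\xi)=0$. A symmetric matrix $v\in\mathrm{sym}(\mathbb R^{4\times4})\cong\mathbb R^{10}$ satisfies the harmonicity condition with respect to $\xi$ if $$-\widehat g^{mn}\xi_m v_{nj}+\tfrac12\,\xi_j\,\widehat g^{pq}v_{pq}=0\qquad\text{for all } j. \tag{H}$$ **The equations.** For a metric $g=\widehat g+u$ let $F^n=g^{jk}\Gamma^n_{jk}$ and $(\mathrm{Ric}_{\widehat g}\,g)_{jk}=\mathrm{Ric}_{jk}(g)-\frac12(g_{jn}\partial_kF^n+g_{kn}\partial_jF^n)$. The reduced vacuum Einstein equations $\mathrm{Ric}_{\widehat g}(g)=0$ read $\square u=N(u)$ with $N(u)=\square u+2\,\mathrm{Ric}_{\widehat g}(\widehat g+u)$. **The waves.** Fix an integer $a\ge16$. Let $\mathbf b=(b^{(1)},\dots,b^{(5)})$ be light-like covectors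 such that $b^{(1)},\dots,b^{(4)}$ are linearly independent and $b^{(5)}$ is not in the span of any three of them. Let $\mathbf v=(v_{(1)},\dots,v_{(5)})$ be symmetric matrices. Put $u_j(x)=v_{(j)}(b^{(j)}\cdot x)_+^a$ for $j\le4$ and $u_\tau(x)=e^{i\tau b^{(5)}\cdot x}$. The formal parametrix $\mathbf Q_0$ of $\square$ is given on products by $$\mathbf Q_0\big((b^{(i)}\!\cdot x)_+^{m}(b^{(j)}\!\cdot x)_+^{n}\big)=\frac{(b^{(i)}\!\cdot x)_+^{m+1}(b^{(j)}\!\cdot x)_+^{n+1}}{2(m+1)(n+1)\,\widehat g(b^{(i)},b^{(j)})},\qquad \mathbf Q_0\big((b^{(j)}\!\cdot x)_+^{m}u_\tau\big)=\frac{(b^{(j)}\!\cdot x)_+^{m+1}u_\tau}{2i(m+1)\,\widehat g(b^{(j)},b^{(5)})\,\tau}.$$ **The four-wave interaction.** Insert $u_\varepsilon=\sum_{\emptyset\ne S\subset\{1,2,3,4\}}\varepsilon^S u_S$, $\varepsilon^S=\prod_{j\in S}\varepsilon_j$, $u_{\{j\}}=u_j$, into $\square u=N(u)$ and compare the coefficients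 of $\varepsilon^S$. This gives, formally, $u_S=\mathbf Q F_S$ where $F_S$ is the coefficient of $\varepsilon^S$ in $N(u_\varepsilon)$; it depends only on the $u_{S'}$ with $S'\subsetneq S$. For $|S|=2$ we take $\mathbf Q=\mathbf Q_0$. Let $F_{1234}$ be the coefficient for $S=\{1,2,3,4\}$, and let $\langle v_{(5)}u_\tau,hF_{1234}\rangle$ be the integral over $\mathbb R^4$ of $h\,u_\tau\,\widehat g^{nj}\widehat g^{mk}(v_{(5)})_{nm}(F_{1234})_{jk}$, where $h\in C_0^\infty(\mathbb R^4)$ equals one near $0$. The terms that contain $u_S$ with $|S|=3$ are bilinear in $u_j$, $\{j\}=\{1,2,3,4\}\setminus S$, and $u_S=\mathbf QF_S$, and they are interpreted by duality: each contribution $$\langle u_\tau,(\partial^\alpha u_j)\,\partial^\beta(\mathbf QF_S)\rangle\quad\text{is replaced by}\quad\langle\mathbf Q_0(u_\tau\,\partial^\alpha u_j),\,h\,\partial^\beta F_S\rangle .$$ The Minkowski indicator function is the leading coefficient $$\mathcal G^{(\mathbf m)}(\mathbf v,\mathbf b)=\lim_{\tau\to\infty}\tau^{4a+2}\,\langle v_{(5)}u_\tau,\,h\,F_{1234}\rangle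 .$$ **Proposition.** Let $a\ge 16$ and let $\widehat b^{(5)}$ be light-like. Let $\mathbb X(\widehat b^{(5)})$ be the set of all $(\mathbf b,v_{(2)},v_{(3)},v_{(4)})$ where $\mathbf b$ is a 5-tuple of light-like covectors with $b^{(5)}=\widehat b^{(5)}$ and each $v_{(j)}$, $j=2,3,4$, is symmetric and satisfies (H) with respect to $b^{(j)}$. There is an open dense subset $\mathbb X'(\widehat b^{(5)})$ of $\mathbb X(\widehat b^{(5)})$ such that for every $(\mathbf b,v_{(2)},v_{(3)},v_{(4)})\in\mathbb X'(\widehat b^{(5)})$ the covectors $b^{(1)},\dots,b^{(4)}$ are linearly independent, $b^{(5)}$ is not in the span of any three of them, and there are linearly independent symmetric matrices $v_{(5)}^1,\dots,v_{(5)}^6$ with the following property. If $v_{(5)}\in\mathrm{span}\{v^q_{(5)}:q=1,\dots,6\}$ is non-zero, then there is a symmetric $v_{(1)}$ satisfying (H) with respect to $b^{(1)}$ such that, for $\mathbf v=(v_{(1)},\dots,v_{(5)})$, the limit $\mathcal G^{(\mathbf m)}(\mathbf v,\mathbf b)$ exists, does not depend on $h$, and is non-zero. -/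

import Mathlib

namespace FourWave

noncomputable section

/-! ### Minkowski space -/

/-- Covectors of `ℝ⁴` in the standard coordinates `(x⁰, x¹, x², x³)`. -/
abbrev Covector : Type := Fin 4 → ℝ

/-- `4 × 4` matrices; the polarizations are the symmetric ones. -/
abbrev Tensor : Type := Matrix (Fin 4) (Fin 4) ℝ

/-- The Minkowski metric `diag(-1, 1, 1, 1)`. It is its own inverse, so the same matrix is used
for `ĝ_{jk}` and for `ĝ^{jk}`. -/
def minkowski : Tensor := Matrix.diagonal ![-1, 1, 1, 1]

/-- `ĝ(ξ, ζ) = ĝ^{jk} ξ_j ζ_k` for covectors. -/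
def pairing (ξ ζ : Covector) : ℝ := ∑ j, ∑ k, minkowski j k * ξ j * ζ k

def IsLightlike (ξ : Covector) : Prop := ξ ≠ 0 ∧ pairing ξ ξ = 0

/-- `v` is a symmetric tensor satisfying the harmonicity condition for symbols at the covector `ξ`,
`- ĝ^{mn} ξ_m v_{nj} + ½ ξ_j ĝ^{pq} v_{pq} = 0` for all `j`. -/
def IsPolarization (ξ : Covector) (v : Tensor) : Prop :=
  v.IsSymm ∧ ∀ j,
    -(∑ m, ∑ n, minkowski m n * ξ m * v n j)
      + 1 / 2 * ξ j * (∑ p, ∑ q, minkowski p q * v p q) = 0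

/-! ### The reduced Einstein equations

These are written over any commutative `ℝ`-algebra `R` (of functions) with operators
`D 0, …, D 3` playing the role of the coordinate derivatives `∂_0, …, ∂_3`. -/

/-- The Christoffel symbol `Γ^q_{mn} = ½ g^{ql} (∂_m g_{nl} + ∂_n g_{ml} - ∂_l g_{mn})`. -/
def christoffel {R : Type*} [CommRing R] [Algebra ℝ R] (D : Fin 4 → R → R)
    (g : Matrix (Fin 4) (Fin 4) R) (q m n : Fin 4) : R :=
  (1 / 2 : ℝ) • ∑ l, g⁻¹ q l * (D m (g n l) + D n (g m l) - D l (g m n))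

/-- The Ricci tensor,
`Ric_{jk} = ∂_a Γ^a_{jk} - ∂_k Γ^a_{ja} + Γ^a_{ac} Γ^c_{jk} - Γ^a_{kc} Γ^c_{ja}`. -/
def ricci {R : Type*} [CommRing R] [Algebra ℝ R] (D : Fin 4 → R → R)
    (g : Matrix (Fin 4) (Fin 4) R) (j k : Fin 4) : R :=
  (∑ a, (D a (christoffel D g a j k) - D k (christoffel D g a j a)))
    + ∑ a, ∑ c, (christoffel D g a a c * christoffel D g c j k
        - christoffel D g a k c * christoffel D g c j a)

/-- The harmonicity functions `F^n = g^{jk} Γ^n_{jk}`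
(the background Christoffel symbols vanish). -/
def harmonicity {R : Type*} [CommRing R] [Algebra ℝ R] (D : Fin 4 → R → R)
    (g : Matrix (Fin 4) (Fin 4) R) (n : Fin 4) : R :=
  ∑ j, ∑ k, g⁻¹ j k * christoffel D g n j k

/-- The Ricci tensor reduced with respect to the Minkowski metric,
`(Ric_ĝ g)_{jk} = Ric_{jk} - ½ (g_{jn} ∂_k F^n + g_{kn} ∂_j F^n)`. In vacuum the reduced Einstein
equations are equivalent to `Ric_ĝ g = 0`. -/
def reducedRicci {R : Type*} [CommRing R] [Algebra ℝ R] (D : Fin 4 → R → R)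
    (g : Matrix (Fin 4) (Fin 4) R) (j k : Fin 4) : R :=
  ricci D g j k
    - (1 / 2 : ℝ) • ∑ n, (g j n * D k (harmonicity D g n) + g k n * D j (harmonicity D g n))

/-- The Minkowski wave operator `□ = ĝ^{pq} ∂_p ∂_q`. -/
def waveOp {R : Type*} [CommRing R] [Algebra ℝ R] (D : Fin 4 → R → R) (f : R) : R :=
  ∑ p, ∑ q, minkowski p q • D p (D q f)

/-- The nonlinearity `N` of the reduced vacuum Einstein equations around Minkowski space: as
`-2 Ric_ĝ(ĝ + u) = □ u - N(u)`, these equations for the metric `ĝ + u` read `□ u = N(u)`.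
`N` vanishes to second order at `u = 0`. -/
def nonlinearity {R : Type*} [CommRing R] [Algebra ℝ R] (D : Fin 4 → R → R)
    (u : Matrix (Fin 4) (Fin 4) R) : Matrix (Fin 4) (Fin 4) R :=
  Matrix.of fun j k =>
    waveOp D (u j k) + (2 : ℝ) • reducedRicci D (minkowski.map (algebraMap ℝ R) + u) j k

/-! ### Products of plane waves

The index `j : Fin 4` stands for the `(j+1)`-st wave; `b 4` is the direction `b⁽⁵⁾`. -/

/-- Linear combinations of products of plane waves: the monomial `∏ X_j ^ α_j` stands for the
function `∏ (b⁽ʲ⁾ · x)_+ ^ α_j`. -/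
abbrev WaveAlg : Type := MvPolynomial (Fin 4) ℝ

/-- The function on `ℝ⁴` represented by `p`. -/
def realize (b : Fin 5 → Covector) (p : WaveAlg) (x : Fin 4 → ℝ) : ℝ :=
  MvPolynomial.eval (fun j : Fin 4 => max (b j.castSucc ⬝ᵥ x) 0) p

/-- The coordinate derivative `∂_k`, determined by
`∂_k (b⁽ʲ⁾ · x)_+ ^ α = α b⁽ʲ⁾_k (b⁽ʲ⁾ · x)_+ ^ (α - 1)`. (All exponents below are positive.) -/
def waveDeriv (b : Fin 5 → Covector) (k : Fin 4) (p : WaveAlg) : WaveAlg :=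
  ∑ j : Fin 4, MvPolynomial.C (b j.castSucc k) * MvPolynomial.pderiv j p

/-- The formal parametrix `Q₀` on products of the waves `i` and `j`:
`(b⁽ⁱ⁾ · x)_+ ^ m (b⁽ʲ⁾ · x)_+ ^ n` is mapped to
`(b⁽ⁱ⁾ · x)_+ ^ (m+1) (b⁽ʲ⁾ · x)_+ ^ (n+1) / (2 (m+1) (n+1) ĝ(b⁽ⁱ⁾, b⁽ʲ⁾))`. -/
def parametrix (b : Fin 5 → Covector) (i j : Fin 4) (p : WaveAlg) : WaveAlg :=
  ∑ s ∈ p.support,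
    MvPolynomial.monomial (s + Finsupp.single i 1 + Finsupp.single j 1)
      (MvPolynomial.coeff s p
        / (2 * ((s i : ℝ) + 1) * ((s j : ℝ) + 1) * pairing (b i.castSucc) (b j.castSucc)))

/-- The formal parametrix `Q₀` on products of the wave `j` with `u_τ = exp (i τ b⁽⁵⁾ · x)`:
`Q₀ ((b⁽ʲ⁾ · x)_+ ^ m u_τ) = (i τ)⁻¹ (b⁽ʲ⁾ · x)_+ ^ (m+1) u_τ / (2 (m+1) ĝ(b⁽ʲ⁾, b⁽⁵⁾))`.
The factors `(i τ)⁻¹ u_τ` are left out here and put back in `interaction`; powers of the other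
waves are left as they are. -/
def testParametrix (b : Fin 5 → Covector) (j : Fin 4) (p : WaveAlg) : WaveAlg :=
  ∑ s ∈ p.support,
    MvPolynomial.monomial (s + Finsupp.single j 1)
      (MvPolynomial.coeff s p
        / (2 * ((s j : ℝ) + 1) * pairing (b j.castSucc) (b 4)))

/-! ### Expansion in the amplitudes `ε₁, …, ε₄` -/

/-- Power series in the amplitudes `ε₁, …, ε₄` of the four waves. -/
abbrev Expansion : Type := MvPowerSeries (Fin 4) WaveAlg

/-- `∂_k` acting on the coefficients. -/
def expDeriv (b : Fin 5 → Covector) (k : Fin 4) (f : Expansion) : Expansion :=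
  fun n => waveDeriv b k (MvPowerSeries.coeff n f)

/-- The exponent of `ε^S = ∏_{j ∈ S} ε_j`. -/
def epsExp (S : Finset (Fin 4)) : Fin 4 →₀ ℕ := ∑ j ∈ S, Finsupp.single j 1

/-- The tensor field `ε^S w`. -/
def withEps (S : Finset (Fin 4)) (w : Matrix (Fin 4) (Fin 4) WaveAlg) :
    Matrix (Fin 4) (Fin 4) Expansion :=
  w.map fun f => MvPowerSeries.monomial (epsExp S) f

/-- The coefficient of `ε^S` (that is, the mixed derivative `∂_ε^S` at `ε = 0`) of `N(u)`. -/
def source (b : Fin 5 → Covector) (S : Finset (Fin 4))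
    (u : Matrix (Fin 4) (Fin 4) Expansion) : Matrix (Fin 4) (Fin 4) WaveAlg :=
  (nonlinearity (expDeriv b) u).map fun f => MvPowerSeries.coeff (epsExp S) f

/-- The plane wave `u_j(x) = v_j (b⁽ʲ⁾ · x)_+ ^ a`. -/
def planeWave (a : ℕ) (v : Fin 5 → Tensor) (j : Fin 4) : Matrix (Fin 4) (Fin 4) WaveAlg :=
  (v j.castSucc).map fun c => MvPolynomial.C c * MvPolynomial.X j ^ a

/-- `∑_j ε_j u_j`. -/
def firstOrder (a : ℕ) (v : Fin 5 → Tensor) : Matrix (Fin 4) (Fin 4) Expansion :=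
  ∑ j, withEps {j} (planeWave a v j)

/-- The wave produced by the interaction of the waves `i` and `j`, that is, `Q₀` applied to the
coefficient of `ε_i ε_j` in the nonlinearity. -/
def pairWave (a : ℕ) (b : Fin 5 → Covector) (v : Fin 5 → Tensor) (i j : Fin 4) :
    Matrix (Fin 4) (Fin 4) WaveAlg :=
  (source b {i, j} (firstOrder a v)).map (parametrix b i j)

/-- The solution up to the interactions of two waves. -/
def secondOrder (a : ℕ) (b : Fin 5 → Covector) (v : Fin 5 → Tensor) :
    Matrix (Fin 4) (Fin 4) Expansion :=
  firstOrder a v + ∑ i, ∑ j ∈ Finset.Ioi i, withEps {i, j} (pairWave a b v i j)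

/-- The source of the wave produced by the interaction of the three waves other than `j`. -/
def tripleSource (a : ℕ) (b : Fin 5 → Covector) (v : Fin 5 → Tensor) (j : Fin 4) :
    Matrix (Fin 4) (Fin 4) WaveAlg :=
  source b {j}ᶜ (secondOrder a b v)

/-- Those four-wave interaction terms in which no three-wave interaction occurs. -/
def regularFour (a : ℕ) (b : Fin 5 → Covector) (v : Fin 5 → Tensor) :
    Matrix (Fin 4) (Fin 4) WaveAlg :=
  source b Finset.univ (secondOrder a b v)

/-- `A[u_j, F]`, where `A` is the (symmetrized) bilinear part of the nonlinearity and `F` is the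
source of the three-wave interaction of the waves other than `j`. The actual interaction term is
`A[u_j, Q F]`. -/
def tripleFour (a : ℕ) (b : Fin 5 → Covector) (v : Fin 5 → Tensor) (j : Fin 4) :
    Matrix (Fin 4) (Fin 4) WaveAlg :=
  source b Finset.univ
    (withEps {j} (planeWave a v j) + withEps {j}ᶜ (tripleSource a b v j))

/-- The pairing `ĝ^{nj} ĝ^{mk} w_{nm} F_{jk}`. -/
def contract (w : Tensor) (F : Matrix (Fin 4) (Fin 4) WaveAlg) : WaveAlg :=
  ∑ j, ∑ k, MvPolynomial.C ((minkowski * w * minkowski) j k) * F j k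

/-- The sum of all four-wave interaction terms, tested with `v₅ u_τ`, `u_τ = exp (i τ b⁽⁵⁾ · x)`,
and cut off by `h`. In the terms `⟨v₅ u_τ, A[u_j, Q F]⟩` the derivatives in `A[u_j, ·]` are commuted
with `Q`, and then `Q` is moved to the left factor, where it becomes `Q₀` applied to products of
`u_τ` and derivatives of `u_j`. -/
def interaction (a : ℕ) (h : (Fin 4 → ℝ) → ℝ) (b : Fin 5 → Covector) (v : Fin 5 → Tensor)
    (τ : ℝ) : ℂ :=
  ∫ x : Fin 4 → ℝ,
    (h x : ℂ) * Complex.exp (Complex.I * (τ : ℂ) * ((b 4 ⬝ᵥ x : ℝ) : ℂ)) *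
      ((realize b (contract (v 4) (regularFour a b v)) x : ℂ)
        + (Complex.I * (τ : ℂ))⁻¹ *
          (realize b (∑ j, testParametrix b j (contract (v 4) (tripleFour a b v j))) x : ℂ))

/-- `c` is the value of the Minkowski indicator function at `(v, b)`, for plane waves
`v_j (b⁽ʲ⁾ · x)_+ ^ a`: for every smooth compactly supported cut-off function `h` that is one near
the intersection point `0` of the hyperplanes `b⁽ʲ⁾ · x = 0`, the limit of `τ ^ (4 a + 2)` times
the interaction exists and equals `c`. -/
def HasIndicator (a : ℕ) (b : Fin 5 → Covector) (v : Fin 5 → Tensor) (c : ℂ) : Prop :=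
  ∀ h : (Fin 4 → ℝ) → ℝ, ContDiff ℝ ((⊤ : ℕ∞) : WithTop ℕ∞) h → HasCompactSupport h →
    (∀ᶠ x in nhds (0 : Fin 4 → ℝ), h x = 1) →
    Filter.Tendsto (fun τ : ℝ => (τ : ℂ) ^ (4 * a + 2) * interaction a h b v τ)
      Filter.atTop (nhds c)

/-- `b⁽¹⁾, …, b⁽⁴⁾` are linearly independent and `b⁽⁵⁾` is not in the span of three of them. -/
def GeneralPosition (b : Fin 5 → Covector) : Prop :=
  LinearIndependent ℝ (fun j : Fin 4 => b j.castSucc) ∧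
    ∀ j : Fin 4, b 4 ∉ Submodule.span ℝ ((fun i : Fin 4 => b i.castSucc) '' {j}ᶜ)

/-- The set of all `(b, v₂, v₃, v₄)` where `b` is a 5-tuple of light-like covectors with
`b⁽⁵⁾ = b5` and each `v_j` satisfies the harmonicity condition with respect to `b⁽ʲ⁾`. -/
def configurations (b5 : Covector) :
    Set ((Fin 5 → Covector) × Tensor × Tensor × Tensor) :=
  {x | (∀ j, IsLightlike (x.1 j)) ∧ x.1 4 = b5 ∧
    IsPolarization (x.1 1) x.2.1 ∧ IsPolarization (x.1 2) x.2.2.1 ∧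
    IsPolarization (x.1 3) x.2.2.2}

end

end FourWave

/-! Write b⁽⁵⁾ = ∑ c_j b⁽ʲ⁾. In the coordinates y_j = b⁽ʲ⁾ · x the phase of u_τ is τ ∑ c_j y_j, and
the integral of h u_τ ∏ (y_j)_+ ^ α_j is asymptotic to |det|⁻¹ ∏ α_j! (i / (c_j τ)) ^ (α_j + 1),
because only the corner y = 0 contributes. Up to powers of iτ this is a Laplace transform. It turns
∂_k on the wave j into multiplication by the component k of ζ_j = c_j b⁽ʲ⁾, and Q₀ into division by
2 ĝ(ζ_i, ζ_j) or, up to sign, by 2 ĝ(ζ_j, b⁽⁵⁾). Hence the limit exists and is a non-zero constant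
times an algebraic amplitude in null momenta ζ_j with sum b⁽⁵⁾ (`hasIndicator_of_amp`).

The amplitude is too large to expand, so its non-vanishing is read off at a pole, with waves
numbered from 0. Multiply by the inverse propagators of the pair (0, 1) and of wave 3 with the test
wave. The result `regAmp` stays regular when both vanish, and there a single channel survives: wave
0 meets wave 1, the product meets wave 2, and that product meets wave 3 (`regAmp_eq_absorb`). If the
polarizations of waves 1, 2, 3 are squares ε ⊗ ε with ε null and transverse, each meeting is an
explicit linear map `absorb`. It preserves harmonicity and is injective on symmetric tensors. The
polarizations of wave 0 form a space of dimension 10 - 4 = 6, so its image has dimension 6. Six real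
symmetric tensors W_r then separate the six images: a 6 × 6 determinant is non-zero.

Real null covectors are orthogonal only if they are proportional, so such a pole with independent
momenta needs complex momenta. A null covector is a product p ⊗ q of two spinors, and two of them
are orthogonal iff they share a factor up to scale (`dot_spinMul`). This gives an explicit singular
configuration with the prescribed sum b⁽⁵⁾ (`exists_isSingular`); the W_r are chosen there, so they
depend on b⁽⁵⁾ only.

For density, join an arbitrary real configuration at t = 0 to the singular one at t = i by a
polynomial curve of null covectors and harmonic tensors that is real for real t (`exists_curve`).
The determinant `gramDet` is meromorphic along the curve and has a non-zero limit at i, so it does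
not vanish for small real t ≠ 0. Openness is continuity of `gramDet`. Where the determinant is
non-zero, every non-zero combination of the W_r has a non-zero amplitude with one of the six
polarizations of the first wave.

All comparisons between different incarnations of the nonlinearity use one device. The formulas make
sense over every commutative ℝ-algebra and commute with homomorphisms, so two computations are
related by doing them at once in a product algebra and following a family of subspaces. -/

namespace FourWave

noncomputable section

/-! ### Naturality of the nonlinearity -/

section Naturality

variable {R R' : Type*} [CommRing R] [Algebra ℝ R] [CommRing R'] [Algebra ℝ R']

/-- The unit hypothesis cannot be dropped: the matrix inverse is zero by convention when the
determinant is not a unit, while the image under `φ` may be invertible. -/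
theorem inv_map_of_isUnit_det (φ : R →ₐ[ℝ] R') (g : Matrix (Fin 4) (Fin 4) R)
    (hg : IsUnit g.det) : (g.map φ)⁻¹ = g⁻¹.map φ := by
  apply Matrix.inv_eq_right_inv
  rw [← Matrix.map_mul, Matrix.mul_nonsing_inv g hg]
  exact Matrix.map_one φ (map_zero φ) (map_one φ)

variable {D : Fin 4 → R → R} {D' : Fin 4 → R' → R'}

theorem christoffel_map (φ : R →ₐ[ℝ] R') (hD : ∀ k f, φ (D k f) = D' k (φ f))
    (g : Matrix (Fin 4) (Fin 4) R) (hg : IsUnit g.det) (q m n : Fin 4) :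
    φ (christoffel D g q m n) = christoffel D' (g.map φ) q m n := by
  simp only [christoffel, map_smul, map_sum, map_mul, map_add, map_sub, hD,
    inv_map_of_isUnit_det φ g hg, Matrix.map_apply]

/-- This is applied with `φ` a projection of a product algebra, an evaluation of functions, or the
inclusion of a subalgebra, extended to power series coefficientwise. -/
theorem nonlinearity_map (φ : R →ₐ[ℝ] R') (hD : ∀ k f, φ (D k f) = D' k (φ f))
    (u : Matrix (Fin 4) (Fin 4) R)
    (hu : IsUnit (minkowski.map (algebraMap ℝ R) + u).det) (j k : Fin 4) :
    φ (nonlinearity D u j k) = nonlinearity D' (u.map φ) j k := by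
  have hg : (minkowski.map (algebraMap ℝ R) + u).map φ
      = minkowski.map (algebraMap ℝ R') + u.map φ := by
    ext i l
    simp
  simp only [nonlinearity, Matrix.of_apply, waveOp, reducedRicci, ricci, harmonicity, map_smul,
    map_sum, map_mul, map_add, map_sub, hD, christoffel_map φ hD _ hu,
    ← hg, inv_map_of_isUnit_det φ _ hu, Matrix.map_apply]

end Naturality

/-! ### Graded families of functions closed under products and derivatives -/

section Graded

variable {R : Type*} [CommRing R] [Algebra ℝ R] {D : Fin 4 → R → R} {P : ℕ → Submodule ℝ R}

theorem christoffel_mem (hmul : ∀ d e f g, f ∈ P d → g ∈ P e → f * g ∈ P (d + e))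
    (hD : ∀ d k f, d < 2 → f ∈ P d → D k f ∈ P (d + 1)) (g : Matrix (Fin 4) (Fin 4) R)
    (hg : ∀ i j, g i j ∈ P 0) (hg' : ∀ i j, g⁻¹ i j ∈ P 0) (q m n : Fin 4) :
    christoffel D g q m n ∈ P 1 := by
  refine Submodule.smul_mem _ _ (Submodule.sum_mem _ fun l _ => ?_)
  have h := fun k i j => hD 0 k _ (by norm_num) (hg i j)
  exact hmul 0 1 _ _ (hg' _ _) (Submodule.sub_mem _ (Submodule.add_mem _ (h _ _ _) (h _ _ _)) (h _ _ _))

theorem harmonicity_mem (hmul : ∀ d e f g, f ∈ P d → g ∈ P e → f * g ∈ P (d + e))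
    (hD : ∀ d k f, d < 2 → f ∈ P d → D k f ∈ P (d + 1)) (g : Matrix (Fin 4) (Fin 4) R)
    (hg : ∀ i j, g i j ∈ P 0) (hg' : ∀ i j, g⁻¹ i j ∈ P 0) (n : Fin 4) :
    harmonicity D g n ∈ P 1 :=
  Submodule.sum_mem _ fun _ _ => Submodule.sum_mem _ fun _ _ =>
    hmul 0 1 _ _ (hg' _ _) (christoffel_mem hmul hD g hg hg' _ _ _)

/-- The grading counts derivatives. No term carries more than two, so closedness under `D` is needed
in degrees 0 and 1 only. The restriction matters for products of waves, whose exponents must stay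
positive as long as derivatives are taken. -/
theorem nonlinearity_mem (hmul : ∀ d e f g, f ∈ P d → g ∈ P e → f * g ∈ P (d + e))
    (hD : ∀ d k f, d < 2 → f ∈ P d → D k f ∈ P (d + 1)) (u : Matrix (Fin 4) (Fin 4) R)
    (hu : ∀ i j, u i j ∈ P 0)
    (hg : ∀ i j, (minkowski.map (algebraMap ℝ R) + u) i j ∈ P 0)
    (hg' : ∀ i j, (minkowski.map (algebraMap ℝ R) + u)⁻¹ i j ∈ P 0) (j k : Fin 4) :
    nonlinearity D u j k ∈ P 2 := by
  have hΓ := christoffel_mem hmul hD _ hg hg'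
  have hF := harmonicity_mem hmul hD _ hg hg'
  have hDD : ∀ p q i l, D p (D q (u i l)) ∈ P 2 := fun p q i l =>
    hD 1 p _ (by norm_num) (hD 0 q _ (by norm_num) (hu i l))
  have hDΓ : ∀ p q m n, D p (christoffel D (minkowski.map (algebraMap ℝ R) + u) q m n) ∈ P 2 :=
    fun p q m n => hD 1 p _ (by norm_num) (hΓ q m n)
  have hDF : ∀ p n, D p (harmonicity D (minkowski.map (algebraMap ℝ R) + u) n) ∈ P 2 :=
    fun p n => hD 1 p _ (by norm_num) (hF n)
  simp only [nonlinearity, Matrix.of_apply, waveOp, reducedRicci, ricci]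
  refine Submodule.add_mem _ (Submodule.sum_mem _ fun p _ => Submodule.sum_mem _ fun q _ =>
    Submodule.smul_mem _ _ (hDD _ _ _ _)) (Submodule.smul_mem _ _ (Submodule.sub_mem _
      (Submodule.add_mem _ (Submodule.sum_mem _ fun a _ => ?_)
        (Submodule.sum_mem _ fun a _ => Submodule.sum_mem _ fun c _ => ?_))
      (Submodule.smul_mem _ _ (Submodule.sum_mem _ fun n _ => ?_))))
  · exact Submodule.sub_mem _ (hDΓ _ _ _ _) (hDΓ _ _ _ _)
  · exact Submodule.sub_mem _ (hmul 1 1 _ _ (hΓ _ _ _) (hΓ _ _ _)) (hmul 1 1 _ _ (hΓ _ _ _) (hΓ _ _ _))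
  · exact Submodule.add_mem _ (hmul 0 2 _ _ (hg _ _) (hDF _ _)) (hmul 0 2 _ _ (hg _ _) (hDF _ _))

end Graded

end

end FourWave

namespace FourWave

noncomputable section

/-! ### Square-free coefficients of power series -/

section SquareFree

variable {C : Type*} [CommRing C]

theorem epsExp_apply (S : Finset (Fin 4)) (j : Fin 4) : epsExp S j = if j ∈ S then 1 else 0 := by
  simp [epsExp, Finsupp.finsetSum_apply, Finsupp.single_apply]

theorem epsExp_empty : epsExp ∅ = 0 := by simp [epsExp]

theorem epsExp_support (S : Finset (Fin 4)) : (epsExp S).support = S := by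
  ext j
  simp [epsExp_apply]

theorem epsExp_injective : Function.Injective epsExp := fun S T h => by
  rw [← epsExp_support S, h, epsExp_support]

/-- A decomposition of a square-free exponent into two exponents is a splitting of its support into
two disjoint sets, so square-free coefficients multiply among themselves by subset convolution.
Powers ε_j² never enter. -/
theorem coeff_epsExp_mul (S : Finset (Fin 4)) (f g : MvPowerSeries (Fin 4) C) :
    MvPowerSeries.coeff (epsExp S) (f * g) = ∑ T ∈ S.powerset,
      MvPowerSeries.coeff (epsExp T) f * MvPowerSeries.coeff (epsExp (S \ T)) g := by
  rw [MvPowerSeries.coeff_mul]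
  symm
  refine Finset.sum_nbij' (fun T => (epsExp T, epsExp (S \ T))) (fun p => p.1.support)
    ?_ ?_ ?_ ?_ ?_
  · intro T hT
    rw [Finset.mem_powerset] at hT
    rw [Finset.HasAntidiagonal.mem_antidiagonal]
    ext j
    have := @hT j
    simp only [Finsupp.add_apply, epsExp_apply, Finset.mem_sdiff]
    by_cases h1 : j ∈ T <;> by_cases h2 : j ∈ S <;> simp_all
  · intro p hp
    rw [Finset.HasAntidiagonal.mem_antidiagonal] at hp
    rw [Finset.mem_powerset, ← epsExp_support S, ← hp]
    intro j hj
    simp only [Finsupp.mem_support_iff, Finsupp.add_apply] at hj ⊢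
    omega
  · intro T _
    exact epsExp_support T
  · rintro ⟨p, q⟩ hp
    rw [Finset.HasAntidiagonal.mem_antidiagonal] at hp
    have h : ∀ j, p j + q j = if j ∈ S then 1 else 0 := fun j => by
      rw [← epsExp_apply, ← hp]
      rfl
    refine Prod.ext (Finsupp.ext fun j => ?_) (Finsupp.ext fun j => ?_)
    · have h1 := h j
      simp only [epsExp_apply, Finsupp.mem_support_iff]
      split_ifs at h1 ⊢ <;> omega
    · have h1 := h j
      simp only [epsExp_apply, Finsupp.mem_support_iff, Finset.mem_sdiff]
      have h2 : q j = (if j ∈ S then 1 else 0) - p j := by omega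
      by_cases h3 : p j = 0 <;> by_cases h4 : j ∈ S <;> simp [h2, h3, h4]
      rw [if_pos h4] at h1
      omega
  · intro T _
    rfl

end SquareFree

theorem minkowski_apply (i j : Fin 4) :
    minkowski i j = if i = j then minkowski i i else 0 := by
  fin_cases i <;> fin_cases j <;> simp [minkowski]

theorem minkowski_mul_self_apply (i : Fin 4) : minkowski i i * minkowski i i = 1 := by
  fin_cases i <;> norm_num [minkowski]

theorem sum_minkowski_smul {M : Type*} [AddCommGroup M] [Module ℝ M] (i : Fin 4) (f : Fin 4 → M) :
    ∑ j, minkowski i j • f j = minkowski i i • f i := by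
  rw [Finset.sum_eq_single i]
  · intro j _ hj
    rw [minkowski_apply, if_neg hj.symm, zero_smul]
  · simp

/-! ### The perturbed metric and its inverse, by square-free coefficients -/

section Metric

variable {C : Type*} [CommRing C] [Algebra ℝ C]

theorem coeff_minkowski (i j : Fin 4) (S : Finset (Fin 4)) :
    MvPowerSeries.coeff (epsExp S) (algebraMap ℝ (MvPowerSeries (Fin 4) C) (minkowski i j))
      = if S = ∅ then algebraMap ℝ C (minkowski i j) else 0 := by
  rw [MvPowerSeries.algebraMap_apply, MvPowerSeries.coeff_C]
  simp only [← epsExp_empty, epsExp_injective.eq_iff]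

/-- A power series is a unit iff its constant coefficient is, and here this coefficient is det ĝ =
-1. -/
theorem isUnit_det_metric (u : Matrix (Fin 4) (Fin 4) (MvPowerSeries (Fin 4) C))
    (hu : ∀ i j, MvPowerSeries.coeff (epsExp ∅) (u i j) = 0) :
    IsUnit (minkowski.map (algebraMap ℝ (MvPowerSeries (Fin 4) C)) + u).det := by
  rw [MvPowerSeries.isUnit_iff_constantCoeff, RingHom.map_det]
  have : (MvPowerSeries.constantCoeff (σ := Fin 4) (R := C)).mapMatrix
      (minkowski.map (algebraMap ℝ (MvPowerSeries (Fin 4) C)) + u)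
      = (algebraMap ℝ C).mapMatrix minkowski := by
    ext i j
    have h1 := hu i j
    rw [epsExp_empty] at h1
    simp only [RingHom.mapMatrix_apply, Matrix.map_apply, Matrix.add_apply, map_add]
    rw [← MvPowerSeries.coeff_zero_eq_constantCoeff_apply,
      ← MvPowerSeries.coeff_zero_eq_constantCoeff_apply, h1, add_zero,
      ← epsExp_empty, coeff_minkowski, if_pos rfl]
  rw [this, ← RingHom.map_det]
  have h2 : minkowski.det = -1 := by
    simp [minkowski, Matrix.det_diagonal, Fin.prod_univ_four]
  rw [h2]
  simp

/-- This is the coefficient of `ε^S` in g g⁻¹ = 1, solved for the term in which g contributes its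
constant part ĝ. The remaining terms involve g⁻¹ at strictly smaller sets, so the identity is a
recursion over `S`. -/
theorem coeff_inv_metric (u : Matrix (Fin 4) (Fin 4) (MvPowerSeries (Fin 4) C))
    (hu : ∀ i j, MvPowerSeries.coeff (epsExp ∅) (u i j) = 0) (S : Finset (Fin 4)) (i l : Fin 4) :
    MvPowerSeries.coeff (epsExp S)
        ((minkowski.map (algebraMap ℝ (MvPowerSeries (Fin 4) C)) + u)⁻¹ i l)
      = minkowski i i • ((if S = ∅ ∧ i = l then 1 else 0)
        - ∑ m, ∑ T ∈ S.powerset.erase ∅, MvPowerSeries.coeff (epsExp T) (u i m) *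
          MvPowerSeries.coeff (epsExp (S \ T))
            ((minkowski.map (algebraMap ℝ (MvPowerSeries (Fin 4) C)) + u)⁻¹ m l)) := by
  set g := minkowski.map (algebraMap ℝ (MvPowerSeries (Fin 4) C)) + u with hg
  have h1 : g * g⁻¹ = 1 := Matrix.mul_nonsing_inv g (isUnit_det_metric u hu)
  have h2 := congrArg (fun M : Matrix (Fin 4) (Fin 4) (MvPowerSeries (Fin 4) C) =>
    MvPowerSeries.coeff (epsExp S) (M i l)) h1
  simp only [Matrix.mul_apply, map_sum, coeff_epsExp_mul] at h2
  have h3 : MvPowerSeries.coeff (epsExp S)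
      ((1 : Matrix (Fin 4) (Fin 4) (MvPowerSeries (Fin 4) C)) i l)
      = if S = ∅ ∧ i = l then 1 else 0 := by
    rw [Matrix.one_apply]
    by_cases h : i = l
    · simp only [h, if_true, and_true, MvPowerSeries.coeff_one, ← epsExp_empty,
        epsExp_injective.eq_iff]
    · simp [h]
  rw [h3] at h2
  have h4 : ∀ m, ∑ T ∈ S.powerset, MvPowerSeries.coeff (epsExp T) (g i m) *
        MvPowerSeries.coeff (epsExp (S \ T)) (g⁻¹ m l)
      = minkowski i m • MvPowerSeries.coeff (epsExp S) (g⁻¹ m l)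
        + ∑ T ∈ S.powerset.erase ∅, MvPowerSeries.coeff (epsExp T) (u i m) *
          MvPowerSeries.coeff (epsExp (S \ T)) (g⁻¹ m l) := by
    intro m
    rw [← Finset.add_sum_erase _ _ (Finset.empty_mem_powerset S)]
    congr 1
    · rw [hg, Matrix.add_apply, map_add, hu, add_zero, Matrix.map_apply, coeff_minkowski,
        if_pos rfl, Finset.sdiff_empty, Algebra.smul_def]
    · refine Finset.sum_congr rfl fun T hT => ?_
      rw [Finset.mem_erase] at hT
      rw [hg, Matrix.add_apply, map_add, Matrix.map_apply, coeff_minkowski, if_neg hT.1, zero_add]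
  simp only [h4, Finset.sum_add_distrib, sum_minkowski_smul] at h2
  rw [← h2, add_sub_cancel_right, smul_smul, minkowski_mul_self_apply, one_smul]

/-- The power series whose square-free coefficients lie in given spaces. -/
def coeffSubmodule (V : Finset (Fin 4) → Submodule ℝ C) :
    Submodule ℝ (MvPowerSeries (Fin 4) C) where
  carrier := {f | ∀ S, MvPowerSeries.coeff (epsExp S) f ∈ V S}
  add_mem' := fun hf hg S => by
    rw [map_add]
    exact Submodule.add_mem _ (hf S) (hg S)
  zero_mem' := fun S => by
    rw [map_zero]
    exact Submodule.zero_mem _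
  smul_mem' := fun c f hf S => by
    have : MvPowerSeries.coeff (epsExp S) (c • f) = c • MvPowerSeries.coeff (epsExp S) f := rfl
    rw [this]
    exact Submodule.smul_mem _ _ (hf S)

theorem mem_coeffSubmodule {V : Finset (Fin 4) → Submodule ℝ C} {f : MvPowerSeries (Fin 4) C} :
    f ∈ coeffSubmodule V ↔ ∀ S, MvPowerSeries.coeff (epsExp S) f ∈ V S := Iff.rfl

variable {V : ℕ → Finset (Fin 4) → Submodule ℝ C}

theorem coeffSubmodule_mul
    (hmul : ∀ d e S T f g, Disjoint S T → f ∈ V d S → g ∈ V e T → f * g ∈ V (d + e) (S ∪ T))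
    (d e : ℕ) (f g : MvPowerSeries (Fin 4) C) (hf : f ∈ coeffSubmodule (V d))
    (hg : g ∈ coeffSubmodule (V e)) : f * g ∈ coeffSubmodule (V (d + e)) := by
  intro S
  rw [coeff_epsExp_mul]
  refine Submodule.sum_mem _ fun T hT => ?_
  rw [Finset.mem_powerset] at hT
  have := hmul d e T (S \ T) _ _ Finset.disjoint_sdiff (hf T) (hg _)
  rwa [Finset.union_sdiff_of_subset hT] at this

theorem metric_mem_coeffSubmodule (hone : (1 : C) ∈ V 0 ∅)
    (u : Matrix (Fin 4) (Fin 4) (MvPowerSeries (Fin 4) C))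
    (hu : ∀ i j, u i j ∈ coeffSubmodule (V 0)) (i j : Fin 4) :
    (minkowski.map (algebraMap ℝ (MvPowerSeries (Fin 4) C)) + u) i j
      ∈ coeffSubmodule (V 0) := by
  refine Submodule.add_mem _ (fun S => ?_) (hu i j)
  rw [Matrix.map_apply, coeff_minkowski]
  split_ifs with h
  · rw [h, Algebra.algebraMap_eq_smul_one]
    exact Submodule.smul_mem _ _ hone
  · exact Submodule.zero_mem _

theorem inv_metric_mem_coeffSubmodule (hone : (1 : C) ∈ V 0 ∅)
    (hmul : ∀ d e S T f g, Disjoint S T → f ∈ V d S → g ∈ V e T → f * g ∈ V (d + e) (S ∪ T))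
    (u : Matrix (Fin 4) (Fin 4) (MvPowerSeries (Fin 4) C))
    (hu : ∀ i j, u i j ∈ coeffSubmodule (V 0))
    (hu0 : ∀ i j, MvPowerSeries.coeff (epsExp ∅) (u i j) = 0) (i j : Fin 4) :
    (minkowski.map (algebraMap ℝ (MvPowerSeries (Fin 4) C)) + u)⁻¹ i j
      ∈ coeffSubmodule (V 0) := by
  intro S
  induction S using Finset.strongInduction generalizing i j with
  | H S ih =>
  rw [coeff_inv_metric u hu0]
  refine Submodule.smul_mem _ _ (Submodule.sub_mem _ ?_ (Submodule.sum_mem _ fun m _ =>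
    Submodule.sum_mem _ fun T hT => ?_))
  · split_ifs with h
    · rw [h.1]
      exact hone
    · exact Submodule.zero_mem _
  · rw [Finset.mem_erase, Finset.mem_powerset] at hT
    -- The set `T = ∅` is removed from the sum, so the recursion strictly descends.
    have hss : S \ T ⊂ S := Finset.sdiff_ssubset hT.2 (Finset.nonempty_iff_ne_empty.mpr hT.1)
    have := hmul 0 0 T (S \ T) _ _ Finset.disjoint_sdiff (hu i m T) (ih _ hss m j)
    rwa [Finset.union_sdiff_of_subset hT.2] at this

/-- A way to prove relations between square-free coefficients of the nonlinearity. -/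
theorem nonlinearity_mem_coeffSubmodule {D : Fin 4 → MvPowerSeries (Fin 4) C →
      MvPowerSeries (Fin 4) C} (hone : (1 : C) ∈ V 0 ∅)
    (hmul : ∀ d e S T f g, Disjoint S T → f ∈ V d S → g ∈ V e T → f * g ∈ V (d + e) (S ∪ T))
    (hD : ∀ d k f, d < 2 → f ∈ coeffSubmodule (V d) → D k f ∈ coeffSubmodule (V (d + 1)))
    (u : Matrix (Fin 4) (Fin 4) (MvPowerSeries (Fin 4) C))
    (hu : ∀ i j, u i j ∈ coeffSubmodule (V 0))
    (hu0 : ∀ i j, MvPowerSeries.coeff (epsExp ∅) (u i j) = 0) (j k : Fin 4) :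
    nonlinearity D u j k ∈ coeffSubmodule (V 2) :=
  nonlinearity_mem (coeffSubmodule_mul hmul) hD u hu
    (metric_mem_coeffSubmodule hone u hu)
    (inv_metric_mem_coeffSubmodule hone hmul u hu hu0) j k

end Metric

end

end FourWave

namespace FourWave

noncomputable section

/-! ### The nonlinearity in momentum space -/

section Momentum

variable {C C' : Type*} [CommRing C] [CommRing C']

/-- The derivative `∂_k`, when `ε_j` stands for a wave `exp (ζ_j · x)`. -/
def momDeriv (ζ : Fin 4 → Fin 4 → C) (k : Fin 4) (f : MvPowerSeries (Fin 4) C) :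
    MvPowerSeries (Fin 4) C :=
  fun n => (∑ j, (n j : C) * ζ j k) * MvPowerSeries.coeff n f

/-- The tensor field `ε^S w`. -/
def epsTensor (S : Finset (Fin 4)) (w : Matrix (Fin 4) (Fin 4) C) :
    Matrix (Fin 4) (Fin 4) (MvPowerSeries (Fin 4) C) :=
  w.map fun f => MvPowerSeries.monomial (epsExp S) f

/-- The momentum of the wave produced by the waves in `S`. -/
def totalMom (ζ : Fin 4 → Fin 4 → C) (S : Finset (Fin 4)) (k : Fin 4) : C := ∑ j ∈ S, ζ j k

theorem totalMom_empty (ζ : Fin 4 → Fin 4 → C) (k : Fin 4) : totalMom ζ ∅ k = 0 := by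
  simp [totalMom]

theorem coeff_momDeriv (ζ : Fin 4 → Fin 4 → C) (k : Fin 4) (f : MvPowerSeries (Fin 4) C)
    (S : Finset (Fin 4)) : MvPowerSeries.coeff (epsExp S) (momDeriv ζ k f)
      = totalMom ζ S k * MvPowerSeries.coeff (epsExp S) f := by
  have h : MvPowerSeries.coeff (epsExp S) (momDeriv ζ k f)
      = (∑ j, ((epsExp S j : ℕ) : C) * ζ j k) * MvPowerSeries.coeff (epsExp S) f := rfl
  rw [h, totalMom]
  congr 1
  simp [epsExp_apply, Finset.sum_ite_mem]

theorem coeff_epsTensor (S T : Finset (Fin 4)) (w : Matrix (Fin 4) (Fin 4) C) (i j : Fin 4) :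
    MvPowerSeries.coeff (epsExp T) (epsTensor S w i j) = if T = S then w i j else 0 := by
  simp only [epsTensor, Matrix.map_apply, MvPowerSeries.coeff_monomial, epsExp_injective.eq_iff]

variable [Algebra ℝ C] [Algebra ℝ C']

/-- The coefficient of `ε^S` in the nonlinearity. -/
def momSource (ζ : Fin 4 → Fin 4 → C) (S : Finset (Fin 4))
    (u : Matrix (Fin 4) (Fin 4) (MvPowerSeries (Fin 4) C)) : Matrix (Fin 4) (Fin 4) C :=
  (nonlinearity (momDeriv ζ) u).map fun f => MvPowerSeries.coeff (epsExp S) f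

/-- The coefficientwise extension of `φ` intertwines the derivatives `momDeriv`, since these are
multiplications by momenta. -/
theorem momSource_map (φ : C →ₐ[ℝ] C') (ζ : Fin 4 → Fin 4 → C) (S : Finset (Fin 4))
    (u : Matrix (Fin 4) (Fin 4) (MvPowerSeries (Fin 4) C))
    (hu : ∀ i j, MvPowerSeries.coeff (epsExp ∅) (u i j) = 0) :
    (momSource ζ S u).map φ
      = momSource (fun j k => φ (ζ j k)) S (u.map (MvPowerSeries.mapAlgHom φ)) := by
  ext i j
  simp only [momSource, Matrix.map_apply]
  rw [← nonlinearity_map (MvPowerSeries.mapAlgHom φ) (D := momDeriv ζ) ?_ u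
    (isUnit_det_metric u hu)]
  · rfl
  · intro k f
    ext n
    change φ ((∑ j, (n j : C) * ζ j k) * MvPowerSeries.coeff n f)
      = (∑ j, (n j : C') * φ (ζ j k)) * φ (MvPowerSeries.coeff n f)
    simp

theorem epsTensor_map (φ : C →ₐ[ℝ] C') (S : Finset (Fin 4)) (w : Matrix (Fin 4) (Fin 4) C) :
    (epsTensor S w).map (MvPowerSeries.mapAlgHom φ) = epsTensor S (w.map φ) := by
  ext i j n
  change φ (MvPowerSeries.coeff n (MvPowerSeries.monomial (epsExp S) (w i j))) =
    MvPowerSeries.coeff n (MvPowerSeries.monomial (epsExp S) (φ (w i j)))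
  rw [MvPowerSeries.coeff_monomial, MvPowerSeries.coeff_monomial]
  split_ifs <;> simp

end Momentum

/-! ### From products of waves to momentum space -/

section Waves

/-- The Laplace transform of `∏ X_j ^ α_j` at the point `c`, up to the factor `∏ c_j`. -/
def laplaceWeight (c : Fin 4 → ℝ) (α : Fin 4 →₀ ℕ) : ℝ :=
  ∏ j, ((α j).factorial : ℝ) / c j ^ α j

/-- Exponents of the waves in the terms proportional to `ε^S` of a quantity with `d` derivatives:
`w` are the degrees of homogeneity of the waves, and `K` is a lower bound for the exponents in
terms without derivatives. -/
def GoodExponent (K : ℕ) (w : Fin 4 → ℕ) (d : ℕ) (S : Finset (Fin 4)) (α : Fin 4 →₀ ℕ) : Prop :=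
  (∀ j, j ∉ S → α j = 0) ∧ (∀ j, j ∈ S → K ≤ α j + d) ∧ ∑ j, α j + d = ∑ j ∈ S, w j

/-- Pairs consisting of a linear combination of products of waves and its Laplace transform. -/
def WaveRel (c : Fin 4 → ℝ) (K : ℕ) (w : Fin 4 → ℕ) (d : ℕ) (S : Finset (Fin 4)) :
    Submodule ℝ (WaveAlg × ℂ) :=
  Submodule.span ℝ {p | ∃ α, GoodExponent K w d S α ∧
    p = (MvPolynomial.monomial α 1, (laplaceWeight c α : ℂ))}

variable {c : Fin 4 → ℝ} {K : ℕ} {w : Fin 4 → ℕ}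

theorem monomial_mem_waveRel {d : ℕ} {S : Finset (Fin 4)} {α : Fin 4 →₀ ℕ}
    (h : GoodExponent K w d S α) :
    ((MvPolynomial.monomial α 1, (laplaceWeight c α : ℂ)) : WaveAlg × ℂ) ∈ WaveRel c K w d S :=
  Submodule.subset_span ⟨α, h, rfl⟩

theorem one_mem_waveRel : (1 : WaveAlg × ℂ) ∈ WaveRel c K w 0 ∅ := by
  have := monomial_mem_waveRel (c := c) (K := K) (w := w) (d := 0) (S := ∅) (α := 0)
    ⟨by simp, by simp, by simp⟩
  convert this using 1
  exact Prod.ext (by simp) (by simp [laplaceWeight])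

/-- Factorials are not multiplicative in the exponent. The identity rests on the two monomials
involving disjoint sets of waves, as in all products that contribute to square-free coefficients. -/
theorem laplaceWeight_add {S T : Finset (Fin 4)} (hST : Disjoint S T) {α β : Fin 4 →₀ ℕ}
    (hα : ∀ j, j ∉ S → α j = 0) (hβ : ∀ j, j ∉ T → β j = 0) :
    laplaceWeight c (α + β) = laplaceWeight c α * laplaceWeight c β := by
  rw [laplaceWeight, laplaceWeight, laplaceWeight, ← Finset.prod_mul_distrib]
  refine Finset.prod_congr rfl fun j _ => ?_
  by_cases hj : j ∈ S
  · rw [Finsupp.add_apply, hβ j (Finset.disjoint_left.mp hST hj)]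
    simp
  · rw [Finsupp.add_apply, hα j hj]
    simp

theorem GoodExponent.add {d e : ℕ} {S T : Finset (Fin 4)} {α β : Fin 4 →₀ ℕ}
    (hST : Disjoint S T) (hα : GoodExponent K w d S α) (hβ : GoodExponent K w e T β) :
    GoodExponent K w (d + e) (S ∪ T) (α + β) := by
  refine ⟨fun j hj => ?_, fun j hj => ?_, ?_⟩
  · rw [Finset.mem_union, not_or] at hj
    simp [hα.1 j hj.1, hβ.1 j hj.2]
  · rw [Finsupp.add_apply]
    rcases Finset.mem_union.mp hj with h | h
    · have := hα.2.1 j h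
      omega
    · have := hβ.2.1 j h
      omega
  · rw [Finset.sum_union hST, ← hα.2.2, ← hβ.2.2]
    simp only [Finsupp.add_apply, Finset.sum_add_distrib]
    ring

theorem waveRel_mul (d e : ℕ) (S T : Finset (Fin 4)) (f g : WaveAlg × ℂ) (hST : Disjoint S T)
    (hf : f ∈ WaveRel c K w d S) (hg : g ∈ WaveRel c K w e T) :
    f * g ∈ WaveRel c K w (d + e) (S ∪ T) := by
  have h := Submodule.mul_mem_mul hf hg
  rw [WaveRel, WaveRel, Submodule.span_mul_span] at h
  refine Submodule.span_le.mpr ?_ h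
  rintro _ ⟨_, ⟨α, hα, rfl⟩, _, ⟨β, hβ, rfl⟩, rfl⟩
  have := monomial_mem_waveRel (c := c) (hα.add hST hβ)
  rw [laplaceWeight_add hST hα.1 hβ.1] at this
  simpa [MvPolynomial.monomial_mul] using this

/-- Real momenta proportional to the directions of the waves. -/
def waveMom (c : Fin 4 → ℝ) (b : Fin 5 → Covector) (j k : Fin 4) : ℂ :=
  ((c j * b j.castSucc k : ℝ) : ℂ)

/-- The derivative of a pair in `WaveRel`. -/
def pairDeriv (b : Fin 5 → Covector) (k : Fin 4) (z : ℂ) : WaveAlg × ℂ →ₗ[ℝ] WaveAlg × ℂ where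
  toFun p := (waveDeriv b k p.1, z * p.2)
  map_add' p q := by
    simp [waveDeriv, mul_add, Finset.sum_add_distrib]
  map_smul' r p := by
    refine Prod.ext (by simp [waveDeriv, Finset.smul_sum]) ?_
    change z * (r • p.2) = r • (z * p.2)
    rw [mul_smul_comm]

/-- Differentiation in y_j becomes multiplication by c_j under the Laplace transform: m (m-1)! /
c^(m-1) = c · m! / c^m. -/
theorem laplaceWeight_sub_single {α : Fin 4 →₀ ℕ} {j : Fin 4} (hj : α j ≠ 0) (hc : c j ≠ 0) :
    (α j : ℝ) * laplaceWeight c (α - Finsupp.single j 1) = c j * laplaceWeight c α := by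
  rw [laplaceWeight, laplaceWeight, ← Finset.mul_prod_erase _ _ (Finset.mem_univ j),
    ← Finset.mul_prod_erase (a := j) _ _ (Finset.mem_univ j)]
  have h1 : ∏ i ∈ Finset.univ.erase j, ((((α - Finsupp.single j 1 : Fin 4 →₀ ℕ)) i).factorial : ℝ)
        / c i ^ (α - Finsupp.single j 1 : Fin 4 →₀ ℕ) i
      = ∏ i ∈ Finset.univ.erase j, ((α i).factorial : ℝ) / c i ^ α i := by
    refine Finset.prod_congr rfl fun i hi => ?_
    have : (α - Finsupp.single j 1 : Fin 4 →₀ ℕ) i = α i := by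
      simp [(Finset.ne_of_mem_erase hi).symm]
    rw [this]
  rw [h1, ← mul_assoc, ← mul_assoc]
  congr 1
  obtain ⟨m, hm⟩ := Nat.exists_eq_succ_of_ne_zero hj
  have h2 : (α - Finsupp.single j 1 : Fin 4 →₀ ℕ) j = m := by simp [hm]
  rw [h2, hm, Nat.factorial_succ, Nat.succ_eq_add_one, pow_succ]
  push_cast
  field_simp

/-- The bounds 2 ≤ `K` and `d` < 2 force every exponent in `S` to be at least one before the
derivative is taken. With exponent zero the monomial would be annihilated while its transform is
merely multiplied by c_j, and the relation would fail. -/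
theorem pairDeriv_mem (hc : ∀ j, c j ≠ 0) (hK : 2 ≤ K) (b : Fin 5 → Covector) (k : Fin 4) {d : ℕ}
    (hd : d < 2) (S : Finset (Fin 4)) (p : WaveAlg × ℂ) (hp : p ∈ WaveRel c K w d S) :
    pairDeriv b k (totalMom (waveMom c b) S k) p ∈ WaveRel c K w (d + 1) S := by
  suffices h : WaveRel c K w d S ≤ (WaveRel c K w (d + 1) S).comap
      (pairDeriv b k (totalMom (waveMom c b) S k)) from h hp
  refine Submodule.span_le.mpr ?_
  rintro _ ⟨α, hα, rfl⟩
  have h1 : pairDeriv b k (totalMom (waveMom c b) S k)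
        (MvPolynomial.monomial α 1, (laplaceWeight c α : ℂ))
      = ∑ j ∈ S, (b j.castSucc k * α j) • ((MvPolynomial.monomial (α - Finsupp.single j 1) 1,
        (laplaceWeight c (α - Finsupp.single j 1) : ℂ)) : WaveAlg × ℂ) := by
    refine Prod.ext ?_ ?_
    · rw [Prod.fst_sum]
      change waveDeriv b k (MvPolynomial.monomial α 1) = _
      rw [waveDeriv, ← Finset.sum_subset (Finset.subset_univ S)]
      · refine Finset.sum_congr rfl fun j _ => ?_
        rw [MvPolynomial.pderiv_monomial, MvPolynomial.C_mul_monomial]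
        simp [MvPolynomial.smul_monomial]
      · intro j _ hj
        rw [MvPolynomial.pderiv_monomial, hα.1 j hj]
        simp
    · rw [Prod.snd_sum]
      change totalMom (waveMom c b) S k * (laplaceWeight c α : ℂ) = _
      rw [totalMom, Finset.sum_mul]
      refine Finset.sum_congr rfl fun j hj => ?_
      have h2 := laplaceWeight_sub_single (c := c) (α := α) (j := j)
        (by have := hα.2.1 j hj; omega) (hc j)
      simp only [Prod.smul_mk, Complex.real_smul, waveMom]
      rw [← Complex.ofReal_mul, ← Complex.ofReal_mul, mul_assoc (b _ _), h2]
      congr 1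
      ring
  rw [SetLike.mem_coe, Submodule.mem_comap, h1]
  refine Submodule.sum_mem _ fun j hj => Submodule.smul_mem _ _ (monomial_mem_waveRel ?_)
  have hj0 := hα.2.1 j hj
  have hle : Finsupp.single j 1 ≤ α := by
    rw [Finsupp.single_le_iff]
    omega
  refine ⟨fun i hi => ?_, fun i hi => ?_, ?_⟩
  · rw [Finsupp.tsub_apply, hα.1 i hi, zero_tsub]
  · have := hα.2.1 i hi
    rw [Finsupp.tsub_apply, Finsupp.single_apply]
    split_ifs <;> omega
  · rw [← hα.2.2]
    have h3 : ∑ i, α i = ∑ i, (α - Finsupp.single j 1 : Fin 4 →₀ ℕ) i + 1 := by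
      conv_lhs => rw [← tsub_add_cancel_of_le hle]
      simp only [Finsupp.add_apply, Finset.sum_add_distrib]
      congr 1
      simp [Finsupp.single_apply]
    omega

/-- The derivatives of a power series of pairs. -/
def pairExpDeriv (c : Fin 4 → ℝ) (b : Fin 5 → Covector) (k : Fin 4)
    (f : MvPowerSeries (Fin 4) (WaveAlg × ℂ)) : MvPowerSeries (Fin 4) (WaveAlg × ℂ) :=
  fun n => pairDeriv b k (∑ j, (n j : ℂ) * waveMom c b j k) (MvPowerSeries.coeff n f)

/-- The two arguments are combined into one matrix over power series with coefficients in `WaveAlg ×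
ℂ`. The nonlinearity is evaluated there, where `WaveRel` is respected by products and derivatives,
and the two projections recover both sources. -/
theorem source_mem_waveRel (hc : ∀ j, c j ≠ 0) (hK : 2 ≤ K) (b : Fin 5 → Covector)
    (u : Matrix (Fin 4) (Fin 4) Expansion)
    (m : Matrix (Fin 4) (Fin 4) (MvPowerSeries (Fin 4) ℂ))
    (hu : ∀ i j S, (MvPowerSeries.coeff (epsExp S) (u i j), MvPowerSeries.coeff (epsExp S) (m i j))
      ∈ WaveRel c K w 0 S)
    (hu0 : ∀ i j, MvPowerSeries.coeff (epsExp ∅) (u i j) = 0)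
    (hm0 : ∀ i j, MvPowerSeries.coeff (epsExp ∅) (m i j) = 0) (S : Finset (Fin 4)) (j k : Fin 4) :
    (source b S u j k, momSource (waveMom c b) S m j k) ∈ WaveRel c K w 2 S := by
  set v : Matrix (Fin 4) (Fin 4) (MvPowerSeries (Fin 4) (WaveAlg × ℂ)) := Matrix.of fun i j n =>
    (MvPowerSeries.coeff n (u i j), MvPowerSeries.coeff n (m i j)) with hv
  have hv0 : ∀ i j, MvPowerSeries.coeff (epsExp ∅) (v i j) = 0 := fun i j =>
    Prod.ext (hu0 i j) (hm0 i j)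
  have h := nonlinearity_mem_coeffSubmodule (V := WaveRel c K w) (D := pairExpDeriv c b)
    one_mem_waveRel waveRel_mul ?_ v (fun i j S => hu i j S) hv0 j k S
  · have h1 := nonlinearity_map (MvPowerSeries.mapAlgHom (AlgHom.fst ℝ WaveAlg ℂ))
      (D := pairExpDeriv c b) (D' := expDeriv b) (fun k f => rfl) v (isUnit_det_metric v hv0) j k
    have h2 := nonlinearity_map (MvPowerSeries.mapAlgHom (AlgHom.snd ℝ WaveAlg ℂ))
      (D := pairExpDeriv c b) (D' := momDeriv (waveMom c b)) (fun k f => rfl) v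
      (isUnit_det_metric v hv0) j k
    have h3 : v.map (MvPowerSeries.mapAlgHom (AlgHom.fst ℝ WaveAlg ℂ)) = u := rfl
    have h4 : v.map (MvPowerSeries.mapAlgHom (AlgHom.snd ℝ WaveAlg ℂ)) = m := rfl
    rw [h3] at h1
    rw [h4] at h2
    have h5 : (source b S u j k, momSource (waveMom c b) S m j k)
        = MvPowerSeries.coeff (epsExp S) (nonlinearity (pairExpDeriv c b) v j k) := by
      simp only [source, momSource, Matrix.map_apply, ← h1, ← h2]
      rfl
    rw [h5]
    exact h
  · intro d k f hd hf S
    have := pairDeriv_mem hc hK b k hd S _ (hf S)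
    convert this using 1
    change pairDeriv b k (∑ j, (epsExp S j : ℂ) * waveMom c b j k) _ = _
    congr 2
    simp [totalMom, epsExp_apply, Finset.sum_ite_mem]

end Waves

end

end FourWave

namespace FourWave

noncomputable section

/-! ### The interaction amplitude in momentum space -/

section Amplitude

variable {C : Type*} [CommRing C]

/-- `∑_j ε_j x_j`. -/
def linField (x : Fin 4 → Matrix (Fin 4) (Fin 4) C) :
    Matrix (Fin 4) (Fin 4) (MvPowerSeries (Fin 4) C) :=
  ∑ j, epsTensor {j} (x j)

/-- `∑_j ε_j x_j + ∑_{i < j} ε_i ε_j P_{ij}`. -/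
def quadField (x : Fin 4 → Matrix (Fin 4) (Fin 4) C)
    (P : Fin 4 → Fin 4 → Matrix (Fin 4) (Fin 4) C) :
    Matrix (Fin 4) (Fin 4) (MvPowerSeries (Fin 4) C) :=
  linField x + ∑ i, ∑ j ∈ Finset.Ioi i, epsTensor {i, j} (P i j)

theorem coeff_empty_epsTensor {S : Finset (Fin 4)} (hS : S ≠ ∅) (w : Matrix (Fin 4) (Fin 4) C)
    (i j : Fin 4) : MvPowerSeries.coeff (epsExp ∅) (epsTensor S w i j) = 0 := by
  rw [coeff_epsTensor, if_neg hS.symm]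

theorem coeff_linField (x : Fin 4 → Matrix (Fin 4) (Fin 4) C) (S : Finset (Fin 4))
    (i j : Fin 4) : MvPowerSeries.coeff (epsExp S) (linField x i j)
      = ∑ l, if S = {l} then x l i j else 0 := by
  simp only [linField, Matrix.sum_apply, map_sum, coeff_epsTensor]

theorem coeff_quadField (x : Fin 4 → Matrix (Fin 4) (Fin 4) C)
    (P : Fin 4 → Fin 4 → Matrix (Fin 4) (Fin 4) C) (S : Finset (Fin 4)) (i j : Fin 4) :
    MvPowerSeries.coeff (epsExp S) (quadField x P i j)
      = (∑ l, if S = {l} then x l i j else 0)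
        + ∑ l, ∑ m ∈ Finset.Ioi l, if S = {l, m} then P l m i j else 0 := by
  simp only [quadField, Matrix.add_apply, map_add, coeff_linField, Matrix.sum_apply, map_sum,
    coeff_epsTensor]

theorem coeff_empty_linField (x : Fin 4 → Matrix (Fin 4) (Fin 4) C) (i j : Fin 4) :
    MvPowerSeries.coeff (epsExp ∅) (linField x i j) = 0 := by
  simp [coeff_linField, (Finset.singleton_ne_empty _).symm]

theorem coeff_empty_quadField (x : Fin 4 → Matrix (Fin 4) (Fin 4) C)
    (P : Fin 4 → Fin 4 → Matrix (Fin 4) (Fin 4) C) (i j : Fin 4) :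
    MvPowerSeries.coeff (epsExp ∅) (quadField x P i j) = 0 := by
  simp [coeff_quadField, (Finset.singleton_ne_empty _).symm, (Finset.insert_ne_empty _ _).symm]

variable [Algebra ℝ C]

/-- The waves produced by two-wave interactions, with propagators `r`. -/
def pairTensor (ζ : Fin 4 → Fin 4 → C) (r : Fin 4 → Fin 4 → C)
    (x : Fin 4 → Matrix (Fin 4) (Fin 4) C) (i j : Fin 4) : Matrix (Fin 4) (Fin 4) C :=
  r i j • momSource ζ {i, j} (linField x)

/-- The interaction term that contains the product of three waves other than `j`. -/
def tripleTerm (ζ : Fin 4 → Fin 4 → C) (x : Fin 4 → Matrix (Fin 4) (Fin 4) C)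
    (P : Fin 4 → Fin 4 → Matrix (Fin 4) (Fin 4) C) (j : Fin 4) : Matrix (Fin 4) (Fin 4) C :=
  momSource ζ Finset.univ
    (epsTensor {j} (x j) + epsTensor {j}ᶜ (momSource ζ {j}ᶜ (quadField x P)))

/-- The interaction terms without interactions of three waves. -/
def quarticTerm (ζ : Fin 4 → Fin 4 → C) (x : Fin 4 → Matrix (Fin 4) (Fin 4) C)
    (P : Fin 4 → Fin 4 → Matrix (Fin 4) (Fin 4) C) : Matrix (Fin 4) (Fin 4) C :=
  momSource ζ Finset.univ (quadField x P)

/-- The pairing `ĝ^{nj} ĝ^{mk} w_{nm} F_{jk}`. -/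
def contractMom (w : Tensor) (F : Matrix (Fin 4) (Fin 4) C) : C :=
  ∑ j, ∑ k, (minkowski * w * minkowski) j k • F j k

end Amplitude

/-! ### The four-wave interaction and the amplitude -/

section Interaction

variable {c : Fin 4 → ℝ} {K : ℕ} {w : Fin 4 → ℕ}

/-- Only the sum of the degrees `w` over `S` is constrained, and derivatives may be traded against
degrees and against the lower bound. -/
theorem WaveRel.mono {K' : ℕ} {w' : Fin 4 → ℕ} {d d' : ℕ} {S : Finset (Fin 4)}
    (hK : K' + d ≤ K + d') (hw : ∑ j ∈ S, w' j + d = ∑ j ∈ S, w j + d') :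
    WaveRel c K w d S ≤ WaveRel c K' w' d' S := by
  refine Submodule.span_mono ?_
  rintro _ ⟨α, hα, rfl⟩
  refine ⟨α, ⟨hα.1, fun j hj => ?_, ?_⟩, rfl⟩
  · have := hα.2.1 j hj
    omega
  · have := hα.2.2
    omega

theorem waveRel_eps {S T : Finset (Fin 4)} {d : ℕ} {f : Matrix (Fin 4) (Fin 4) WaveAlg}
    {m : Matrix (Fin 4) (Fin 4) ℂ} (h : ∀ i j, (f i j, m i j) ∈ WaveRel c K w d T) (i j : Fin 4) :
    (MvPowerSeries.coeff (epsExp S) (withEps T f i j),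
      MvPowerSeries.coeff (epsExp S) (epsTensor T m i j)) ∈ WaveRel c K w d S := by
  have : withEps T f = epsTensor T f := rfl
  rw [this, coeff_epsTensor, coeff_epsTensor]
  split_ifs with hS
  · rw [hS]
    exact h i j
  · exact Submodule.zero_mem _

theorem waveRel_eps_add {T T' : Finset (Fin 4)} {d : ℕ} {f f' : Matrix (Fin 4) (Fin 4) WaveAlg}
    {m m' : Matrix (Fin 4) (Fin 4) ℂ} (h : ∀ i j, (f i j, m i j) ∈ WaveRel c K w d T)
    (h' : ∀ i j, (f' i j, m' i j) ∈ WaveRel c K w d T') (i j : Fin 4) (S : Finset (Fin 4)) :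
    (MvPowerSeries.coeff (epsExp S) ((withEps T f + withEps T' f') i j),
      MvPowerSeries.coeff (epsExp S) ((epsTensor T m + epsTensor T' m') i j))
      ∈ WaveRel c K w d S := by
  have h1 := Submodule.add_mem _ (waveRel_eps (S := S) h i j) (waveRel_eps (S := S) h' i j)
  rw [Prod.mk_add_mk] at h1
  rw [Matrix.add_apply, Matrix.add_apply, map_add, map_add]
  exact h1

/-- The momentum space amplitude of a plane wave. -/
def planeAmp (a : ℕ) (c : Fin 4 → ℝ) (v : Fin 5 → Tensor) (j : Fin 4) :
    Matrix (Fin 4) (Fin 4) ℂ :=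
  (v j.castSucc).map fun t => (((a.factorial : ℝ) / c j ^ a * t : ℝ) : ℂ)

theorem planeWave_mem_waveRel {a : ℕ} (hK : K ≤ a) (v : Fin 5 → Tensor) (j : Fin 4)
    (hw : w j = a) (i l : Fin 4) :
    (planeWave a v j i l, planeAmp a c v j i l) ∈ WaveRel c K w 0 {j} := by
  have h := Submodule.smul_mem _ (v j.castSucc i l) (monomial_mem_waveRel (c := c) (K := K) (w := w)
    (d := 0) (S := {j}) (α := Finsupp.single j a) ⟨?_, ?_, ?_⟩)
  · convert h using 1
    refine Prod.ext ?_ ?_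
    · simp [planeWave, MvPolynomial.C_mul_X_pow_eq_monomial, MvPolynomial.smul_monomial]
    · simp only [planeAmp, Matrix.map_apply, Prod.smul_snd, Complex.real_smul,
        ← Complex.ofReal_mul]
      rw [laplaceWeight, Finset.prod_eq_single j]
      · rw [Finsupp.single_eq_same]
        congr 1
        ring
      · intro i _ hi
        simp [hi.symm]
      · simp
  · intro i hi
    rw [Finset.mem_singleton] at hi
    simp [Ne.symm hi]
  · intro i hi
    rw [Finset.mem_singleton] at hi
    simp [hi, hK]
  · simp [hw, Finsupp.single_apply]

theorem laplaceWeight_add_single (α : Fin 4 →₀ ℕ) (j : Fin 4) (hc : c j ≠ 0) :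
    c j * laplaceWeight c (α + Finsupp.single j 1) = ((α j : ℝ) + 1) * laplaceWeight c α := by
  have h := laplaceWeight_sub_single (c := c) (α := α + Finsupp.single j 1) (j := j) (by simp) hc
  rw [add_tsub_cancel_right] at h
  rw [← h]
  simp

theorem sum_add_single (α : Fin 4 →₀ ℕ) (j : Fin 4) :
    ∑ i, (α + Finsupp.single j 1 : Fin 4 →₀ ℕ) i = ∑ i, α i + 1 := by
  simp only [Finsupp.add_apply, Finset.sum_add_distrib]
  congr 1
  simp [Finsupp.single_apply]

/-- An operator given by its values on monomials is linear. -/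
def monomialMap (φ : (Fin 4 →₀ ℕ) → ℝ → WaveAlg)
    (hφ : ∀ s, φ s 0 = 0) (hadd : ∀ s x y, φ s (x + y) = φ s x + φ s y)
    (hmul : ∀ s (r x : ℝ), φ s (r * x) = r • φ s x) : WaveAlg →ₗ[ℝ] WaveAlg where
  toFun p := ∑ s ∈ p.support, φ s (MvPolynomial.coeff s p)
  map_add' p q := by
    have h : ∀ (t : Finset (Fin 4 →₀ ℕ)) (f : WaveAlg), f.support ⊆ t →
        ∑ s ∈ f.support, φ s (MvPolynomial.coeff s f) = ∑ s ∈ t, φ s (MvPolynomial.coeff s f) :=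
      fun t f ht => Finset.sum_subset ht fun s _ hs => by
        rw [MvPolynomial.notMem_support_iff.mp hs, hφ]
    rw [h (p.support ∪ q.support) (p + q) MvPolynomial.support_add,
      h _ p Finset.subset_union_left, h _ q Finset.subset_union_right, ← Finset.sum_add_distrib]
    exact Finset.sum_congr rfl fun s _ => by rw [MvPolynomial.coeff_add, hadd]
  map_smul' r p := by
    rw [RingHom.id_apply, Finset.smul_sum]
    refine (Finset.sum_subset MvPolynomial.support_smul fun s _ hs => ?_).trans
      (Finset.sum_congr rfl fun s _ => ?_)
    · rw [MvPolynomial.notMem_support_iff.mp hs, hφ]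
    · rw [MvPolynomial.coeff_smul, smul_eq_mul, hmul]

theorem map_mem_waveRel {d : ℕ} {S : Finset (Fin 4)} {V : Submodule ℝ (WaveAlg × ℂ)}
    (L : WaveAlg →ₗ[ℝ] WaveAlg) (r : ℝ)
    (hL : ∀ α, GoodExponent K w d S α →
      (L (MvPolynomial.monomial α 1), ((r * laplaceWeight c α : ℝ) : ℂ)) ∈ V)
    {f : WaveAlg} {m : ℂ} (h : (f, m) ∈ WaveRel c K w d S) : (L f, (r : ℂ) * m) ∈ V := by
  let M : WaveAlg × ℂ →ₗ[ℝ] WaveAlg × ℂ := L.prodMap (LinearMap.lsmul ℝ ℂ r)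
  have h1 : WaveRel c K w d S ≤ V.comap M := by
    refine Submodule.span_le.mpr ?_
    rintro _ ⟨α, hα, rfl⟩
    have := hL α hα
    simp only [SetLike.mem_coe, Submodule.mem_comap]
    convert this using 1
    simp [M]
  have h2 := h1 h
  simp only [Submodule.mem_comap] at h2
  convert h2 using 1
  simp [M]

/-- Raising both exponents multiplies the transform by (m+1)(n+1) / (c_i c_j). This cancels the
denominators of Q₀ and leaves the constant 1 / (2 ĝ(ζ_i, ζ_j)), the inverse of the square of the
null sum ζ_i + ζ_j. Two derivatives are undone, but each exponent gains only one, so the bound drops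
from `K + 1` to `K`. -/
theorem parametrix_mem_waveRel (hc : ∀ j, c j ≠ 0) (b : Fin 5 → Covector) {i j : Fin 4}
    (hij : i ≠ j) {f : WaveAlg} {m : ℂ} (h : (f, m) ∈ WaveRel c (K + 1) w 2 {i, j}) :
    (parametrix b i j f,
      (((2 * c i * c j * pairing (b i.castSucc) (b j.castSucc))⁻¹ : ℝ) : ℂ) * m)
      ∈ WaveRel c K w 0 {i, j} := by
  let L := monomialMap (fun s x => MvPolynomial.monomial
    (s + Finsupp.single i 1 + Finsupp.single j 1)
      (x / (2 * ((s i : ℝ) + 1) * ((s j : ℝ) + 1) * pairing (b i.castSucc) (b j.castSucc))))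
    (fun s => by simp) (fun s x y => by rw [add_div, map_add])
    (fun s r x => by rw [MvPolynomial.smul_monomial, smul_eq_mul, mul_div_assoc])
  refine map_mem_waveRel L _ (fun α hα => ?_) h
  have h1 := Submodule.smul_mem _
    (1 / (2 * ((α i : ℝ) + 1) * ((α j : ℝ) + 1) * pairing (b i.castSucc) (b j.castSucc)))
    (monomial_mem_waveRel (c := c) (K := K) (w := w) (d := 0) (S := {i, j})
      (α := α + Finsupp.single i 1 + Finsupp.single j 1) ⟨?_, ?_, ?_⟩)
  · convert h1 using 1
    refine Prod.ext ?_ ?_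
    · change ∑ s ∈ (MvPolynomial.monomial α (1 : ℝ)).support, _ = _
      rw [MvPolynomial.support_monomial, if_neg one_ne_zero]
      simp [MvPolynomial.smul_monomial]
    · simp only [Prod.smul_snd, Complex.real_smul, ← Complex.ofReal_mul]
      congr 1
      have h2 := laplaceWeight_add_single α i (hc i)
      have h3 := laplaceWeight_add_single (α + Finsupp.single i 1) j (hc j)
      have h4 : (α + Finsupp.single i 1 : Fin 4 →₀ ℕ) j = α j := by
        simp [hij]
      rw [h4] at h3
      have hi := hc i
      have hj := hc j
      have h5 : laplaceWeight c (α + Finsupp.single i 1 + Finsupp.single j 1)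
          = ((α i : ℝ) + 1) * ((α j : ℝ) + 1) * laplaceWeight c α / (c i * c j) := by
        rw [eq_div_iff (mul_ne_zero hi hj)]
        linear_combination c i * h3 + ((α j : ℝ) + 1) * h2
      rw [h5]
      have h6 : (α i : ℝ) + 1 ≠ 0 := by positivity
      have h7 : (α j : ℝ) + 1 ≠ 0 := by positivity
      field_simp
  · intro l hl
    have h2 := hα.1 l hl
    simp only [Finset.mem_insert, Finset.mem_singleton, not_or] at hl
    simp [h2, Ne.symm hl.1, Ne.symm hl.2]
  · intro l hl
    have h2 := hα.2.1 l hl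
    simp only [Finset.mem_insert, Finset.mem_singleton] at hl
    simp only [Finsupp.add_apply, Finsupp.single_apply]
    rcases hl with rfl | rfl <;> simp <;> omega
  · rw [sum_add_single, sum_add_single, ← hα.2.2]

/-- Only one exponent is raised, so one of the two derivatives is undone here. The other is
accounted for by the factor (iτ)⁻¹ in `interaction`. -/
theorem testParametrix_mem_waveRel (hc : ∀ j, c j ≠ 0) (b : Fin 5 → Covector) (j : Fin 4)
    {f : WaveAlg} {m : ℂ} (h : (f, m) ∈ WaveRel c (K + 1) w 2 Finset.univ) :
    (testParametrix b j f, (((2 * c j * pairing (b j.castSucc) (b 4))⁻¹ : ℝ) : ℂ) * m)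
      ∈ WaveRel c K w 1 Finset.univ := by
  let L := monomialMap (fun s x => MvPolynomial.monomial (s + Finsupp.single j 1)
      (x / (2 * ((s j : ℝ) + 1) * pairing (b j.castSucc) (b 4))))
    (fun s => by simp) (fun s x y => by rw [add_div, map_add])
    (fun s r x => by rw [MvPolynomial.smul_monomial, smul_eq_mul, mul_div_assoc])
  refine map_mem_waveRel L _ (fun α hα => ?_) h
  have h1 := Submodule.smul_mem _
    (1 / (2 * ((α j : ℝ) + 1) * pairing (b j.castSucc) (b 4)))
    (monomial_mem_waveRel (c := c) (K := K) (w := w) (d := 1) (S := Finset.univ)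
      (α := α + Finsupp.single j 1) ⟨?_, ?_, ?_⟩)
  · convert h1 using 1
    refine Prod.ext ?_ ?_
    · change ∑ s ∈ (MvPolynomial.monomial α (1 : ℝ)).support, _ = _
      rw [MvPolynomial.support_monomial, if_neg one_ne_zero]
      simp [MvPolynomial.smul_monomial]
    · simp only [Prod.smul_snd, Complex.real_smul, ← Complex.ofReal_mul]
      congr 1
      have h2 := laplaceWeight_add_single α j (hc j)
      have hj := hc j
      have h5 : laplaceWeight c (α + Finsupp.single j 1)
          = ((α j : ℝ) + 1) * laplaceWeight c α / c j := by
        rw [eq_div_iff hj]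
        linear_combination h2
      rw [h5]
      have h7 : (α j : ℝ) + 1 ≠ 0 := by positivity
      field_simp
  · intro l hl
    simp at hl
  · intro l hl
    have h2 := hα.2.1 l hl
    simp only [Finsupp.add_apply]
    omega
  · rw [sum_add_single, ← hα.2.2]

theorem contract_mem_waveRel {d : ℕ} {S : Finset (Fin 4)} (v : Tensor)
    {F : Matrix (Fin 4) (Fin 4) WaveAlg} {M : Matrix (Fin 4) (Fin 4) ℂ}
    (h : ∀ i j, (F i j, M i j) ∈ WaveRel c K w d S) :
    (contract v F, contractMom v M) ∈ WaveRel c K w d S := by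
  have : (contract v F, contractMom v M)
      = ∑ j, ∑ k, (minkowski * v * minkowski) j k • ((F j k, M j k) : WaveAlg × ℂ) := by
    refine Prod.ext ?_ ?_
    · simp only [contract, Prod.fst_sum, Prod.smul_fst, MvPolynomial.smul_eq_C_mul]
    · simp only [contractMom, Prod.snd_sum, Prod.smul_snd]
  rw [this]
  exact Submodule.sum_mem _ fun j _ => Submodule.sum_mem _ fun k _ => Submodule.smul_mem _ _ (h j k)

/-- The propagators of pairs of waves. -/
def pairProp (c : Fin 4 → ℝ) (b : Fin 5 → Covector) (i j : Fin 4) : ℂ :=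
  (((2 * c i * c j * pairing (b i.castSucc) (b j.castSucc))⁻¹ : ℝ) : ℂ)

/-- The propagators of triples of waves, up to sign. -/
def testProp (c : Fin 4 → ℝ) (b : Fin 5 → Covector) (j : Fin 4) : ℂ :=
  (((2 * c j * pairing (b j.castSucc) (b 4))⁻¹ : ℝ) : ℂ)

variable {a : ℕ} (ha : 16 ≤ a) (hc : ∀ j, c j ≠ 0) (b : Fin 5 → Covector) (v : Fin 5 → Tensor)

theorem firstOrder_mem (K : ℕ) (hK : K ≤ a) (i j : Fin 4) (S : Finset (Fin 4)) :
    (MvPowerSeries.coeff (epsExp S) (firstOrder a v i j),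
      MvPowerSeries.coeff (epsExp S) (linField (planeAmp a c v) i j))
      ∈ WaveRel c K (fun _ => a) 0 S := by
  have : (MvPowerSeries.coeff (epsExp S) (firstOrder a v i j),
      MvPowerSeries.coeff (epsExp S) (linField (planeAmp a c v) i j))
      = ∑ l, ((MvPowerSeries.coeff (epsExp S) (withEps {l} (planeWave a v l) i j),
        MvPowerSeries.coeff (epsExp S) (epsTensor {l} (planeAmp a c v l) i j)) : WaveAlg × ℂ) := by
    refine Prod.ext ?_ ?_
    · simp only [firstOrder, Matrix.sum_apply, map_sum, Prod.fst_sum]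
    · simp only [linField, Matrix.sum_apply, map_sum, Prod.snd_sum]
  rw [this]
  exact Submodule.sum_mem _ fun l _ => waveRel_eps (planeWave_mem_waveRel hK v l rfl) i j

include hc in
theorem pairWave_mem (K : ℕ) (hK : K + 1 ≤ a) (hK' : 1 ≤ K) {i j : Fin 4} (hij : i ≠ j)
    (l m : Fin 4) :
    (pairWave a b v i j l m, pairTensor (waveMom c b) (pairProp c b) (planeAmp a c v) i j l m)
      ∈ WaveRel c K (fun _ => a) 0 {i, j} := by
  refine parametrix_mem_waveRel hc b hij ?_
  exact source_mem_waveRel hc (by omega) b _ _ (firstOrder_mem v (K + 1) hK)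
    (coeff_empty_linField (C := WaveAlg) (planeWave a v)) (coeff_empty_linField _) _ _ _

include ha hc in
-- The hypothesis 16 ≤ `a` provides the bound 16 for the plane waves. The two-wave parametrix lowers
-- it to 15, the derivatives left in the three-wave source to 13, and the test parametrix to 12.
theorem secondOrder_mem (i j : Fin 4) (S : Finset (Fin 4)) :
    (MvPowerSeries.coeff (epsExp S) (secondOrder a b v i j),
      MvPowerSeries.coeff (epsExp S) (quadField (planeAmp a c v)
        (pairTensor (waveMom c b) (pairProp c b) (planeAmp a c v)) i j))
      ∈ WaveRel c 15 (fun _ => a) 0 S := by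
  have : (MvPowerSeries.coeff (epsExp S) (secondOrder a b v i j),
      MvPowerSeries.coeff (epsExp S) (quadField (planeAmp a c v)
        (pairTensor (waveMom c b) (pairProp c b) (planeAmp a c v)) i j))
      = ((MvPowerSeries.coeff (epsExp S) (firstOrder a v i j),
          MvPowerSeries.coeff (epsExp S) (linField (planeAmp a c v) i j)) : WaveAlg × ℂ)
        + ∑ l, ∑ m ∈ Finset.Ioi l,
          ((MvPowerSeries.coeff (epsExp S) (withEps {l, m} (pairWave a b v l m) i j),
            MvPowerSeries.coeff (epsExp S) (epsTensor {l, m} (pairTensor (waveMom c b)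
              (pairProp c b) (planeAmp a c v) l m) i j)) : WaveAlg × ℂ) := by
    refine Prod.ext ?_ ?_
    · simp only [secondOrder, Matrix.add_apply, Matrix.sum_apply, map_add, map_sum, Prod.fst_add,
        Prod.fst_sum]
    · simp only [quadField, Matrix.add_apply, Matrix.sum_apply, map_add, map_sum, Prod.snd_add,
        Prod.snd_sum]
  rw [this]
  refine Submodule.add_mem _ (firstOrder_mem v 15 (by omega) i j S)
    (Submodule.sum_mem _ fun l _ => Submodule.sum_mem _ fun m hm => waveRel_eps
      (pairWave_mem hc b v 15 (by omega) (by omega) (Finset.mem_Ioi.mp hm).ne) i j)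

include ha hc in
theorem secondOrder_source_mem (S : Finset (Fin 4)) (i j : Fin 4) :
    (source b S (secondOrder a b v) i j,
      momSource (waveMom c b) S (quadField (planeAmp a c v)
        (pairTensor (waveMom c b) (pairProp c b) (planeAmp a c v))) i j)
      ∈ WaveRel c 15 (fun _ => a) 2 S :=
  source_mem_waveRel hc (by norm_num) b _ _ (secondOrder_mem ha hc b v)
    (coeff_empty_quadField (C := WaveAlg) (planeWave a v) (pairWave a b v))
    (coeff_empty_quadField _ _) S i j

include ha hc in
theorem tripleFour_mem (j i l : Fin 4) :
    (tripleFour a b v j i l, tripleTerm (waveMom c b) (planeAmp a c v)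
      (pairTensor (waveMom c b) (pairProp c b) (planeAmp a c v)) j i l)
      ∈ WaveRel c 13 (fun i => if i = 0 then a - 2 else a) 2 Finset.univ := by
  -- The three-wave source carries two derivatives that no parametrix has undone. To insert it as a
  -- new field with derivative count zero, the deficit of two is booked as a lower degree of one of
  -- the other waves. Which one is immaterial, since only the sum of the degrees counts.
  set w : Fin 4 → ℕ := fun i => if i = j + 1 then a - 2 else a with hw
  have hne : j ≠ j + 1 := by fin_cases j <;> decide
  have hwj : w j = a := by rw [hw]; simp only; rw [if_neg hne]
  have hsum : ∀ t : Finset (Fin 4), j + 1 ∈ t → ∑ i ∈ t, w i + 2 = ∑ i ∈ t, a := by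
    intro t ht
    rw [← Finset.add_sum_erase _ _ ht, ← Finset.add_sum_erase _ _ ht]
    have : ∑ i ∈ t.erase (j + 1), w i = ∑ i ∈ t.erase (j + 1), a :=
      Finset.sum_congr rfl fun i hi => by
        rw [hw]
        simp only
        rw [if_neg (Finset.ne_of_mem_erase hi)]
    rw [this, hw]
    simp only [if_true]
    omega
  have hne' : ({j}ᶜ : Finset (Fin 4)) ≠ ∅ := by fin_cases j <;> decide
  have h := source_mem_waveRel (K := 13) (w := w) hc (by norm_num) b
    (withEps {j} (planeWave a v j) + withEps {j}ᶜ (tripleSource a b v j))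
    (epsTensor {j} (planeAmp a c v j) + epsTensor {j}ᶜ (momSource (waveMom c b) {j}ᶜ
      (quadField (planeAmp a c v) (pairTensor (waveMom c b) (pairProp c b) (planeAmp a c v)))))
    ?_ ?_ ?_ Finset.univ i l
  · refine WaveRel.mono ?_ ?_ h
    · omega
    · have h1 := hsum Finset.univ (Finset.mem_univ _)
      simp only [Finset.sum_const, Finset.card_univ, Fintype.card_fin, smul_eq_mul] at h1
      simp only [Fin.sum_univ_four] at h1 ⊢
      simp
      omega
  · refine waveRel_eps_add (fun p q => planeWave_mem_waveRel (by omega) v j hwj p q) fun p q => ?_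
    have h2 : (tripleSource a b v j p q, momSource (waveMom c b) {j}ᶜ (quadField (planeAmp a c v)
        (pairTensor (waveMom c b) (pairProp c b) (planeAmp a c v))) p q)
        ∈ WaveRel c 15 (fun _ => a) 2 {j}ᶜ := secondOrder_source_mem ha hc b v _ p q
    refine WaveRel.mono ?_ ?_ h2
    · omega
    · rw [add_zero]
      exact hsum _ (by rw [Finset.mem_compl, Finset.mem_singleton]; exact hne.symm)
  · intro p q
    have hE : ∀ T f, withEps T f = epsTensor T f := fun _ _ => rfl
    rw [hE, hE, Matrix.add_apply, map_add, coeff_empty_epsTensor (Finset.singleton_ne_empty j),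
      coeff_empty_epsTensor hne', add_zero]
  · intro p q
    rw [Matrix.add_apply, map_add, coeff_empty_epsTensor (Finset.singleton_ne_empty j),
      coeff_empty_epsTensor hne', add_zero]

include ha hc in
theorem regularFour_contract_mem :
    (contract (v 4) (regularFour a b v), contractMom (v 4) (quarticTerm (waveMom c b)
      (planeAmp a c v) (pairTensor (waveMom c b) (pairProp c b) (planeAmp a c v))))
      ∈ WaveRel c 15 (fun _ => a) 2 Finset.univ :=
  contract_mem_waveRel _ (secondOrder_source_mem ha hc b v Finset.univ)

include ha hc in
theorem tripleFour_contract_mem :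
    (∑ j, testParametrix b j (contract (v 4) (tripleFour a b v j)),
      ∑ j, testProp c b j * contractMom (v 4) (tripleTerm (waveMom c b)
        (planeAmp a c v) (pairTensor (waveMom c b) (pairProp c b) (planeAmp a c v)) j))
      ∈ WaveRel c 12 (fun i => if i = 0 then a - 2 else a) 1 Finset.univ := by
  have : (∑ j, testParametrix b j (contract (v 4) (tripleFour a b v j)),
      ∑ j, testProp c b j * contractMom (v 4) (tripleTerm (waveMom c b)
        (planeAmp a c v) (pairTensor (waveMom c b) (pairProp c b) (planeAmp a c v)) j))
      = ∑ j, ((testParametrix b j (contract (v 4) (tripleFour a b v j)),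
        testProp c b j * contractMom (v 4) (tripleTerm (waveMom c b)
        (planeAmp a c v) (pairTensor (waveMom c b) (pairProp c b) (planeAmp a c v)) j))
          : WaveAlg × ℂ) :=
    Prod.ext (by rw [Prod.fst_sum]) (by rw [Prod.snd_sum])
  rw [this]
  exact Submodule.sum_mem _ fun j _ => testParametrix_mem_waveRel hc b j
    (contract_mem_waveRel _ (tripleFour_mem ha hc b v j))

end Interaction

end

end FourWave

namespace FourWave

noncomputable section

open MeasureTheory Filter Topology

/-! ### Oscillatory integrals on a half line -/

section HalfLine

variable {R c : ℝ}

/-- `∫_0^R ρ(y) y^m exp(i τ c y) dy`. -/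
def halfOsc (R c : ℝ) (m : ℕ) (ρ : ℝ → ℝ) (τ : ℝ) : ℂ :=
  ∫ y in (0 : ℝ)..R, ((ρ y * y ^ m : ℝ) : ℂ) * Complex.exp (((τ * c * y : ℝ) : ℂ) * Complex.I)

/-- Integration by parts. The boundary term at `R` vanishes by the support condition, and the one at
0 carries 0 ^ m, so it is present only for m = 0. In that case the truncated m - 1 is harmless
because its term has the factor m. -/
theorem halfOsc_ibp (hc : c ≠ 0) (m : ℕ) {ρ : ℝ → ℝ} (hρ : ContDiff ℝ ((⊤ : ℕ∞) : WithTop ℕ∞) ρ)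
    (hR : tsupport ρ ⊆ Set.Iio R) (τ : ℝ) :
    (τ : ℂ) * halfOsc R c m ρ τ = (Complex.I / c) * (0 ^ m * ρ 0
      + (m * halfOsc R c (m - 1) ρ τ + halfOsc R c m (deriv ρ) τ)) := by
  have hdρ : Differentiable ℝ ρ := hρ.differentiable (by simp)
  have hcρ : Continuous (deriv ρ) := hρ.continuous_deriv (by simp)
  have hR0 : ρ R = 0 := image_eq_zero_of_notMem_tsupport fun h => lt_irrefl R (hR h)
  have hu : ∀ y, HasDerivAt (fun y => ((ρ y * y ^ m : ℝ) : ℂ))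
      ((deriv ρ y * y ^ m + ρ y * (m * y ^ (m - 1)) : ℝ) : ℂ) y := fun y =>
    (((hdρ y).hasDerivAt).mul (hasDerivAt_pow m y)).ofReal_comp
  have hv : ∀ y : ℝ, HasDerivAt (fun y : ℝ => Complex.exp (((τ * c * y : ℝ) : ℂ) * Complex.I))
      (Complex.exp (((τ * c * y : ℝ) : ℂ) * Complex.I) * ((τ * c : ℝ) * Complex.I)) y := fun y => by
    have h1 : HasDerivAt (fun y : ℝ => τ * c * y) (τ * c) y := by
      simpa using (hasDerivAt_id y).const_mul (τ * c)
    exact (h1.ofReal_comp.mul_const Complex.I).cexp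
  have hcu : Continuous fun y => ((deriv ρ y * y ^ m + ρ y * (m * y ^ (m - 1)) : ℝ) : ℂ) := by
    have := hdρ.continuous
    fun_prop
  have h := intervalIntegral.integral_mul_deriv_eq_deriv_mul (a := 0) (b := R)
    (fun y _ => hu y) (fun y _ => hv y) (hcu.intervalIntegrable _ _)
    (Continuous.intervalIntegrable (by fun_prop) _ _)
  have h1 : ∫ y in (0 : ℝ)..R, ((ρ y * y ^ m : ℝ) : ℂ) *
      (Complex.exp (((τ * c * y : ℝ) : ℂ) * Complex.I) * ((τ * c : ℝ) * Complex.I))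
      = halfOsc R c m ρ τ * ((τ * c : ℝ) * Complex.I) := by
    rw [halfOsc, ← intervalIntegral.integral_mul_const]
    simp only [mul_assoc]
  have h2 : ∫ y in (0 : ℝ)..R, ((deriv ρ y * y ^ m + ρ y * (m * y ^ (m - 1)) : ℝ) : ℂ) *
      Complex.exp (((τ * c * y : ℝ) : ℂ) * Complex.I)
      = m * halfOsc R c (m - 1) ρ τ + halfOsc R c m (deriv ρ) τ := by
    rw [halfOsc, halfOsc, ← intervalIntegral.integral_const_mul, ← intervalIntegral.integral_add]
    · refine intervalIntegral.integral_congr fun y _ => ?_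
      push_cast
      ring
    · refine Continuous.intervalIntegrable ?_ _ _
      have := hdρ.continuous
      fun_prop
    · exact Continuous.intervalIntegrable (by fun_prop) _ _
  rw [h1, h2, hR0] at h
  have hc' : (c : ℂ) ≠ 0 := by exact_mod_cast hc
  push_cast at h
  simp only [mul_zero, zero_mul, Complex.exp_zero, mul_one] at h
  field_simp
  have hI := Complex.I_mul_I
  linear_combination (-Complex.I) * h + (halfOsc R c m ρ τ * τ * c) * hI

/-- If the density vanishes near 0, integration by parts never produces a boundary term, and each
one gains a power of τ. -/
theorem halfOsc_decay (hR0 : 0 ≤ R) (hc : c ≠ 0) (n : ℕ) : ∀ (m : ℕ) (ρ : ℝ → ℝ),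
    ContDiff ℝ ((⊤ : ℕ∞) : WithTop ℕ∞) ρ → tsupport ρ ⊆ Set.Iio R → (∀ᶠ y in 𝓝 0, ρ y = 0) →
    ∃ C : ℝ, ∀ τ : ℝ, 0 < τ → τ ^ n * ‖halfOsc R c m ρ τ‖ ≤ C := by
  induction n with
  | zero =>
    intro m ρ hρ hR h0
    refine ⟨∫ y in (0 : ℝ)..R, |ρ y * y ^ m|, fun τ _ => ?_⟩
    rw [pow_zero, one_mul, halfOsc]
    refine (intervalIntegral.norm_integral_le_integral_norm hR0).trans (le_of_eq ?_)
    refine intervalIntegral.integral_congr fun y _ => ?_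
    simp only [norm_mul, Complex.norm_exp_ofReal_mul_I, mul_one, Complex.norm_real, Real.norm_eq_abs, abs_mul]
  | succ n ih =>
    intro m ρ hρ hR h0
    have hdρ : ContDiff ℝ ((⊤ : ℕ∞) : WithTop ℕ∞) (deriv ρ) := hρ.deriv' 
    have h0' : ∀ᶠ y in 𝓝 0, deriv ρ y = 0 := by
      filter_upwards [h0.eventually_nhds] with y hy
      rw [Filter.EventuallyEq.deriv_eq (f := fun _ => (0 : ℝ)) hy]
      simp
    obtain ⟨C1, h1⟩ := ih (m - 1) ρ hρ hR h0
    obtain ⟨C2, h2⟩ := ih m (deriv ρ) hdρ (tsupport_deriv_subset.trans hR) h0'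
    refine ⟨|c|⁻¹ * (m * C1 + C2), fun τ hτ => ?_⟩
    have h3 := halfOsc_ibp hc m hρ hR τ
    rw [h0.self_of_nhds, Complex.ofReal_zero, mul_zero, zero_add] at h3
    have h4 : τ ^ (n + 1) * ‖halfOsc R c m ρ τ‖ = τ ^ n * ‖(τ : ℂ) * halfOsc R c m ρ τ‖ := by
      rw [norm_mul, Complex.norm_real, Real.norm_eq_abs, abs_of_pos hτ]
      ring
    rw [h4, h3, norm_mul, norm_div, Complex.norm_I, Complex.norm_real, Real.norm_eq_abs, one_div]
    have hτn : 0 ≤ τ ^ n := by positivity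
    have h5 : ‖(m : ℂ) * halfOsc R c (m - 1) ρ τ + halfOsc R c m (deriv ρ) τ‖
        ≤ m * ‖halfOsc R c (m - 1) ρ τ‖ + ‖halfOsc R c m (deriv ρ) τ‖ := by
      refine (norm_add_le _ _).trans (le_of_eq ?_)
      rw [norm_mul, Complex.norm_natCast]
    calc τ ^ n * (|c|⁻¹ * ‖(m : ℂ) * halfOsc R c (m - 1) ρ τ + halfOsc R c m (deriv ρ) τ‖)
        ≤ τ ^ n * (|c|⁻¹ * (m * ‖halfOsc R c (m - 1) ρ τ‖ + ‖halfOsc R c m (deriv ρ) τ‖)) := by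
          gcongr
      _ = |c|⁻¹ * (m * (τ ^ n * ‖halfOsc R c (m - 1) ρ τ‖)
          + τ ^ n * ‖halfOsc R c m (deriv ρ) τ‖) := by ring
      _ ≤ |c|⁻¹ * (m * C1 + C2) := by
          gcongr
          · exact h1 τ hτ
          · exact h2 τ hτ

theorem tendsto_zero_of_decay {f : ℝ → ℂ} {n : ℕ}
    (h : ∃ C : ℝ, ∀ τ : ℝ, 0 < τ → τ ^ (n + 1) * ‖f τ‖ ≤ C) :
    Tendsto (fun τ : ℝ => (τ : ℂ) ^ n * f τ) atTop (𝓝 0) := by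
  obtain ⟨C, hC⟩ := h
  refine squeeze_zero_norm' (a := fun τ : ℝ => C * τ⁻¹) ?_ ?_
  · filter_upwards [eventually_gt_atTop 0] with τ hτ
    rw [norm_mul, norm_pow, Complex.norm_real, Real.norm_eq_abs, abs_of_pos hτ]
    rw [← div_eq_mul_inv, le_div_iff₀ hτ]
    refine le_trans (le_of_eq ?_) (hC τ hτ)
    ring
  · simpa using tendsto_inv_atTop_zero.const_mul C

/-- Induction on `m` by parts. The terms with `deriv χ` decay rapidly since χ is constant near 0,
and each step contributes a factor m · i / c; the first one comes from the boundary term. -/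
theorem halfOsc_tendsto (hR0 : 0 ≤ R) (hc : c ≠ 0) {χ : ℝ → ℝ}
    (hχ : ContDiff ℝ ((⊤ : ℕ∞) : WithTop ℕ∞) χ) (hR : tsupport χ ⊆ Set.Iio R)
    (h1 : ∀ᶠ y in 𝓝 0, χ y = 1) (m : ℕ) :
    Tendsto (fun τ : ℝ => (τ : ℂ) ^ (m + 1) * halfOsc R c m χ τ) atTop
      (𝓝 (m.factorial * (Complex.I / c) ^ (m + 1))) := by
  have hdχ : ContDiff ℝ ((⊤ : ℕ∞) : WithTop ℕ∞) (deriv χ) := hχ.deriv'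
  have h0' : ∀ᶠ y in 𝓝 0, deriv χ y = 0 := by
    filter_upwards [h1.eventually_nhds] with y hy
    rw [Filter.EventuallyEq.deriv_eq (f := fun _ => (1 : ℝ)) hy]
    simp
  have hdec : ∀ n, Tendsto (fun τ : ℝ => (τ : ℂ) ^ n * halfOsc R c n (deriv χ) τ) atTop (𝓝 0) :=
    fun n => tendsto_zero_of_decay
      (halfOsc_decay hR0 hc (n + 1) n _ hdχ (tsupport_deriv_subset.trans hR) h0')
  have hχ0 : χ 0 = 1 := h1.self_of_nhds
  induction m with
  | zero =>
    have h2 : Tendsto (fun τ : ℝ => (Complex.I / c) * (1 + halfOsc R c 0 (deriv χ) τ)) atTop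
        (𝓝 ((Complex.I / c) * (1 + 0))) := by
      have := hdec 0
      simp only [pow_zero, one_mul] at this
      exact (this.const_add 1).const_mul _
    refine Tendsto.congr' ?_ (h2.trans_eq ?_)
    · filter_upwards [eventually_gt_atTop 0] with τ hτ
      have := halfOsc_ibp hc 0 hχ hR τ
      rw [zero_add, pow_one, this, hχ0]
      simp
    · simp
  | succ m ih =>
    have h2 : Tendsto (fun τ : ℝ => (Complex.I / c) * (((m + 1 : ℕ) : ℂ) *
        ((τ : ℂ) ^ (m + 1) * halfOsc R c m χ τ)
        + (τ : ℂ) ^ (m + 1) * halfOsc R c (m + 1) (deriv χ) τ)) atTop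
        (𝓝 ((Complex.I / c) * (((m + 1 : ℕ) : ℂ) *
          (m.factorial * (Complex.I / c) ^ (m + 1)) + 0))) :=
      ((ih.const_mul _).add (hdec (m + 1))).const_mul _
    refine Tendsto.congr' ?_ (h2.trans_eq ?_)
    · filter_upwards [eventually_gt_atTop 0] with τ hτ
      have := halfOsc_ibp hc (m + 1) hχ hR τ
      rw [pow_succ (τ : ℂ) (m + 1), mul_assoc, this]
      simp
      ring
    · rw [Nat.factorial_succ]
      push_cast
      ring_nf

end HalfLine

end

end FourWave

namespace FourWave

noncomputable section

open MeasureTheory Filter Topology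

/-! ### Oscillatory integrals on an orthant -/

section Orthant

variable {c : Fin 4 → ℝ}

/-- `∏_k (y_k)_+ ^ α_k`. -/
def orthantMonomial (α : Fin 4 → ℕ) (y : Fin 4 → ℝ) : ℝ := ∏ k, max (y k) 0 ^ α k

/-- `∫ ψ(y) ∏_k (y_k)_+ ^ α_k exp(i τ c · y) dy`. -/
def orthantOsc (c : Fin 4 → ℝ) (α : Fin 4 → ℕ) (ψ : (Fin 4 → ℝ) → ℝ) (τ : ℝ) : ℂ :=
  ∫ y : Fin 4 → ℝ, ((ψ y * orthantMonomial α y : ℝ) : ℂ) *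
    Complex.exp (((τ * ∑ k, c k * y k : ℝ) : ℂ) * Complex.I)

theorem continuous_orthantMonomial (α : Fin 4 → ℕ) : Continuous (orthantMonomial α) := by
  unfold orthantMonomial
  fun_prop

theorem integrable_orthant (c : Fin 4 → ℝ) (α : Fin 4 → ℕ) {ψ : (Fin 4 → ℝ) → ℝ}
    (hψ : Continuous ψ) (hs : HasCompactSupport ψ) (τ : ℝ) :
    Integrable fun y : Fin 4 → ℝ => ((ψ y * orthantMonomial α y : ℝ) : ℂ) *
      Complex.exp (((τ * ∑ k, c k * y k : ℝ) : ℂ) * Complex.I) := by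
  have h1 := continuous_orthantMonomial α
  refine Continuous.integrable_of_hasCompactSupport (by fun_prop) ?_
  refine HasCompactSupport.mul_right ?_
  exact (hs.mul_right (f' := orthantMonomial α)).comp_left Complex.ofReal_zero

/-- From exponent two on, the truncated power is differentiable at the corner as well; there it is
o(t). -/
theorem hasDerivAt_max_pow {m : ℕ} (hm : 2 ≤ m) (t : ℝ) :
    HasDerivAt (fun t : ℝ => max t 0 ^ m) (m * max t 0 ^ (m - 1)) t := by
  rcases lt_trichotomy t 0 with h | h | h
  · have h1 : (fun t : ℝ => max t 0 ^ m) =ᶠ[𝓝 t] fun _ => 0 := by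
      filter_upwards [gt_mem_nhds h] with s hs
      rw [max_eq_right hs.le, zero_pow (by omega)]
    rw [max_eq_right h.le, zero_pow (by omega), mul_zero]
    exact (hasDerivAt_const t 0).congr_of_eventuallyEq h1
  · subst h
    rw [max_self, zero_pow (by omega), mul_zero]
    rw [hasDerivAt_iff_isLittleO]
    simp only [max_self, sub_zero, smul_zero, zero_pow (show m ≠ 0 by omega)]
    have h2 : (fun t : ℝ => t ^ m) =o[𝓝 0] fun t => t := by
      simpa using Asymptotics.isLittleO_pow_id (𝕜 := ℝ) (show 1 < m by omega)
    refine Asymptotics.IsBigO.trans_isLittleO ?_ h2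
    refine Asymptotics.IsBigO.of_bound 1 (Eventually.of_forall fun t => ?_)
    rw [one_mul, norm_pow, norm_pow]
    gcongr
    rw [Real.norm_eq_abs, Real.norm_eq_abs, abs_of_nonneg (le_max_right _ _)]
    exact max_le (le_abs_self t) (abs_nonneg t)
  · have h1 : (fun t : ℝ => max t 0 ^ m) =ᶠ[𝓝 t] fun t => t ^ m := by
      filter_upwards [lt_mem_nhds h] with s hs
      rw [max_eq_left hs.le]
    rw [max_eq_left h.le]
    exact (hasDerivAt_pow m t).congr_of_eventuallyEq h1

theorem orthantMonomial_eq (α : Fin 4 → ℕ) (j : Fin 4) (y : Fin 4 → ℝ) :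
    orthantMonomial α y = max (y j) 0 ^ α j * ∏ k ∈ Finset.univ.erase j, max (y k) 0 ^ α k :=
  (Finset.mul_prod_erase _ _ (Finset.mem_univ j)).symm

theorem orthantMonomial_update (α : Fin 4 → ℕ) (j : Fin 4) (m : ℕ) (y : Fin 4 → ℝ) :
    orthantMonomial (Function.update α j m) y
      = max (y j) 0 ^ m * ∏ k ∈ Finset.univ.erase j, max (y k) 0 ^ α k := by
  rw [orthantMonomial_eq _ j, Function.update_self]
  congr 1
  refine Finset.prod_congr rfl fun k hk => ?_
  rw [Function.update_of_ne (Finset.ne_of_mem_erase hk)]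

theorem hasLineDerivAt_orthantMonomial (α : Fin 4 → ℕ) (j : Fin 4) (hα : 2 ≤ α j)
    (y : Fin 4 → ℝ) : HasLineDerivAt ℝ (orthantMonomial α)
      (α j * orthantMonomial (Function.update α j (α j - 1)) y) y (Pi.single j 1) := by
  have h1 : (fun t : ℝ => orthantMonomial α (y + t • Pi.single j 1))
      = fun t => max (y j + t) 0 ^ α j * ∏ k ∈ Finset.univ.erase j, max (y k) 0 ^ α k := by
    funext t
    rw [orthantMonomial_eq α j]
    congr 1
    · simp
    · refine Finset.prod_congr rfl fun k hk => ?_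
      simp [Finset.ne_of_mem_erase hk]
  unfold HasLineDerivAt
  rw [h1, orthantMonomial_update, ← mul_assoc]
  have h2 : HasDerivAt (fun t : ℝ => y j + t) 1 0 := (hasDerivAt_id 0).const_add (y j)
  have h3 := (HasDerivAt.comp (0 : ℝ) (hasDerivAt_max_pow hα (y j + 0)) h2).mul_const
    (∏ k ∈ Finset.univ.erase j, max (y k) 0 ^ α k)
  simpa using h3

/-- The partial derivative. -/
def partialDeriv (j : Fin 4) (ψ : (Fin 4 → ℝ) → ℝ) (y : Fin 4 → ℝ) : ℝ :=
  fderiv ℝ ψ y (Pi.single j 1)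

theorem contDiff_partialDeriv (j : Fin 4) {ψ : (Fin 4 → ℝ) → ℝ}
    (hψ : ContDiff ℝ ((⊤ : ℕ∞) : WithTop ℕ∞) ψ) :
    ContDiff ℝ ((⊤ : ℕ∞) : WithTop ℕ∞) (partialDeriv j ψ) :=
  (hψ.fderiv_right (m := ((⊤ : ℕ∞) : WithTop ℕ∞)) (by simp)).clm_apply contDiff_const

theorem hasCompactSupport_partialDeriv (j : Fin 4) {ψ : (Fin 4 → ℝ) → ℝ}
    (hψ : HasCompactSupport ψ) : HasCompactSupport (partialDeriv j ψ) :=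
  (hψ.fderiv ℝ).comp_left (g := fun L : (Fin 4 → ℝ) →L[ℝ] ℝ => L (Pi.single j 1)) rfl

/-- With exponent at least two in the direction `j` the integrand is differentiable along that
direction, so integration by parts over the whole space has no boundary term on the face y_j = 0. -/
theorem orthantOsc_ibp {j : Fin 4} (hc : c j ≠ 0) (α : Fin 4 → ℕ) (hα : 2 ≤ α j)
    {ψ : (Fin 4 → ℝ) → ℝ} (hψ : ContDiff ℝ ((⊤ : ℕ∞) : WithTop ℕ∞) ψ) (hs : HasCompactSupport ψ)
    (τ : ℝ) :
    (τ : ℂ) * orthantOsc c α ψ τ = (Complex.I / c j) *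
      (α j * orthantOsc c (Function.update α j (α j - 1)) ψ τ
        + orthantOsc c α (partialDeriv j ψ) τ) := by
  have hψ' := contDiff_partialDeriv j hψ
  have hs' := hasCompactSupport_partialDeriv j hs
  set e : (Fin 4 → ℝ) → ℂ := fun y =>
    Complex.exp (((τ * ∑ k, c k * y k : ℝ) : ℂ) * Complex.I) with he
  have hf : ∀ y, HasLineDerivAt ℝ (fun y => ((ψ y * orthantMonomial α y : ℝ) : ℂ))
      ((partialDeriv j ψ y * orthantMonomial α y
        + ψ y * (α j * orthantMonomial (Function.update α j (α j - 1)) y) : ℝ) : ℂ) y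
      (Pi.single j 1) := by
    intro y
    have h1 : HasLineDerivAt ℝ ψ (partialDeriv j ψ y) y (Pi.single j 1) :=
      ((hψ.differentiable (by simp)) y).hasFDerivAt.hasLineDerivAt _
    have h2 := hasLineDerivAt_orthantMonomial α j hα y
    have h3 := (HasDerivAt.mul h1 h2).ofReal_comp
    simpa [HasLineDerivAt] using h3
  have hg : ∀ y, HasLineDerivAt ℝ e (e y * ((τ * c j : ℝ) * Complex.I)) y (Pi.single j 1) := by
    intro y
    have h1 : HasDerivAt (fun t : ℝ => τ * ∑ k, c k * (y + t • Pi.single j 1 : Fin 4 → ℝ) k)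
        (τ * c j) 0 := by
      have h2 : (fun t : ℝ => τ * ∑ k, c k * (y + t • Pi.single j 1 : Fin 4 → ℝ) k)
          = fun t => τ * ∑ k, c k * y k + τ * c j * t := by
        funext t
        simp only [Pi.add_apply, Pi.smul_apply, smul_eq_mul, mul_add, Finset.sum_add_distrib]
        congr 1
        rw [Finset.sum_eq_single j]
        · simp
          ring
        · intro k _ hk
          simp [hk]
        · simp
      rw [h2]
      simpa using ((hasDerivAt_id (0 : ℝ)).const_mul (τ * c j)).const_add (τ * ∑ k, c k * y k)
    have h3 := (h1.ofReal_comp.mul_const Complex.I).cexp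
    simpa [HasLineDerivAt, he] using h3
  have hi0 := integrable_orthant c α hψ.continuous hs τ
  have hi1 := integrable_orthant c α hψ'.continuous hs' τ
  have hi2 := integrable_orthant c (Function.update α j (α j - 1)) hψ.continuous hs τ
  have hsplit : ∀ y, ((partialDeriv j ψ y * orthantMonomial α y
        + ψ y * (α j * orthantMonomial (Function.update α j (α j - 1)) y) : ℝ) : ℂ) * e y
      = ((partialDeriv j ψ y * orthantMonomial α y : ℝ) : ℂ) * e y
        + (α j : ℂ) * (((ψ y * orthantMonomial (Function.update α j (α j - 1)) y : ℝ) : ℂ)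
          * e y) := by
    intro y
    push_cast
    ring
  have h := integral_bilinear_hasLineDerivAt_right_eq_neg_left_of_integrable
    (μ := (volume : Measure (Fin 4 → ℝ))) (B := ContinuousLinearMap.mul ℝ ℂ)
    (f := fun y => ((ψ y * orthantMonomial α y : ℝ) : ℂ)) (g := e) (v := Pi.single j 1)
    (f' := fun y => ((partialDeriv j ψ y * orthantMonomial α y
        + ψ y * (α j * orthantMonomial (Function.update α j (α j - 1)) y) : ℝ) : ℂ))
    (g' := fun y => e y * ((τ * c j : ℝ) * Complex.I)) ?_ ?_ ?_ (fun y _ => hf y) (fun y _ => hg y)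
  · simp only [ContinuousLinearMap.mul_apply'] at h
    have h1 : ∫ y, ((ψ y * orthantMonomial α y : ℝ) : ℂ) * (e y * ((τ * c j : ℝ) * Complex.I))
        = orthantOsc c α ψ τ * ((τ * c j : ℝ) * Complex.I) := by
      rw [orthantOsc, ← integral_mul_const]
      simp only [mul_assoc]
      rfl
    have h2 : ∫ y, ((partialDeriv j ψ y * orthantMonomial α y
        + ψ y * (α j * orthantMonomial (Function.update α j (α j - 1)) y) : ℝ) : ℂ) * e y
        = orthantOsc c α (partialDeriv j ψ) τ
          + α j * orthantOsc c (Function.update α j (α j - 1)) ψ τ := by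
      simp only [hsplit]
      rw [integral_add hi1 (hi2.const_mul _), integral_const_mul]
      rfl
    rw [h1, h2] at h
    have hc' : (c j : ℂ) ≠ 0 := by exact_mod_cast hc
    push_cast at h
    have hI := Complex.I_mul_I
    field_simp
    linear_combination (-Complex.I) * h + (orthantOsc c α ψ τ * τ * c j) * hI
  · simp only [ContinuousLinearMap.mul_apply', hsplit]
    exact hi1.add (hi2.const_mul _)
  · simp only [ContinuousLinearMap.mul_apply']
    simpa only [mul_assoc] using hi0.mul_const (((τ * c j : ℝ) : ℂ) * Complex.I)
  · simpa only [ContinuousLinearMap.mul_apply'] using hi0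

/-- Each integration by parts costs one unit of the exponent in direction `j` and needs at least two
units, so exponent n + 1 allows n of them. -/
theorem orthantOsc_decay_of_le {j : Fin 4} (hc : c j ≠ 0) (n : ℕ) :
    ∀ (α : Fin 4 → ℕ) (ψ : (Fin 4 → ℝ) → ℝ), n + 1 ≤ α j →
    ContDiff ℝ ((⊤ : ℕ∞) : WithTop ℕ∞) ψ → HasCompactSupport ψ →
    ∃ C : ℝ, ∀ τ : ℝ, 0 < τ → τ ^ n * ‖orthantOsc c α ψ τ‖ ≤ C := by
  induction n with
  | zero =>
    intro α ψ _ _ _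
    refine ⟨∫ y, |ψ y * orthantMonomial α y|, fun τ _ => ?_⟩
    rw [pow_zero, one_mul, orthantOsc]
    refine (norm_integral_le_integral_norm _).trans (le_of_eq ?_)
    congr 1
    funext y
    rw [norm_mul, Complex.norm_exp_ofReal_mul_I, mul_one, Complex.norm_real, Real.norm_eq_abs]
  | succ n ih =>
    intro α ψ hα hψ hs
    obtain ⟨C1, h1⟩ := ih (Function.update α j (α j - 1)) ψ
      (by rw [Function.update_self]; omega) hψ hs
    obtain ⟨C2, h2⟩ := ih α (partialDeriv j ψ) (by omega) (contDiff_partialDeriv j hψ)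
      (hasCompactSupport_partialDeriv j hs)
    refine ⟨|c j|⁻¹ * (α j * C1 + C2), fun τ hτ => ?_⟩
    have h3 := orthantOsc_ibp hc α (by omega) hψ hs τ
    have h4 : τ ^ (n + 1) * ‖orthantOsc c α ψ τ‖ = τ ^ n * ‖(τ : ℂ) * orthantOsc c α ψ τ‖ := by
      rw [norm_mul, Complex.norm_real, Real.norm_eq_abs, abs_of_pos hτ]
      ring
    rw [h4, h3, norm_mul, norm_div, Complex.norm_I, Complex.norm_real, Real.norm_eq_abs, one_div]
    have hτn : 0 ≤ τ ^ n := by positivity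
    have h5 : ‖(α j : ℂ) * orthantOsc c (Function.update α j (α j - 1)) ψ τ
          + orthantOsc c α (partialDeriv j ψ) τ‖
        ≤ α j * ‖orthantOsc c (Function.update α j (α j - 1)) ψ τ‖
          + ‖orthantOsc c α (partialDeriv j ψ) τ‖ := by
      refine (norm_add_le _ _).trans (le_of_eq ?_)
      rw [norm_mul, Complex.norm_natCast]
    calc τ ^ n * (|c j|⁻¹ * ‖(α j : ℂ) * orthantOsc c (Function.update α j (α j - 1)) ψ τ
          + orthantOsc c α (partialDeriv j ψ) τ‖)
        ≤ τ ^ n * (|c j|⁻¹ * (α j * ‖orthantOsc c (Function.update α j (α j - 1)) ψ τ‖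
          + ‖orthantOsc c α (partialDeriv j ψ) τ‖)) := by gcongr
      _ = |c j|⁻¹ * (α j * (τ ^ n * ‖orthantOsc c (Function.update α j (α j - 1)) ψ τ‖)
          + τ ^ n * ‖orthantOsc c α (partialDeriv j ψ) τ‖) := by ring
      _ ≤ |c j|⁻¹ * (α j * C1 + C2) := by
          gcongr
          · exact h1 τ hτ
          · exact h2 τ hτ

/-- A cut-off that vanishes near the corner can be divided by ∑ y_k ^ (2n). Writing φ = ∑ y_j ^ (2n)
ψ with ψ smooth raises one exponent by 2n in each summand, which is enough for n integrations by
parts in that direction. -/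
theorem orthantOsc_decay (hc : ∀ j, c j ≠ 0) (α : Fin 4 → ℕ) (hα : ∀ j, 1 ≤ α j)
    {φ : (Fin 4 → ℝ) → ℝ} (hφ : ContDiff ℝ ((⊤ : ℕ∞) : WithTop ℕ∞) φ) (hs : HasCompactSupport φ)
    (h0 : ∀ᶠ y in 𝓝 0, φ y = 0) (n : ℕ) :
    ∃ C : ℝ, ∀ τ : ℝ, 0 < τ → τ ^ n * ‖orthantOsc c α φ τ‖ ≤ C := by
  -- The even exponent makes `q` positive away from the origin.
  set q : (Fin 4 → ℝ) → ℝ := fun y => ∑ k, y k ^ (2 * n) with hq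
  set ψ : (Fin 4 → ℝ) → ℝ := fun y => φ y / q y with hψ
  have hφ0 : φ 0 = 0 := h0.self_of_nhds
  have hq0 : ∀ y, y ≠ 0 → q y ≠ 0 := by
    intro y hy
    obtain ⟨k, hk⟩ := Function.ne_iff.mp hy
    have hk' : y k ≠ 0 := hk
    have h2 : 0 < y k ^ (2 * n) := by
      rw [pow_mul]
      positivity
    have h3 : y k ^ (2 * n) ≤ q y :=
      Finset.single_le_sum (f := fun k => y k ^ (2 * n))
        (fun i _ => by simp only [pow_mul]; positivity) (Finset.mem_univ k)
    exact (h2.trans_le h3).ne'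
  have hψd : ContDiff ℝ ((⊤ : ℕ∞) : WithTop ℕ∞) ψ := by
    rw [contDiff_iff_contDiffAt]
    intro y
    by_cases hy : y = 0
    · subst hy
      have : ψ =ᶠ[𝓝 0] fun _ => 0 := by
        filter_upwards [h0] with z hz
        rw [hψ]
        simp [hz]
      exact contDiffAt_const.congr_of_eventuallyEq this
    · refine ContDiffAt.div hφ.contDiffAt ?_ (hq0 y hy)
      exact (ContDiff.sum fun k _ => (contDiff_apply ℝ ℝ k).pow _).contDiffAt
  have hψs : HasCompactSupport ψ := by
    have : ψ = fun y => φ y * (q y)⁻¹ := by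
      funext y
      rw [hψ]
      simp only [div_eq_mul_inv]
    rw [this]
    exact hs.mul_right
  have hφψ : ∀ y, φ y = ∑ j, y j ^ (2 * n) * ψ y := by
    intro y
    rw [← Finset.sum_mul]
    by_cases hy : y = 0
    · rw [hψ, hy]
      simp [hφ0]
    · exact (mul_div_cancel₀ _ (hq0 y hy)).symm
  have hsum : ∀ τ, orthantOsc c α φ τ
      = ∑ j, orthantOsc c (Function.update α j (α j + 2 * n)) ψ τ := by
    intro τ
    simp only [orthantOsc]
    rw [← integral_finsetSum _ fun j _ =>
      integrable_orthant c (Function.update α j (α j + 2 * n)) hψd.continuous hψs τ]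
    congr 1
    funext y
    rw [← Finset.sum_mul, ← Complex.ofReal_sum]
    congr 2
    rw [hφψ, Finset.sum_mul]
    refine Finset.sum_congr rfl fun j _ => ?_
    rw [orthantMonomial_update, orthantMonomial_eq α j]
    have h1 : max (y j) 0 ^ α j * y j ^ (2 * n) = max (y j) 0 ^ (α j + 2 * n) := by
      rcases le_total (y j) 0 with h | h
      · have := hα j
        rw [max_eq_right h, zero_pow (by omega), zero_pow (by omega), zero_mul]
      · rw [max_eq_left h, pow_add]
    rw [← h1]
    ring
  have hdec : ∀ j, ∃ C : ℝ, ∀ τ : ℝ, 0 < τ →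
      τ ^ n * ‖orthantOsc c (Function.update α j (α j + 2 * n)) ψ τ‖ ≤ C := fun j =>
    orthantOsc_decay_of_le (hc j) n _ _
      (by rw [Function.update_self]; have := hα j; omega) hψd hψs
  choose C hC using hdec
  refine ⟨∑ j, C j, fun τ hτ => ?_⟩
  rw [hsum τ]
  calc τ ^ n * ‖∑ j, orthantOsc c (Function.update α j (α j + 2 * n)) ψ τ‖
      ≤ τ ^ n * ∑ j, ‖orthantOsc c (Function.update α j (α j + 2 * n)) ψ τ‖ := by
        gcongr
        exact norm_sum_le _ _
    _ = ∑ j, τ ^ n * ‖orthantOsc c (Function.update α j (α j + 2 * n)) ψ τ‖ := Finset.mul_sum _ _ _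
    _ ≤ ∑ j, C j := Finset.sum_le_sum fun j _ => hC j τ hτ

/-- For a product cut-off, Fubini splits the integral. Exponents at least one make each integrand
vanish on the negative half line and at 0. -/
theorem orthantOsc_prod (α : Fin 4 → ℕ) (hα : ∀ j, 1 ≤ α j) {χ : ℝ → ℝ} {R : ℝ}
    (hR0 : 0 ≤ R) (hR : tsupport χ ⊆ Set.Iio R) (τ : ℝ) :
    orthantOsc c α (fun y => ∏ k, χ (y k)) τ = ∏ k, halfOsc R (c k) (α k) χ τ := by
  have h1 : ∀ k, halfOsc R (c k) (α k) χ τ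
      = ∫ y : ℝ, ((χ y * max y 0 ^ α k : ℝ) : ℂ) *
        Complex.exp (((τ * c k * y : ℝ) : ℂ) * Complex.I) := by
    intro k
    rw [← intervalIntegral.integral_eq_integral_of_support_subset (a := 0) (b := R), halfOsc]
    · refine intervalIntegral.integral_congr fun y hy => ?_
      rw [Set.uIcc_of_le hR0] at hy
      simp only [max_eq_left hy.1]
    · intro y hy
      rw [Function.mem_support] at hy
      constructor
      · by_contra h
        apply hy
        rw [max_eq_right (not_lt.mp h), zero_pow (by have := hα k; omega)]
        simp
      · by_contra h
        apply hy
        rw [image_eq_zero_of_notMem_tsupport (f := χ) (x := y) fun h' => h (le_of_lt (hR h'))]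
        simp
  simp only [h1]
  rw [← integral_fintype_prod_volume_eq_prod (fun k (y : ℝ) => ((χ y * max y 0 ^ α k : ℝ) : ℂ) *
        Complex.exp (((τ * c k * y : ℝ) : ℂ) * Complex.I)), orthantOsc]
  congr 1
  funext y
  rw [Finset.prod_mul_distrib, ← Complex.exp_sum, ← Complex.ofReal_prod, Finset.prod_mul_distrib,
    orthantMonomial, ← Finset.sum_mul, ← Complex.ofReal_sum, Finset.mul_sum]
  simp only [mul_assoc]

/-- A general cut-off differs from a product of one-dimensional bumps by a function vanishing near
the corner, which contributes a rapidly decaying term. This is also why the limit does not depend on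
the cut-off. -/
theorem orthantOsc_tendsto (hc : ∀ j, c j ≠ 0) (α : Fin 4 → ℕ) (hα : ∀ j, 1 ≤ α j)
    {H : (Fin 4 → ℝ) → ℝ} (hH : ContDiff ℝ ((⊤ : ℕ∞) : WithTop ℕ∞) H) (hs : HasCompactSupport H)
    (h1 : ∀ᶠ y in 𝓝 0, H y = 1) :
    Tendsto (fun τ : ℝ => (τ : ℂ) ^ (∑ j, (α j + 1)) * orthantOsc c α H τ) atTop
      (𝓝 (∏ j, ((α j).factorial * (Complex.I / c j) ^ (α j + 1)))) := by
  let χ : ContDiffBump (0 : ℝ) := ⟨1, 2, one_pos, one_lt_two⟩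
  have hχd : ContDiff ℝ ((⊤ : ℕ∞) : WithTop ℕ∞) χ := χ.contDiff
  have hχR : tsupport χ ⊆ Set.Iio 3 := by
    rw [χ.tsupport_eq]
    intro y hy
    rw [Metric.mem_closedBall, Real.dist_eq, sub_zero] at hy
    have h2 : |y| ≤ 2 := hy
    exact lt_of_le_of_lt ((le_abs_self y).trans h2) (by norm_num)
  have hχ1 : ∀ᶠ y in 𝓝 0, χ y = 1 := χ.eventuallyEq_one
  set h0 : (Fin 4 → ℝ) → ℝ := fun y => ∏ k, χ (y k) with hh0
  have hd0 : ContDiff ℝ ((⊤ : ℕ∞) : WithTop ℕ∞) h0 :=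
    contDiff_prod fun k _ => hχd.comp (contDiff_apply ℝ ℝ k)
  have hs0 : HasCompactSupport h0 := by
    refine HasCompactSupport.intro (isCompact_closedBall (0 : Fin 4 → ℝ) 2) fun y hy => ?_
    rw [mem_closedBall_zero_iff, pi_norm_le_iff_of_nonneg (by norm_num)] at hy
    push Not at hy
    obtain ⟨k, hk⟩ := hy
    refine Finset.prod_eq_zero (Finset.mem_univ k) (χ.zero_of_le_dist ?_)
    rw [dist_zero_right]
    exact hk.le
  have hev : ∀ᶠ y in 𝓝 (0 : Fin 4 → ℝ), H y - h0 y = 0 := by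
    have h2 : ∀ᶠ y in 𝓝 (0 : Fin 4 → ℝ), ∀ k, χ (y k) = 1 := by
      rw [eventually_all]
      intro k
      have h3 : Tendsto (fun y : Fin 4 → ℝ => y k) (𝓝 0) (𝓝 0) :=
        (continuous_apply k).tendsto' _ _ rfl
      exact h3.eventually hχ1
    filter_upwards [h1, h2] with y hy1 hy2
    rw [hy1, hh0]
    simp [hy2]
  have hdiff := tendsto_zero_of_decay (n := ∑ j, (α j + 1)) (f := orthantOsc c α fun y => H y - h0 y)
    (orthantOsc_decay hc α hα (hH.sub hd0) (hs.sub hs0) hev _)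
  have hprod : Tendsto (fun τ : ℝ => ∏ j, ((τ : ℂ) ^ (α j + 1) * halfOsc 3 (c j) (α j) χ τ)) atTop
      (𝓝 (∏ j, ((α j).factorial * (Complex.I / c j) ^ (α j + 1)))) :=
    tendsto_finsetProd _ fun j _ => halfOsc_tendsto (by norm_num) (hc j) hχd hχR hχ1 (α j)
  have hsum := hdiff.add hprod
  rw [zero_add] at hsum
  refine hsum.congr fun τ => ?_
  rw [Finset.prod_mul_distrib, Finset.prod_pow_eq_pow_sum, ← orthantOsc_prod α hα (by norm_num) hχR,
    ← mul_add]
  congr 1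
  rw [orthantOsc, orthantOsc, orthantOsc, ← integral_add
    (integrable_orthant c α (hH.sub hd0).continuous (hs.sub hs0) τ)
    (integrable_orthant c α hd0.continuous hs0 τ)]
  congr 1
  funext y
  rw [← add_mul, ← Complex.ofReal_add, ← add_mul]
  simp [hh0]

end Orthant

end

end FourWave

namespace FourWave

noncomputable section

open MeasureTheory Filter Topology

/-! ### The indicator function as an amplitude in momentum space -/

section Indicator

variable {b : Fin 5 → Covector} {c : Fin 4 → ℝ}

/-- The matrix with rows `b⁽¹⁾, …, b⁽⁴⁾`. -/
def waveMatrix (b : Fin 5 → Covector) : Matrix (Fin 4) (Fin 4) ℝ :=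
  Matrix.of fun j k => b j.castSucc k

/-- The integral of a product of waves against `h u_τ`. -/
def waveInt (b : Fin 5 → Covector) (h : (Fin 4 → ℝ) → ℝ) (f : WaveAlg) (τ : ℝ) : ℂ :=
  ∫ x : Fin 4 → ℝ, (h x : ℂ) * Complex.exp (Complex.I * (τ : ℂ) * ((b 4 ⬝ᵥ x : ℝ) : ℂ)) *
    (realize b f x : ℂ)

theorem continuous_realize (b : Fin 5 → Covector) (f : WaveAlg) : Continuous (realize b f) := by
  unfold realize
  refine (MvPolynomial.continuous_eval f).comp (continuous_pi fun j => ?_)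
  unfold dotProduct
  fun_prop

theorem integrable_waveInt (b : Fin 5 → Covector) {h : (Fin 4 → ℝ) → ℝ} (hc : Continuous h)
    (hs : HasCompactSupport h) (f : WaveAlg) (τ : ℝ) :
    Integrable fun x : Fin 4 → ℝ => (h x : ℂ) *
      Complex.exp (Complex.I * (τ : ℂ) * ((b 4 ⬝ᵥ x : ℝ) : ℂ)) * (realize b f x : ℂ) := by
  have h1 := continuous_realize b f
  refine Continuous.integrable_of_hasCompactSupport ?_ ?_
  · unfold dotProduct
    fun_prop
  · exact ((hs.comp_left Complex.ofReal_zero).mul_right).mul_right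

/-- The linear substitution y_j = b⁽ʲ⁾ · x turns the product of waves into an orthant monomial and
the phase into τ ∑ c_j y_j, and contributes |det|⁻¹. -/
theorem waveInt_monomial (hdet : (waveMatrix b).det ≠ 0)
    (hb : ∀ k, b 4 k = ∑ j, c j * b j.castSucc k) (h : (Fin 4 → ℝ) → ℝ) (α : Fin 4 →₀ ℕ) (τ : ℝ) :
    waveInt b h (MvPolynomial.monomial α 1) τ = (|(waveMatrix b).det|⁻¹ : ℝ) *
      orthantOsc c α (fun y => h ((waveMatrix b)⁻¹.mulVec y)) τ := by
  have hu : IsUnit (waveMatrix b).det := isUnit_iff_ne_zero.mpr hdet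
  have h1 := Matrix.mul_nonsing_inv (waveMatrix b) hu
  have h2 := Matrix.nonsing_inv_mul (waveMatrix b) hu
  let e : (Fin 4 → ℝ) ≃L[ℝ] (Fin 4 → ℝ) :=
    (Matrix.toLin'OfInv h2 h1).toContinuousLinearEquiv
  have he : (e : (Fin 4 → ℝ) → Fin 4 → ℝ) = Matrix.toLin' (waveMatrix b) := rfl
  have hme : MeasurableEmbedding (Matrix.toLin' (waveMatrix b)) := by
    rw [← he]
    exact e.toHomeomorph.measurableEmbedding
  have h3 := hme.integral_map (μ := volume) fun y =>
    ((h ((waveMatrix b)⁻¹.mulVec y) * orthantMonomial α y : ℝ) : ℂ) *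
      Complex.exp (((τ * ∑ k, c k * y k : ℝ) : ℂ) * Complex.I)
  rw [Real.map_matrix_volume_pi_eq_smul_volume_pi hdet, integral_smul_measure,
    ENNReal.toReal_ofReal (abs_nonneg _)] at h3
  rw [orthantOsc, ← abs_inv, ← Complex.real_smul, h3, waveInt]
  congr 1
  funext x
  have h4 : ∀ j, (Matrix.toLin' (waveMatrix b) x) j = b j.castSucc ⬝ᵥ x := fun j => rfl
  have h5 : (waveMatrix b)⁻¹.mulVec (Matrix.toLin' (waveMatrix b) x) = x := by
    rw [Matrix.toLin'_apply, Matrix.mulVec_mulVec, h2, Matrix.one_mulVec]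
  have h6 : b 4 ⬝ᵥ x = ∑ k, c k * (Matrix.toLin' (waveMatrix b) x) k := by
    simp only [h4, dotProduct, hb, Finset.sum_mul, Finset.mul_sum]
    rw [Finset.sum_comm]
    simp only [mul_assoc]
  have h7 : realize b (MvPolynomial.monomial α 1) x
      = orthantMonomial α (Matrix.toLin' (waveMatrix b) x) := by
    rw [realize, MvPolynomial.eval_monomial, one_mul, Finsupp.prod_fintype _ _ (by simp),
      orthantMonomial]
    simp only [h4]
  rw [h5, ← h6, h7]
  push_cast
  have h8 : Complex.I * (τ : ℂ) * ((b 4 ⬝ᵥ x : ℝ) : ℂ) = τ * ((b 4 ⬝ᵥ x : ℝ) : ℂ) * Complex.I := by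
    ring
  rw [h8]
  ring

theorem waveInt_add (b : Fin 5 → Covector) {h : (Fin 4 → ℝ) → ℝ} (hc : Continuous h)
    (hs : HasCompactSupport h) (f g : WaveAlg) (τ : ℝ) :
    waveInt b h (f + g) τ = waveInt b h f τ + waveInt b h g τ := by
  rw [waveInt, waveInt, waveInt, ← integral_add (integrable_waveInt b hc hs f τ)
    (integrable_waveInt b hc hs g τ)]
  congr 1
  funext x
  rw [← mul_add, ← Complex.ofReal_add]
  simp [realize]

theorem waveInt_smul (b : Fin 5 → Covector) (h : (Fin 4 → ℝ) → ℝ) (r : ℝ) (f : WaveAlg) (τ : ℝ) :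
    waveInt b h (r • f) τ = r * waveInt b h f τ := by
  rw [waveInt, waveInt, ← integral_const_mul]
  congr 1
  funext x
  have : realize b (r • f) x = r * realize b f x := by simp [realize, MvPolynomial.smul_eval]
  rw [this]
  push_cast
  ring

/-- All monomials in `WaveRel` have the same total degree, so they share the power τ ^ N and the
limits add up linearly to the paired transform. The factor ∏ c_j⁻¹ is the one that `laplaceWeight`
omits, and `hK` guarantees positive exponents. -/
theorem waveInt_tendsto (hdet : (waveMatrix b).det ≠ 0)
    (hb : ∀ k, b 4 k = ∑ j, c j * b j.castSucc k) (hc : ∀ j, c j ≠ 0) {h : (Fin 4 → ℝ) → ℝ}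
    (hd : ContDiff ℝ ((⊤ : ℕ∞) : WithTop ℕ∞) h) (hs : HasCompactSupport h)
    (h1 : ∀ᶠ x in 𝓝 0, h x = 1) {K d N : ℕ} {w : Fin 4 → ℕ} (hK : d + 1 ≤ K)
    (hN : N + d = ∑ j, w j + 4) {f : WaveAlg} {m : ℂ}
    (hf : (f, m) ∈ WaveRel c K w d Finset.univ) :
    Tendsto (fun τ : ℝ => (τ : ℂ) ^ N * waveInt b h f τ) atTop
      (𝓝 (((|(waveMatrix b).det|⁻¹ * ∏ j, (c j)⁻¹ : ℝ) : ℂ) * Complex.I ^ N * m)) := by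
  set κ : ℂ := ((|(waveMatrix b).det|⁻¹ * ∏ j, (c j)⁻¹ : ℝ) : ℂ) with hκ
  suffices hgen : ∀ p ∈ WaveRel c K w d Finset.univ,
      Tendsto (fun τ : ℝ => (τ : ℂ) ^ N * waveInt b h p.1 τ) atTop
        (𝓝 (κ * Complex.I ^ N * p.2)) from hgen (f, m) hf
  intro p hp
  induction hp using Submodule.span_induction with
  | mem p hp =>
    obtain ⟨α, hα, rfl⟩ := hp
    have hα1 : ∀ j, 1 ≤ α j := fun j => by
      have := hα.2.1 j (Finset.mem_univ j)
      omega
    have hu : IsUnit (waveMatrix b).det := isUnit_iff_ne_zero.mpr hdet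
    have h2 := Matrix.nonsing_inv_mul (waveMatrix b) hu
    have h3 := Matrix.mul_nonsing_inv (waveMatrix b) hu
    let e : (Fin 4 → ℝ) ≃L[ℝ] (Fin 4 → ℝ) :=
      (Matrix.toLin'OfInv h3 h2).toContinuousLinearEquiv
    have hlim := orthantOsc_tendsto hc α hα1 (H := fun y => h ((waveMatrix b)⁻¹.mulVec y))
      (hd.comp e.contDiff) (hs.comp_homeomorph e.toHomeomorph)
      ((e.continuous.tendsto' 0 0 (map_zero e)).eventually h1)
    have hNα : ∑ j, (α j + 1) = N := by
      have := hα.2.2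
      rw [Finset.sum_add_distrib]
      simp only [Finset.sum_const, Finset.card_univ, Fintype.card_fin, smul_eq_mul]
      omega
    rw [hNα] at hlim
    have hlim2 := hlim.const_mul ((|(waveMatrix b).det|⁻¹ : ℝ) : ℂ)
    refine Tendsto.congr (fun τ => ?_) (hlim2.trans_eq (congrArg 𝓝 ?_))
    swap
    · rw [hκ, laplaceWeight]
      have h4 : ∏ j, ((α j).factorial * (Complex.I / (c j : ℂ)) ^ (α j + 1))
          = Complex.I ^ N * ∏ j, ((((c j)⁻¹ * ((α j).factorial / c j ^ α j) : ℝ)) : ℂ) := by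
        rw [← hNα, ← Finset.prod_pow_eq_pow_sum, ← Finset.prod_mul_distrib]
        refine Finset.prod_congr rfl fun j _ => ?_
        have hcj : (c j : ℂ) ≠ 0 := by exact_mod_cast hc j
        push_cast
        rw [div_pow, pow_succ (c j : ℂ)]
        field_simp
      rw [h4, ← Complex.ofReal_prod, Finset.prod_mul_distrib]
      push_cast
      ring
    · rw [waveInt_monomial hdet hb]
      ring
  | zero =>
    have : ∀ τ, waveInt b h ((0 : WaveAlg × ℂ).1) τ = 0 := fun τ => by
      simp [waveInt, realize]
    simp only [this, mul_zero, Prod.snd_zero]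
    exact tendsto_const_nhds
  | add p q _ _ hp hq =>
    refine Tendsto.congr (fun τ => ?_) ((hp.add hq).trans_eq (congrArg 𝓝 ?_))
    swap
    · rw [Prod.snd_add, mul_add]
    · rw [Prod.fst_add, waveInt_add b hd.continuous hs, mul_add]
  | smul r p _ hp =>
    refine Tendsto.congr (fun τ => ?_) ((hp.const_mul (r : ℂ)).trans_eq (congrArg 𝓝 ?_))
    swap
    · rw [Prod.smul_snd, Complex.real_smul]
      ring
    · rw [Prod.smul_fst, waveInt_smul]
      ring

/-- The amplitude of the four-wave interaction. -/
def indicatorAmp (ζ : Fin 4 → Fin 4 → ℂ) (r : Fin 4 → Fin 4 → ℂ) (s : Fin 4 → ℂ)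
    (x : Fin 4 → Matrix (Fin 4) (Fin 4) ℂ) (w : Tensor) : ℂ :=
  -contractMom w (quarticTerm ζ x (pairTensor ζ r x))
    + ∑ j, s j * contractMom w (tripleTerm ζ x (pairTensor ζ r x) j)

/-- The terms without three-wave interactions scale like τ ^ -(4a+2). Those with one scale like τ ^
-(4a+1) and receive the missing power from (iτ)⁻¹. -/
theorem hasIndicator_of_amp {a : ℕ} (ha : 16 ≤ a) (hdet : (waveMatrix b).det ≠ 0)
    (hb : ∀ k, b 4 k = ∑ j, c j * b j.castSucc k) (hc : ∀ j, c j ≠ 0) (v : Fin 5 → Tensor) :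
    HasIndicator a b v (((|(waveMatrix b).det|⁻¹ * ∏ j, (c j)⁻¹ : ℝ) : ℂ) *
      indicatorAmp (waveMom c b) (pairProp c b) (testProp c b) (planeAmp a c v) (v 4)) := by
  intro h hd hs h1
  have hR := waveInt_tendsto (N := 4 * a + 2) hdet hb hc hd hs h1 (by norm_num)
    (by simp) (regularFour_contract_mem ha hc b v)
  have hT := waveInt_tendsto (N := 4 * a + 1) hdet hb hc hd hs h1 (by norm_num)
    (by simp only [Fin.sum_univ_four]; simp; omega) (tripleFour_contract_mem ha hc b v)
  have hsum := hR.add (hT.const_mul Complex.I⁻¹)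
  have hI : Complex.I ^ (4 * a) = 1 := by rw [pow_mul, Complex.I_pow_four, one_pow]
  refine Tendsto.congr' ?_ (hsum.trans_eq (congrArg 𝓝 ?_))
  swap
  -- Here i ^ (4a+2) = -1 and i ^ (4a+1) · i⁻¹ = 1, which explains the relative sign in
  -- `indicatorAmp`.
  · rw [pow_add, pow_add, hI, Complex.I_sq, indicatorAmp]
    have := Complex.I_ne_zero
    field_simp
  · filter_upwards [eventually_gt_atTop 0] with τ hτ
    have hτ' : (τ : ℂ) ≠ 0 := by exact_mod_cast hτ.ne'
    have h2 : interaction a h b v τ = waveInt b h (contract (v 4) (regularFour a b v)) τ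
        + (Complex.I * (τ : ℂ))⁻¹ *
          waveInt b h (∑ j, testParametrix b j (contract (v 4) (tripleFour a b v j))) τ := by
      rw [waveInt, waveInt, ← integral_const_mul, ← integral_add
        (integrable_waveInt b hd.continuous hs _ τ)
        ((integrable_waveInt b hd.continuous hs _ τ).const_mul _), interaction]
      congr 1
      funext x
      ring
    rw [h2]
    have := Complex.I_ne_zero
    field_simp
    ring

end Indicator

end

end FourWave

namespace FourWave

noncomputable section

open Filter Topology

/-! ### Dependence of the amplitude on parameters -/

section Natural

/-- Operations that make sense for amplitudes over all `ℝ`-algebras. -/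
abbrev AmpOp : Type 1 :=
  ∀ (C : Type) [CommRing C] [Algebra ℝ C], (Fin 4 → Fin 4 → C) →
    (Fin 4 → Matrix (Fin 4) (Fin 4) C) → (Fin 4 → Fin 4 → Matrix (Fin 4) (Fin 4) C) → C

/-- Compatibility with homomorphisms. -/
def AmpOp.IsNatural (Φ : AmpOp) : Prop :=
  ∀ (C C' : Type) [CommRing C] [Algebra ℝ C] [CommRing C'] [Algebra ℝ C'] (φ : C →ₐ[ℝ] C')
    (ζ : Fin 4 → Fin 4 → C) (x : Fin 4 → Matrix (Fin 4) (Fin 4) C)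
    (P : Fin 4 → Fin 4 → Matrix (Fin 4) (Fin 4) C),
    φ (Φ C ζ x P) = Φ C' (fun j k => φ (ζ j k)) (fun j => (x j).map φ) (fun i j => (P i j).map φ)

/-- Naturality for the inclusion of a subalgebra: the operation can be carried out inside it. -/
theorem AmpOp.IsNatural.mem {Φ : AmpOp} (hΦ : Φ.IsNatural) {C : Type} [CommRing C] [Algebra ℝ C]
    (𝓒 : Subalgebra ℝ C) {ζ : Fin 4 → Fin 4 → C} {x : Fin 4 → Matrix (Fin 4) (Fin 4) C}
    {P : Fin 4 → Fin 4 → Matrix (Fin 4) (Fin 4) C} (hζ : ∀ j k, ζ j k ∈ 𝓒)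
    (hx : ∀ j i l, x j i l ∈ 𝓒) (hP : ∀ j k i l, P j k i l ∈ 𝓒) : Φ C ζ x P ∈ 𝓒 := by
  have h := hΦ 𝓒 C 𝓒.val (fun j k => ⟨ζ j k, hζ j k⟩) (fun j => Matrix.of fun i l => ⟨x j i l, hx j i l⟩)
    (fun j k => Matrix.of fun i l => ⟨P j k i l, hP j k i l⟩)
  have h2 : Φ C ζ x P = 𝓒.val (Φ 𝓒 (fun j k => ⟨ζ j k, hζ j k⟩)
    (fun j => Matrix.of fun i l => ⟨x j i l, hx j i l⟩)
    (fun j k => Matrix.of fun i l => ⟨P j k i l, hP j k i l⟩)) := h.symm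
  rw [h2]
  exact Subtype.property _

/-- Functions with a limit, paired with the limit. -/
def limitSubalgebra {X : Type} (F : Filter X) : Subalgebra ℝ ((X → ℂ) × ℂ) where
  carrier := {p | Tendsto p.1 F (𝓝 p.2)}
  mul_mem' := fun hf hg => Tendsto.mul hf hg
  add_mem' := fun hf hg => Tendsto.add hf hg
  algebraMap_mem' := fun _ => tendsto_const_nhds

/-- Convergent families paired with their limits form a subalgebra of (X → ℂ) × ℂ. An operation
natural in the algebra stays in it, so it is continuous without being expanded. -/
theorem AmpOp.IsNatural.tendsto {Φ : AmpOp} (hΦ : Φ.IsNatural) {X : Type} {F : Filter X}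
    {ζ : X → Fin 4 → Fin 4 → ℂ} {x : X → Fin 4 → Matrix (Fin 4) (Fin 4) ℂ}
    {P : X → Fin 4 → Fin 4 → Matrix (Fin 4) (Fin 4) ℂ} {ζ₀ : Fin 4 → Fin 4 → ℂ}
    {x₀ : Fin 4 → Matrix (Fin 4) (Fin 4) ℂ} {P₀ : Fin 4 → Fin 4 → Matrix (Fin 4) (Fin 4) ℂ}
    (hζ : ∀ j k, Tendsto (fun t => ζ t j k) F (𝓝 (ζ₀ j k)))
    (hx : ∀ j i l, Tendsto (fun t => x t j i l) F (𝓝 (x₀ j i l)))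
    (hP : ∀ j k i l, Tendsto (fun t => P t j k i l) F (𝓝 (P₀ j k i l))) :
    Tendsto (fun t => Φ ℂ (ζ t) (x t) (P t)) F (𝓝 (Φ ℂ ζ₀ x₀ P₀)) := by
  have h : Φ ((X → ℂ) × ℂ) (fun j k => (fun t => ζ t j k, ζ₀ j k))
      (fun j => Matrix.of fun i l => (fun t => x t j i l, x₀ j i l))
      (fun j k => Matrix.of fun i l => (fun t => P t j k i l, P₀ j k i l)) ∈ limitSubalgebra F :=
    hΦ.mem _ hζ hx hP
  have h1 : ∀ t, Φ ℂ (ζ t) (x t) (P t) = _ := fun t =>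
    (hΦ ((X → ℂ) × ℂ) ℂ ((Pi.evalAlgHom ℝ (fun _ : X => ℂ) t).comp (AlgHom.fst ℝ (X → ℂ) ℂ))
      (fun j k => (fun t => ζ t j k, ζ₀ j k))
      (fun j => Matrix.of fun i l => (fun t => x t j i l, x₀ j i l))
      (fun j k => Matrix.of fun i l => (fun t => P t j k i l, P₀ j k i l))).symm
  have h2 : Φ ℂ ζ₀ x₀ P₀ = _ := (hΦ ((X → ℂ) × ℂ) ℂ (AlgHom.snd ℝ (X → ℂ) ℂ)
      (fun j k => (fun t => ζ t j k, ζ₀ j k))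
      (fun j => Matrix.of fun i l => (fun t => x t j i l, x₀ j i l))
      (fun j k => Matrix.of fun i l => (fun t => P t j k i l, P₀ j k i l))).symm
  simp only [h1]
  rw [h2]
  exact h

/-- Meromorphic functions. -/
def meromorphicSubalgebra : Subalgebra ℝ (ℂ → ℂ) where
  carrier := {f | ∀ t, MeromorphicAt f t}
  mul_mem' := fun hf hg t => (hf t).mul (hg t)
  add_mem' := fun hf hg t => (hf t).add (hg t)
  algebraMap_mem' := fun _ _ => MeromorphicAt.const _ _

/-- The same argument with the subalgebra of meromorphic functions and evaluation at a point. -/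
theorem AmpOp.IsNatural.meromorphic {Φ : AmpOp} (hΦ : Φ.IsNatural)
    {ζ : ℂ → Fin 4 → Fin 4 → ℂ} {x : ℂ → Fin 4 → Matrix (Fin 4) (Fin 4) ℂ}
    {P : ℂ → Fin 4 → Fin 4 → Matrix (Fin 4) (Fin 4) ℂ}
    (hζ : ∀ j k t, MeromorphicAt (fun t => ζ t j k) t)
    (hx : ∀ j i l t, MeromorphicAt (fun t => x t j i l) t)
    (hP : ∀ j k i l t, MeromorphicAt (fun t => P t j k i l) t) (t : ℂ) :
    MeromorphicAt (fun t => Φ ℂ (ζ t) (x t) (P t)) t := by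
  have h : Φ (ℂ → ℂ) (fun j k t => ζ t j k) (fun j => Matrix.of fun i l t => x t j i l)
      (fun j k => Matrix.of fun i l t => P t j k i l) ∈ meromorphicSubalgebra :=
    hΦ.mem _ hζ hx hP
  have h1 : ∀ t, Φ ℂ (ζ t) (x t) (P t) = _ := fun t =>
    (hΦ (ℂ → ℂ) ℂ (Pi.evalAlgHom ℝ (fun _ : ℂ => ℂ) t)
      (fun j k t => ζ t j k) (fun j => Matrix.of fun i l t => x t j i l)
      (fun j k => Matrix.of fun i l t => P t j k i l)).symm
  simp only [h1]
  exact h t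

variable {C C' : Type*} [CommRing C] [Algebra ℝ C] [CommRing C'] [Algebra ℝ C']

theorem map_add_mapAlgHom (φ : C →ₐ[ℝ] C')
    (u v : Matrix (Fin 4) (Fin 4) (MvPowerSeries (Fin 4) C)) :
    (u + v).map (MvPowerSeries.mapAlgHom φ) = u.map (MvPowerSeries.mapAlgHom φ)
      + v.map (MvPowerSeries.mapAlgHom φ) := by
  ext1 i j
  simp

theorem linField_map (φ : C →ₐ[ℝ] C') (x : Fin 4 → Matrix (Fin 4) (Fin 4) C) :
    (linField x).map (MvPowerSeries.mapAlgHom φ) = linField fun j => (x j).map φ := by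
  simp only [linField, ← epsTensor_map]
  ext1 i j
  simp [Matrix.sum_apply]

theorem quadField_map (φ : C →ₐ[ℝ] C') (x : Fin 4 → Matrix (Fin 4) (Fin 4) C)
    (P : Fin 4 → Fin 4 → Matrix (Fin 4) (Fin 4) C) :
    (quadField x P).map (MvPowerSeries.mapAlgHom φ)
      = quadField (fun j => (x j).map φ) fun i j => (P i j).map φ := by
  rw [quadField, map_add_mapAlgHom, linField_map, quadField]
  congr 1
  simp only [← epsTensor_map]
  ext1 i j
  simp [Matrix.sum_apply]

theorem isNatural_pair (S : Finset (Fin 4)) (i l : Fin 4) :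
    AmpOp.IsNatural fun _ _ _ ζ x _ => momSource ζ S (linField x) i l := by
  intro C C' _ _ _ _ φ ζ x P
  have := congrFun (congrFun (momSource_map φ ζ S _ (coeff_empty_linField x)) i) l
  rw [linField_map] at this
  exact this

theorem isNatural_quad (S : Finset (Fin 4)) (i l : Fin 4) :
    AmpOp.IsNatural fun _ _ _ ζ x P => momSource ζ S (quadField x P) i l := by
  intro C C' _ _ _ _ φ ζ x P
  have := congrFun (congrFun (momSource_map φ ζ S _ (coeff_empty_quadField x P)) i) l
  rw [quadField_map] at this
  exact this

theorem isNatural_triple (j i l : Fin 4) :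
    AmpOp.IsNatural fun _ _ _ ζ x P => tripleTerm ζ x P j i l := by
  intro C C' _ _ _ _ φ ζ x P
  have hne' : ({j}ᶜ : Finset (Fin 4)) ≠ ∅ := by fin_cases j <;> decide
  have h1 : ∀ p q, MvPowerSeries.coeff (epsExp ∅) ((epsTensor {j} (x j)
      + epsTensor {j}ᶜ (momSource ζ {j}ᶜ (quadField x P))) p q) = 0 := by
    intro p q
    rw [Matrix.add_apply, map_add, coeff_empty_epsTensor (Finset.singleton_ne_empty j),
      coeff_empty_epsTensor hne', add_zero]
  have := congrFun (congrFun (momSource_map φ ζ Finset.univ _ h1) i) l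
  rw [map_add_mapAlgHom, epsTensor_map, epsTensor_map,
    momSource_map φ ζ _ _ (coeff_empty_quadField x P), quadField_map] at this
  exact this

end Natural

/-! ### Homogeneity in the first wave -/

section Scaling

/-- Each term of a square-free coefficient contains wave 0 at most once, so the source is
homogeneous of degree one in the fields that involve it. -/
theorem momSource_scale (ζ : Fin 4 → Fin 4 → ℂ) (s : ℂ)
    (u u' : Matrix (Fin 4) (Fin 4) (MvPowerSeries (Fin 4) ℂ))
    (hu : ∀ i j, MvPowerSeries.coeff (epsExp ∅) (u i j) = 0)
    (huu' : ∀ i j S, MvPowerSeries.coeff (epsExp S) (u' i j)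
      = (if 0 ∈ S then s else 1) * MvPowerSeries.coeff (epsExp S) (u i j))
    (S : Finset (Fin 4)) (j k : Fin 4) :
    momSource ζ S u' j k = (if 0 ∈ S then s else 1) * momSource ζ S u j k := by
  -- The graph of the scaling, as a family of subspaces of ℂ × ℂ indexed by `S`. It is
  -- multiplicative because of two disjoint sets at most one contains 0.
  let V : ℕ → Finset (Fin 4) → Submodule ℝ (ℂ × ℂ) := fun _ S =>
    { carrier := {p | p.2 = (if 0 ∈ S then s else 1) * p.1}
      add_mem' := fun {p q} hp hq => by
        simp only [Set.mem_ofPred_eq, Prod.snd_add, Prod.fst_add] at hp hq ⊢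
        rw [hp, hq, mul_add]
      zero_mem' := by simp
      smul_mem' := fun c p hp => by
        simp only [Set.mem_ofPred_eq, Prod.smul_snd, Prod.smul_fst] at hp ⊢
        rw [hp, mul_smul_comm] }
  set v : Matrix (Fin 4) (Fin 4) (MvPowerSeries (Fin 4) (ℂ × ℂ)) := Matrix.of fun i j n =>
    (MvPowerSeries.coeff n (u i j), MvPowerSeries.coeff n (u' i j)) with hv
  have hu' : ∀ i j, MvPowerSeries.coeff (epsExp ∅) (u' i j) = 0 := fun i j => by
    rw [huu', hu, mul_zero]
  have hv0 : ∀ i j, MvPowerSeries.coeff (epsExp ∅) (v i j) = 0 := fun i j =>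
    Prod.ext (hu i j) (hu' i j)
  have h := nonlinearity_mem_coeffSubmodule (V := V) (D := momDeriv fun j k => (ζ j k, ζ j k))
    ?_ ?_ ?_ v (fun i j S => huu' i j S) hv0 j k S
  · have h1 := congrFun (congrFun
      (momSource_map (AlgHom.fst ℝ ℂ ℂ) (fun j k => (ζ j k, ζ j k)) S v hv0) j) k
    have h2 := congrFun (congrFun
      (momSource_map (AlgHom.snd ℝ ℂ ℂ) (fun j k => (ζ j k, ζ j k)) S v hv0) j) k
    have h3 : v.map (MvPowerSeries.mapAlgHom (AlgHom.fst ℝ ℂ ℂ)) = u := rfl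
    have h4 : v.map (MvPowerSeries.mapAlgHom (AlgHom.snd ℝ ℂ ℂ)) = u' := rfl
    rw [h3] at h1
    rw [h4] at h2
    change _ = momSource ζ S u j k at h1
    change _ = momSource ζ S u' j k at h2
    rw [← h1, ← h2]
    exact h
  · change (1 : ℂ × ℂ).2 = _
    simp
  · intro d e S T f g hST hf hg
    change (f * g).2 = _
    have hf' : f.2 = (if 0 ∈ S then s else 1) * f.1 := hf
    have hg' : g.2 = (if 0 ∈ T then s else 1) * g.1 := hg
    rw [Prod.snd_mul, Prod.fst_mul, hf', hg']
    by_cases h1 : (0 : Fin 4) ∈ S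
    · have h2 : (0 : Fin 4) ∉ T := Finset.disjoint_left.mp hST h1
      simp [h1, h2]
      ring
    · by_cases h2 : (0 : Fin 4) ∈ T <;> simp [h1, h2]
      ring
  · intro d k f _ hf S
    have h1 : (MvPowerSeries.coeff (epsExp S) f).2
      = (if 0 ∈ S then s else 1) * (MvPowerSeries.coeff (epsExp S) f).1 := hf S
    rw [coeff_momDeriv]
    have h2 : (totalMom (fun j k => (ζ j k, ζ j k)) S k : ℂ × ℂ)
        = (totalMom ζ S k, totalMom ζ S k) := by
      refine Prod.ext ?_ ?_ <;> simp [totalMom, Prod.fst_sum, Prod.snd_sum]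
    rw [h2]
    change totalMom ζ S k * _ = _ * (totalMom ζ S k * _)
    rw [h1]
    ring

end Scaling

end

end FourWave

namespace FourWave

noncomputable section

/-! ### Interaction of one wave with the product of the others -/

section Block

variable {C : Type*} [CommRing C] [Algebra ℝ C] {a t : Fin 4} {S : Finset (Fin 4)}

/-- The power series in which `ε_a` is always accompanied by all of `ε^S`, as far as the
coefficients of divisors of `ε_t ε^S` are concerned. -/
def blockSubmodule (C : Type*) [CommRing C] [Algebra ℝ C] (a t : Fin 4) (S : Finset (Fin 4)) :
    Submodule ℝ (MvPowerSeries (Fin 4) C) :=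
  coeffSubmodule fun U => if U ⊆ insert t S ∧ a ∈ U ∧ ¬S ⊆ U then ⊥ else ⊤

theorem mem_blockSubmodule {f : MvPowerSeries (Fin 4) C} : f ∈ blockSubmodule C a t S ↔
    ∀ U ⊆ insert t S, a ∈ U → ¬S ⊆ U → MvPowerSeries.coeff (epsExp U) f = 0 := by
  rw [blockSubmodule, mem_coeffSubmodule]
  refine forall_congr' fun U => ?_
  split_ifs with h
  · simp [h.1, h.2.1, h.2.2]
  · simp only [Submodule.mem_top, true_iff]
    exact fun h1 h2 h3 => absurd ⟨h1, h2, h3⟩ h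

theorem block_mul (U T : Finset (Fin 4)) (f g : C) (_ : Disjoint U T)
    (hf : f ∈ (if U ⊆ insert t S ∧ a ∈ U ∧ ¬S ⊆ U then ⊥ else ⊤ : Submodule ℝ C))
    (hg : g ∈ (if T ⊆ insert t S ∧ a ∈ T ∧ ¬S ⊆ T then ⊥ else ⊤ : Submodule ℝ C)) :
    f * g ∈ (if U ∪ T ⊆ insert t S ∧ a ∈ U ∪ T ∧ ¬S ⊆ U ∪ T then ⊥ else ⊤ : Submodule ℝ C) := by
  by_cases h : U ∪ T ⊆ insert t S ∧ a ∈ U ∪ T ∧ ¬S ⊆ U ∪ T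
  · rw [if_pos h, Submodule.mem_bot]
    obtain ⟨h1, h2, h3⟩ := h
    rcases Finset.mem_union.mp h2 with h4 | h4
    · rw [if_pos ⟨Finset.subset_union_left.trans h1, h4,
        fun h5 => h3 (h5.trans Finset.subset_union_left)⟩, Submodule.mem_bot] at hf
      rw [hf, zero_mul]
    · rw [if_pos ⟨Finset.subset_union_right.trans h1, h4,
        fun h5 => h3 (h5.trans Finset.subset_union_right)⟩, Submodule.mem_bot] at hg
      rw [hg, mul_zero]
  · rw [if_neg h]
    exact Submodule.mem_top

theorem blockSubmodule_mul {f g : MvPowerSeries (Fin 4) C} (hf : f ∈ blockSubmodule C a t S)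
    (hg : g ∈ blockSubmodule C a t S) : f * g ∈ blockSubmodule C a t S :=
  coeffSubmodule_mul (V := fun _ U => if U ⊆ insert t S ∧ a ∈ U ∧ ¬S ⊆ U then ⊥ else ⊤)
    (fun _ _ => block_mul) 0 0 f g hf hg

theorem inv_metric_mem_blockSubmodule (u : Matrix (Fin 4) (Fin 4) (MvPowerSeries (Fin 4) C))
    (hu : ∀ i j, u i j ∈ blockSubmodule C a t S)
    (hu0 : ∀ i j, MvPowerSeries.coeff (epsExp ∅) (u i j) = 0) (i j : Fin 4) :
    (minkowski.map (algebraMap ℝ (MvPowerSeries (Fin 4) C)) + u)⁻¹ i j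
      ∈ blockSubmodule C a t S :=
  inv_metric_mem_coeffSubmodule (V := fun _ U => if U ⊆ insert t S ∧ a ∈ U ∧ ¬S ⊆ U then ⊥ else ⊤)
    (by simp) (fun _ _ => block_mul) u hu hu0 i j

theorem metric_mem_blockSubmodule (u : Matrix (Fin 4) (Fin 4) (MvPowerSeries (Fin 4) C))
    (hu : ∀ i j, u i j ∈ blockSubmodule C a t S) (i j : Fin 4) :
    (minkowski.map (algebraMap ℝ (MvPowerSeries (Fin 4) C)) + u) i j ∈ blockSubmodule C a t S :=
  metric_mem_coeffSubmodule (V := fun _ U => if U ⊆ insert t S ∧ a ∈ U ∧ ¬S ⊆ U then ⊥ else ⊤)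
    (by simp) u hu i j

theorem momDeriv_mem_blockSubmodule (ζ : Fin 4 → Fin 4 → C) (k : Fin 4)
    {f : MvPowerSeries (Fin 4) C} (hf : f ∈ blockSubmodule C a t S) :
    momDeriv ζ k f ∈ blockSubmodule C a t S := by
  rw [mem_blockSubmodule] at hf ⊢
  intro U h1 h2 h3
  rw [coeff_momDeriv, hf U h1 h2 h3, mul_zero]

theorem coeff_empty_mul {C : Type*} [CommRing C] (f g : MvPowerSeries (Fin 4) C) :
    MvPowerSeries.coeff (epsExp ∅) (f * g)
      = MvPowerSeries.coeff (epsExp ∅) f * MvPowerSeries.coeff (epsExp ∅) g := by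
  simp [coeff_epsExp_mul]

theorem coeff_singleton_mul {C : Type*} [CommRing C] (f g : MvPowerSeries (Fin 4) C) :
    MvPowerSeries.coeff (epsExp {t}) (f * g)
      = MvPowerSeries.coeff (epsExp ∅) f * MvPowerSeries.coeff (epsExp {t}) g
        + MvPowerSeries.coeff (epsExp {t}) f * MvPowerSeries.coeff (epsExp ∅) g := by
  rw [coeff_epsExp_mul, ← insert_empty_eq t, Finset.sum_powerset_insert (by simp)]
  simp

/-- The factor whose index set contains `a` must contain all of `S`, so only the splittings ∅ ∪ S
and S ∪ ∅ remain. -/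
theorem coeff_block_mul {f g : MvPowerSeries (Fin 4) C} (ha : a ∈ S)
    (hf : f ∈ blockSubmodule C a t S) (hg : g ∈ blockSubmodule C a t S) :
    MvPowerSeries.coeff (epsExp S) (f * g)
      = MvPowerSeries.coeff (epsExp ∅) f * MvPowerSeries.coeff (epsExp S) g
        + MvPowerSeries.coeff (epsExp S) f * MvPowerSeries.coeff (epsExp ∅) g := by
  rw [mem_blockSubmodule] at hf hg
  rw [coeff_epsExp_mul]
  have hne : ∅ ≠ S := (Finset.ne_empty_of_mem ha).symm
  rw [← Finset.sum_subset (s₁ := {∅, S}), Finset.sum_pair hne, Finset.sdiff_empty, Finset.sdiff_self]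
  · intro U hU
    rw [Finset.mem_insert, Finset.mem_singleton] at hU
    rcases hU with rfl | rfl <;> simp
  · intro U hU hU'
    rw [Finset.mem_insert, Finset.mem_singleton, not_or] at hU'
    rw [Finset.mem_powerset] at hU
    by_cases h : a ∈ U
    · rw [hf U (hU.trans (Finset.subset_insert _ _)) h
        fun h1 => hU'.2 (Finset.Subset.antisymm hU h1), zero_mul]
    · rw [hg _ (Finset.sdiff_subset.trans (Finset.subset_insert _ _))
        (Finset.mem_sdiff.mpr ⟨ha, h⟩) ?_, mul_zero]
      intro h1
      refine hU'.1 (Finset.eq_empty_of_forall_notMem fun i hi => ?_)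
      exact (Finset.mem_sdiff.mp (h1 (hU hi))).2 hi

/-- As above, with `t` free to go to either factor: the block `S` behaves like a single variable,
and of all splittings of `insert t S` only four survive. -/
theorem coeff_insert_mul {f g : MvPowerSeries (Fin 4) C} (ha : a ∈ S) (ht : t ∉ S)
    (hf : f ∈ blockSubmodule C a t S) (hg : g ∈ blockSubmodule C a t S) :
    MvPowerSeries.coeff (epsExp (insert t S)) (f * g)
      = MvPowerSeries.coeff (epsExp ∅) f * MvPowerSeries.coeff (epsExp (insert t S)) g
        + MvPowerSeries.coeff (epsExp {t}) f * MvPowerSeries.coeff (epsExp S) g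
        + MvPowerSeries.coeff (epsExp S) f * MvPowerSeries.coeff (epsExp {t}) g
        + MvPowerSeries.coeff (epsExp (insert t S)) f * MvPowerSeries.coeff (epsExp ∅) g := by
  rw [mem_blockSubmodule] at hf hg
  rw [coeff_epsExp_mul, Finset.sum_powerset_insert ht]
  have hne : ∅ ≠ S := (Finset.ne_empty_of_mem ha).symm
  have hins : ∀ U, a ∈ U → U ⊆ S → U ≠ S → ¬S ⊆ insert t U := by
    intro U _ hU hUS h
    refine hUS (Finset.Subset.antisymm hU fun i hi => ?_)
    rcases Finset.mem_insert.mp (h hi) with rfl | h'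
    · exact absurd hi ht
    · exact h'
  have hsd : ∀ U, a ∉ U → U ⊆ S → U ≠ ∅ → ¬S ⊆ insert t (S \ U) := by
    intro U hU hUS hne h
    refine hne (Finset.eq_empty_of_forall_notMem fun i hi => ?_)
    rcases Finset.mem_insert.mp (h (hUS hi)) with rfl | h'
    · exact ht (hUS hi)
    · exact (Finset.mem_sdiff.mp h').2 hi
  have hpair : ({∅, S} : Finset (Finset (Fin 4))) ⊆ S.powerset := by
    intro U hU
    rw [Finset.mem_insert, Finset.mem_singleton] at hU
    rcases hU with rfl | rfl <;> simp
  have h1 : ∀ U, U ⊆ S → insert t S \ U = insert t (S \ U) := fun U hU =>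
    Finset.insert_sdiff_of_notMem _ fun h => ht (hU h)
  have h2 : ∀ U, U ⊆ S → insert t S \ insert t U = S \ U := fun U hU => by
    rw [Finset.insert_sdiff_insert, Finset.sdiff_insert_of_notMem ht]
  rw [← Finset.sum_subset hpair, ← Finset.sum_subset hpair, Finset.sum_pair hne,
    Finset.sum_pair hne, h1 S subset_rfl, h2 S subset_rfl, h1 ∅ (Finset.empty_subset _),
    h2 ∅ (Finset.empty_subset _), Finset.sdiff_empty, Finset.sdiff_self, insert_empty_eq]
  · ring
  · intro U hU hU'
    rw [Finset.mem_insert, Finset.mem_singleton, not_or] at hU'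
    rw [Finset.mem_powerset] at hU
    rw [h2 U hU]
    by_cases h : a ∈ U
    · rw [hf _ (Finset.insert_subset_insert _ hU) (Finset.mem_insert_of_mem h)
        (hins U h hU hU'.2), zero_mul]
    · rw [hg _ (Finset.sdiff_subset.trans (Finset.subset_insert _ _))
        (Finset.mem_sdiff.mpr ⟨ha, h⟩) fun h3 => hsd U h hU hU'.1
          (h3.trans (Finset.subset_insert _ _)), mul_zero]
  · intro U hU hU'
    rw [Finset.mem_insert, Finset.mem_singleton, not_or] at hU'
    rw [Finset.mem_powerset] at hU
    rw [h1 U hU]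
    by_cases h : a ∈ U
    · rw [hf _ (hU.trans (Finset.subset_insert _ _)) h fun h3 => hins U h hU hU'.2
          (h3.trans (Finset.subset_insert _ _)), zero_mul]
    · rw [hg _ (Finset.insert_subset_insert _ Finset.sdiff_subset)
        (Finset.mem_insert_of_mem (Finset.mem_sdiff.mpr ⟨ha, h⟩)) (hsd U h hU hU'.1), mul_zero]

end Block

end

end FourWave

namespace FourWave

noncomputable section

/-! ### Coefficients of the nonlinearity in a block -/

section BlockCoefficients

/-- The diagonal entries of the Minkowski metric. -/
def sign (i : Fin 4) : ℂ := (minkowski i i : ℝ)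

theorem sign_mul_self (i : Fin 4) : sign i * sign i = 1 := by
  rw [sign, ← Complex.ofReal_mul, minkowski_mul_self_apply, Complex.ofReal_one]

theorem minkowski_eq_sign (i j : Fin 4) :
    ((minkowski i j : ℝ) : ℂ) = if i = j then sign i else 0 := by
  rw [minkowski_apply]
  split_ifs <;> simp [sign]

/-- `∂_m g_{nl} + ∂_n g_{ml} - ∂_l g_{mn}` for a wave with momentum `ξ`. -/
def waveChristoffel (ξ : Fin 4 → ℂ) (x : Matrix (Fin 4) (Fin 4) ℂ) (l m n : Fin 4) : ℂ :=
  ξ m * x n l + ξ n * x m l - ξ l * x m n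

variable {a t : Fin 4} {S : Finset (Fin 4)} {ζ : Fin 4 → Fin 4 → ℂ}
  {u : Matrix (Fin 4) (Fin 4) (MvPowerSeries (Fin 4) ℂ)}

/-- The metric `ĝ + u`. -/
def expMetric (u : Matrix (Fin 4) (Fin 4) (MvPowerSeries (Fin 4) ℂ)) :
    Matrix (Fin 4) (Fin 4) (MvPowerSeries (Fin 4) ℂ) :=
  minkowski.map (algebraMap ℝ (MvPowerSeries (Fin 4) ℂ)) + u

theorem expMetric_mem (hu : ∀ i j, u i j ∈ blockSubmodule ℂ a t S) (i j : Fin 4) :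
    expMetric u i j ∈ blockSubmodule ℂ a t S := metric_mem_blockSubmodule u hu i j

theorem inv_expMetric_mem (hu : ∀ i j, u i j ∈ blockSubmodule ℂ a t S)
    (hu0 : ∀ i j, MvPowerSeries.coeff (epsExp ∅) (u i j) = 0) (i j : Fin 4) :
    (expMetric u)⁻¹ i j ∈ blockSubmodule ℂ a t S := inv_metric_mem_blockSubmodule u hu hu0 i j

theorem coeff_expMetric {U : Finset (Fin 4)} (hU : U ≠ ∅) (i j : Fin 4) :
    MvPowerSeries.coeff (epsExp U) (expMetric u i j) = MvPowerSeries.coeff (epsExp U) (u i j) := by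
  rw [expMetric, Matrix.add_apply, map_add, Matrix.map_apply, coeff_minkowski, if_neg hU, zero_add]

theorem coeff_empty_expMetric (hu0 : ∀ i j, MvPowerSeries.coeff (epsExp ∅) (u i j) = 0)
    (i j : Fin 4) :
    MvPowerSeries.coeff (epsExp ∅) (expMetric u i j) = if i = j then sign i else 0 := by
  rw [expMetric, Matrix.add_apply, map_add, Matrix.map_apply, coeff_minkowski, if_pos rfl, hu0, add_zero,
    ← minkowski_eq_sign]
  rfl

theorem coeff_empty_inv (hu0 : ∀ i j, MvPowerSeries.coeff (epsExp ∅) (u i j) = 0) (i j : Fin 4) :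
    MvPowerSeries.coeff (epsExp ∅) ((expMetric u)⁻¹ i j) = if i = j then sign i else 0 := by
  rw [expMetric, coeff_inv_metric u hu0]
  by_cases h : i = j <;> simp [h, sign]

/-- The first-order perturbation of an inverse, -ĝ⁻¹ u ĝ⁻¹. It holds at every set where the
coefficients of products obey the Leibniz rule, in particular at the block and at a single wave. -/
theorem coeff_inv_of_rule {U : Finset (Fin 4)} (hU : U ≠ ∅)
    (hu0 : ∀ i j, MvPowerSeries.coeff (epsExp ∅) (u i j) = 0)
    (hrule : ∀ i j l, MvPowerSeries.coeff (epsExp U) (expMetric u i j * (expMetric u)⁻¹ j l)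
      = MvPowerSeries.coeff (epsExp ∅) (expMetric u i j) *
          MvPowerSeries.coeff (epsExp U) ((expMetric u)⁻¹ j l)
        + MvPowerSeries.coeff (epsExp U) (expMetric u i j) *
          MvPowerSeries.coeff (epsExp ∅) ((expMetric u)⁻¹ j l)) (i l : Fin 4) :
    MvPowerSeries.coeff (epsExp U) ((expMetric u)⁻¹ i l)
      = -(sign i * sign l * MvPowerSeries.coeff (epsExp U) (u i l)) := by
  have h1 : expMetric u * (expMetric u)⁻¹ = 1 := Matrix.mul_nonsing_inv _ (isUnit_det_metric u hu0)
  have h2 := congrArg (fun M : Matrix (Fin 4) (Fin 4) (MvPowerSeries (Fin 4) ℂ) =>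
    MvPowerSeries.coeff (epsExp U) (M i l)) h1
  have h3 : MvPowerSeries.coeff (epsExp U)
      ((1 : Matrix (Fin 4) (Fin 4) (MvPowerSeries (Fin 4) ℂ)) i l) = 0 := by
    rw [Matrix.one_apply]
    by_cases h : i = l
    · rw [if_pos h, MvPowerSeries.coeff_one, if_neg]
      rw [← epsExp_empty, epsExp_injective.eq_iff]
      exact hU
    · simp [h]
  simp only [Matrix.mul_apply, map_sum, hrule, coeff_empty_expMetric hu0, coeff_empty_inv hu0,
    coeff_expMetric hU, Finset.sum_add_distrib, h3, ite_mul, mul_ite, zero_mul, mul_zero,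
    Finset.sum_ite_eq, Finset.sum_ite_eq', Finset.mem_univ, if_true] at h2
  linear_combination sign i * h2
    - MvPowerSeries.coeff (epsExp U) ((expMetric u)⁻¹ i l) * sign_mul_self i

variable (ha : a ∈ S) (ht : t ∉ S) (hu : ∀ i j, u i j ∈ blockSubmodule ℂ a t S)
  (hu0 : ∀ i j, MvPowerSeries.coeff (epsExp ∅) (u i j) = 0)
  {x y : Matrix (Fin 4) (Fin 4) ℂ} {ξ η : Fin 4 → ℂ}
  (hξ : ∀ k, totalMom ζ S k = ξ k) (hη : ∀ k, ζ t k = η k)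
  (hx : ∀ i j, MvPowerSeries.coeff (epsExp S) (u i j) = x i j)
  (hy : ∀ i j, MvPowerSeries.coeff (epsExp {t}) (u i j) = y i j)
  (hxy : ∀ i j, MvPowerSeries.coeff (epsExp (insert t S)) (u i j) = 0)

include hu hu0

theorem christoffel_mem_blockSubmodule (q m n : Fin 4) :
    christoffel (momDeriv ζ) (expMetric u) q m n ∈ blockSubmodule ℂ a t S :=
  christoffel_mem (P := fun _ => blockSubmodule ℂ a t S) (fun _ _ _ _ => blockSubmodule_mul)
    (fun _ k _ _ => momDeriv_mem_blockSubmodule ζ k) _ (expMetric_mem hu)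
    (inv_expMetric_mem hu hu0) q m n

theorem harmonicity_mem_blockSubmodule (n : Fin 4) :
    harmonicity (momDeriv ζ) (expMetric u) n ∈ blockSubmodule ℂ a t S :=
  harmonicity_mem (P := fun _ => blockSubmodule ℂ a t S) (fun _ _ _ _ => blockSubmodule_mul)
    (fun _ k _ _ => momDeriv_mem_blockSubmodule ζ k) _ (expMetric_mem hu)
    (inv_expMetric_mem hu hu0) n

omit hu hu0 in
theorem coeff_smul_half (U : Finset (Fin 4)) (f : MvPowerSeries (Fin 4) ℂ) :
    MvPowerSeries.coeff (epsExp U) ((1 / 2 : ℝ) • f) = 1 / 2 * MvPowerSeries.coeff (epsExp U) f := by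
  have : MvPowerSeries.coeff (epsExp U) ((1 / 2 : ℝ) • f)
    = (1 / 2 : ℝ) • MvPowerSeries.coeff (epsExp U) f := rfl
  rw [this, Complex.real_smul]
  norm_num

omit hu hu0 in
theorem coeff_smul_two (U : Finset (Fin 4)) (f : MvPowerSeries (Fin 4) ℂ) :
    MvPowerSeries.coeff (epsExp U) ((2 : ℝ) • f) = 2 * MvPowerSeries.coeff (epsExp U) f := by
  have : MvPowerSeries.coeff (epsExp U) ((2 : ℝ) • f)
    = (2 : ℝ) • MvPowerSeries.coeff (epsExp U) f := rfl
  rw [this, Complex.real_smul]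
  norm_num

omit hu hu0 in
theorem coeff_empty_christoffel (q m n : Fin 4) :
    MvPowerSeries.coeff (epsExp ∅) (christoffel (momDeriv ζ) (expMetric u) q m n) = 0 := by
  rw [christoffel, coeff_smul_half]
  simp [coeff_empty_mul, coeff_momDeriv, totalMom]

include ha hξ hx in
theorem coeff_block_christoffel (q m n : Fin 4) :
    MvPowerSeries.coeff (epsExp S) (christoffel (momDeriv ζ) (expMetric u) q m n)
      = 1 / 2 * (sign q * waveChristoffel ξ x q m n) := by
  have hS : S ≠ ∅ := Finset.ne_empty_of_mem ha
  have hm := expMetric_mem hu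
  have hD := fun k i j => momDeriv_mem_blockSubmodule ζ k (hm i j)
  rw [christoffel, coeff_smul_half, map_sum]
  congr 1
  rw [Finset.sum_eq_single q]
  · rw [coeff_block_mul ha (inv_expMetric_mem hu hu0 _ _)
      (Submodule.sub_mem _ (Submodule.add_mem _ (hD _ _ _) (hD _ _ _)) (hD _ _ _))]
    simp [coeff_momDeriv, totalMom, coeff_empty_inv hu0, coeff_expMetric hS, ← hx, waveChristoffel,
      ← hξ]
  · intro l _ hl
    rw [coeff_block_mul ha (inv_expMetric_mem hu hu0 _ _)
      (Submodule.sub_mem _ (Submodule.add_mem _ (hD _ _ _) (hD _ _ _)) (hD _ _ _))]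
    simp [coeff_momDeriv, totalMom, coeff_empty_inv hu0, hl.symm]
  · simp

omit hu in
include hη hy in
theorem coeff_singleton_christoffel (q m n : Fin 4) :
    MvPowerSeries.coeff (epsExp {t}) (christoffel (momDeriv ζ) (expMetric u) q m n)
      = 1 / 2 * (sign q * waveChristoffel η y q m n) := by
  rw [christoffel, coeff_smul_half, map_sum]
  congr 1
  rw [Finset.sum_eq_single q]
  · rw [coeff_singleton_mul]
    simp [coeff_momDeriv, totalMom, coeff_empty_inv hu0, coeff_expMetric (Finset.singleton_ne_empty t),
      ← hy, waveChristoffel, ← hη]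
  · intro l _ hl
    rw [coeff_singleton_mul]
    simp [coeff_momDeriv, totalMom, coeff_empty_inv hu0, hl.symm]
  · simp

include ha ht hξ hη hx hy hxy

/-- The Christoffel symbols of ĝ vanish, so the second-order part comes only from the first-order
inverse metric times a first-order symbol. The second-order inverse metric multiplies derivatives of
ĝ, which are zero, and `hxy` excludes a second-order field. -/
theorem coeff_insert_christoffel (q m n : Fin 4) :
    MvPowerSeries.coeff (epsExp (insert t S)) (christoffel (momDeriv ζ) (expMetric u) q m n)
      = -(1 / 2) * ∑ l, sign q * sign l * (x q l * waveChristoffel η y l m n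
        + y q l * waveChristoffel ξ x l m n) := by
  have hS : S ≠ ∅ := Finset.ne_empty_of_mem ha
  have hm := expMetric_mem hu
  have hi := inv_expMetric_mem hu hu0
  have hD := fun k i j => momDeriv_mem_blockSubmodule ζ k (hm i j)
  rw [christoffel, coeff_smul_half, map_sum, neg_mul, ← mul_neg, ← Finset.sum_neg_distrib]
  congr 1
  refine Finset.sum_congr rfl fun l _ => ?_
  rw [coeff_insert_mul ha ht (hi _ _)
    (Submodule.sub_mem _ (Submodule.add_mem _ (hD _ _ _) (hD _ _ _)) (hD _ _ _)),
    coeff_inv_of_rule hS hu0 (fun i j l => coeff_block_mul ha (hm i j) (hi j l)),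
    coeff_inv_of_rule (Finset.singleton_ne_empty t) hu0 (fun i j l => coeff_singleton_mul _ _), hx, hy]
  simp only [map_sub, map_add, coeff_momDeriv, coeff_expMetric (Finset.insert_ne_empty t S), hxy,
    coeff_expMetric hS, coeff_expMetric (Finset.singleton_ne_empty t), hξ, hx, hy]
  simp only [totalMom, Finset.sum_empty, Finset.sum_singleton, hη, waveChristoffel]
  ring

omit hxy ht hη hy in
theorem coeff_block_harmonicity (n : Fin 4) :
    MvPowerSeries.coeff (epsExp S) (harmonicity (momDeriv ζ) (expMetric u) n)
      = 1 / 2 * (sign n * ∑ j, sign j * waveChristoffel ξ x n j j) := by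
  have hi := inv_expMetric_mem hu hu0
  have hΓ := christoffel_mem_blockSubmodule (ζ := ζ) hu hu0
  simp only [harmonicity, map_sum, coeff_block_mul ha (hi _ _) (hΓ _ _ _), coeff_empty_inv hu0,
    coeff_empty_christoffel, coeff_block_christoffel ha hu hu0 hξ hx, mul_zero, add_zero, ite_mul,
    zero_mul, Finset.sum_ite_eq, Finset.mem_univ, if_true, Finset.mul_sum]
  exact Finset.sum_congr rfl fun j _ => by ring

omit hxy ha ht hξ hx hu in
theorem coeff_singleton_harmonicity (n : Fin 4) :
    MvPowerSeries.coeff (epsExp {t}) (harmonicity (momDeriv ζ) (expMetric u) n)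
      = 1 / 2 * (sign n * ∑ j, sign j * waveChristoffel η y n j j) := by
  simp only [harmonicity, map_sum, coeff_singleton_mul, coeff_empty_inv hu0,
    coeff_empty_christoffel, coeff_singleton_christoffel hu0 hη hy, mul_zero, add_zero, ite_mul,
    zero_mul, Finset.sum_ite_eq, Finset.mem_univ, if_true, Finset.mul_sum]
  exact Finset.sum_congr rfl fun j _ => by ring

/-- Two sources at second order: the flat trace of the second-order Christoffel symbol, and the
first-order inverse metric times the first-order symbol. -/
theorem coeff_insert_harmonicity (n : Fin 4) :
    MvPowerSeries.coeff (epsExp (insert t S)) (harmonicity (momDeriv ζ) (expMetric u) n)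
      = -(1 / 2) * (∑ j, ∑ l, sign j * sign n * sign l * (x n l * waveChristoffel η y l j j
          + y n l * waveChristoffel ξ x l j j)
        + ∑ j, ∑ k, sign j * sign k * sign n * (x j k * waveChristoffel η y n j k
          + y j k * waveChristoffel ξ x n j k)) := by
  have hS : S ≠ ∅ := Finset.ne_empty_of_mem ha
  have hm := expMetric_mem hu
  have hi := inv_expMetric_mem hu hu0
  have hΓ := christoffel_mem_blockSubmodule (ζ := ζ) hu hu0
  simp only [harmonicity, map_sum, coeff_insert_mul ha ht (hi _ _) (hΓ _ _ _), coeff_empty_inv hu0,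
    coeff_empty_christoffel, coeff_block_christoffel ha hu hu0 hξ hx,
    coeff_singleton_christoffel hu0 hη hy,
    coeff_inv_of_rule hS hu0 (fun i j l => coeff_block_mul ha (hm i j) (hi j l)),
    coeff_inv_of_rule (Finset.singleton_ne_empty t) hu0 (fun i j l => coeff_singleton_mul _ _), hx, hy,
    mul_zero, add_zero, ite_mul, zero_mul, Finset.sum_add_distrib, Finset.sum_ite_eq,
    Finset.mem_univ, if_true]
  simp only [coeff_insert_christoffel ha ht hu hu0 hξ hη hx hy hxy]
  simp only [← Finset.sum_add_distrib, Finset.mul_sum]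
  refine Finset.sum_congr rfl fun j _ => Finset.sum_congr rfl fun k _ => ?_
  ring

/-- The nonlinearity in a block. -/
theorem momSource_insert (hFx : ∀ n, ∑ j, sign j * waveChristoffel ξ x n j j = 0)
    (hFy : ∀ n, ∑ j, sign j * waveChristoffel η y n j j = 0) (j k : Fin 4) :
    momSource ζ (insert t S) u j k
      = -(∑ p, ((ξ p + η p) * ∑ l, sign p * sign l * (x p l * waveChristoffel η y l j k
            + y p l * waveChristoffel ξ x l j k)
          - (ξ k + η k) * ∑ l, sign p * sign l * (x p l * waveChristoffel η y l j p
            + y p l * waveChristoffel ξ x l j p)))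
        + 1 / 2 * (∑ p, ∑ q, sign p * sign q *
          (waveChristoffel ξ x p p q * waveChristoffel η y q j k
            + waveChristoffel η y p p q * waveChristoffel ξ x q j k
            - waveChristoffel ξ x p k q * waveChristoffel η y q j p
            - waveChristoffel η y p k q * waveChristoffel ξ x q j p))
        + 1 / 2 * ((ξ k + η k) * (∑ p, ∑ q, sign p * sign q * (x p q * waveChristoffel η y j p q
          + y p q * waveChristoffel ξ x j p q))
        + (ξ j + η j) * (∑ p, ∑ q, sign p * sign q * (x p q * waveChristoffel η y k p q
          + y p q * waveChristoffel ξ x k p q))) := by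
  have hS : S ≠ ∅ := Finset.ne_empty_of_mem ha
  have hm := expMetric_mem hu
  have hi := inv_expMetric_mem hu hu0
  have hΓ := christoffel_mem_blockSubmodule (ζ := ζ) hu hu0
  have hF := harmonicity_mem_blockSubmodule (ζ := ζ) hu hu0
  have hσ : ∀ k, totalMom ζ (insert t S) k = ξ k + η k := fun k => by
    rw [totalMom, Finset.sum_insert ht, hη, ← hξ, totalMom, add_comm]
  have hF2 : ∀ n, MvPowerSeries.coeff (epsExp (insert t S))
      (harmonicity (momDeriv ζ) (expMetric u) n)
      = -(1 / 2) * sign n * ∑ p, ∑ q, sign p * sign q * (x p q * waveChristoffel η y n p q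
          + y p q * waveChristoffel ξ x n p q) := by
    intro n
    rw [coeff_insert_harmonicity ha ht hu hu0 hξ hη hx hy hxy]
    have : ∑ j, ∑ l, sign j * sign n * sign l * (x n l * waveChristoffel η y l j j
          + y n l * waveChristoffel ξ x l j j)
        = ∑ l, sign n * sign l * (x n l * ∑ j, sign j * waveChristoffel η y l j j
          + y n l * ∑ j, sign j * waveChristoffel ξ x l j j) := by
      rw [Finset.sum_comm]
      refine Finset.sum_congr rfl fun l _ => ?_
      rw [Finset.mul_sum, Finset.mul_sum, ← Finset.sum_add_distrib, Finset.mul_sum]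
      exact Finset.sum_congr rfl fun j _ => by ring
    rw [this]
    simp only [hFx, hFy, mul_zero, add_zero, Finset.sum_const_zero, zero_add]
    rw [mul_assoc]
    congr 1
    rw [Finset.mul_sum]
    refine Finset.sum_congr rfl fun p _ => ?_
    rw [Finset.mul_sum]
    exact Finset.sum_congr rfl fun q _ => by ring
  have hw : MvPowerSeries.coeff (epsExp (insert t S)) (waveOp (momDeriv ζ) (u j k)) = 0 := by
    rw [waveOp, map_sum]
    refine Finset.sum_eq_zero fun p _ => ?_
    rw [map_sum]
    refine Finset.sum_eq_zero fun q _ => ?_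
    have : MvPowerSeries.coeff (epsExp (insert t S))
        (minkowski p q • momDeriv ζ p (momDeriv ζ q (u j k)))
      = minkowski p q • MvPowerSeries.coeff (epsExp (insert t S))
        (momDeriv ζ p (momDeriv ζ q (u j k))) := rfl
    rw [this, coeff_momDeriv, coeff_momDeriv, hxy]
    simp
  have hgF : ∀ j k, MvPowerSeries.coeff (epsExp (insert t S))
      (∑ n, (expMetric u j n * momDeriv ζ k (harmonicity (momDeriv ζ) (expMetric u) n)))
      = -(1 / 2) * ((ξ k + η k) * ∑ p, ∑ q, sign p * sign q * (x p q * waveChristoffel η y j p q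
          + y p q * waveChristoffel ξ x j p q)) := by
    intro j k
    rw [map_sum]
    simp only [coeff_insert_mul ha ht (hm _ _) (momDeriv_mem_blockSubmodule ζ _ (hF _)),
      coeff_empty_expMetric hu0, coeff_momDeriv, hF2,
      coeff_block_harmonicity ha hu hu0 hξ hx, coeff_singleton_harmonicity hu0 hη hy, hFx, hFy,
      mul_zero, add_zero, totalMom_empty, zero_mul, ite_mul, Finset.sum_ite_eq, Finset.mem_univ,
      if_true, hσ]
    linear_combination (-(1 / 2) * ((ξ k + η k) * ∑ p, ∑ q, sign p * sign q *
      (x p q * waveChristoffel η y j p q + y p q * waveChristoffel ξ x j p q))) * sign_mul_self j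
  rw [momSource, Matrix.map_apply, nonlinearity, Matrix.of_apply, ← expMetric, map_add, hw, coeff_smul_two,
    reducedRicci, map_sub, coeff_smul_half, Finset.sum_add_distrib, map_add, hgF, hgF, ricci,
    map_add]
  simp only [map_sum, map_sub, coeff_insert_mul ha ht (hΓ _ _ _) (hΓ _ _ _), coeff_momDeriv, hσ,
    coeff_empty_christoffel, coeff_insert_christoffel ha ht hu hu0 hξ hη hx hy hxy,
    coeff_block_christoffel ha hu hu0 hξ hx, coeff_singleton_christoffel hu0 hη hy, zero_mul,
    mul_zero, zero_add, add_zero]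
  have e1 : ∀ (f g : Fin 4 → ℂ), ∑ p, ((ξ p + η p) * (-(1 / 2) * f p)
      - (ξ k + η k) * (-(1 / 2) * g p))
      = -(1 / 2) * ∑ p, ((ξ p + η p) * f p - (ξ k + η k) * g p) := by
    intro f g
    rw [Finset.mul_sum]
    exact Finset.sum_congr rfl fun p _ => by ring
  have e2 : ∀ A B C D E F G H : Fin 4 → Fin 4 → ℂ, ∑ p, ∑ q,
      (1 / 2 * (sign p * A p q) * (1 / 2 * (sign q * B p q))
        + 1 / 2 * (sign p * C p q) * (1 / 2 * (sign q * D p q))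
        - (1 / 2 * (sign p * E p q) * (1 / 2 * (sign q * F p q))
          + 1 / 2 * (sign p * G p q) * (1 / 2 * (sign q * H p q)))) =
      1 / 4 * ∑ p, ∑ q, sign p * sign q
        * (C p q * D p q + A p q * B p q - G p q * H p q - E p q * F p q) := by
    intro A B C D E F G H
    simp only [Finset.mul_sum]
    exact Finset.sum_congr rfl fun p _ => Finset.sum_congr rfl fun q _ => by ring
  rw [e1, e2 (fun p q => waveChristoffel η y p p q) (fun p q => waveChristoffel ξ x q j k)
    (fun p q => waveChristoffel ξ x p p q) (fun p q => waveChristoffel η y q j k)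
    (fun p q => waveChristoffel η y p k q) (fun p q => waveChristoffel ξ x q j p)
    (fun p q => waveChristoffel ξ x p k q) (fun p q => waveChristoffel η y q j p)]
  ring

end BlockCoefficients

end

end FourWave

namespace FourWave

noncomputable section

/-! ### The interaction of a harmonic tensor with a null wave -/

section Absorb

/-- The Minkowski pairing of complex covectors. -/
def dot (p q : Fin 4 → ℂ) : ℂ := ∑ i, sign i * p i * q i

/-- The product of a tensor and a covector. -/
def apply (x : Matrix (Fin 4) (Fin 4) ℂ) (p : Fin 4 → ℂ) (j : Fin 4) : ℂ :=
  ∑ l, sign l * x j l * p l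

/-- The trace with respect to the Minkowski metric. -/
def mtrace (x : Matrix (Fin 4) (Fin 4) ℂ) : ℂ := ∑ i, sign i * x i i

/-- Symmetric complex tensors with the harmonicity condition at `ξ`. -/
def IsHarmonic (ξ : Fin 4 → ℂ) (x : Matrix (Fin 4) (Fin 4) ℂ) : Prop :=
  (∀ i j, x i j = x j i) ∧ ∀ j, apply x ξ j = 1 / 2 * mtrace x * ξ j

/-- The source that a tensor `x` with momentum `ξ` creates when it meets the wave with momentum `η`
and polarization `ε ⊗ ε`. -/
def absorb (ξ η ε : Fin 4 → ℂ) (x : Matrix (Fin 4) (Fin 4) ℂ) : Matrix (Fin 4) (Fin 4) ℂ :=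
  Matrix.of fun j k => dot ε ξ ^ 2 * x j k
    + dot ε ξ * (η j * apply x ε k + η k * apply x ε j)
    - dot ε ξ * (ε j * apply x η k + ε k * apply x η j)
    + dot ε (apply x η) * (ξ j * ε k + ξ k * ε j) + dot η (apply x η) * (ε j * ε k)
    - 1 / 2 * dot ε (apply x ε) * (η j * ξ k + η k * ξ j)

variable {ξ η ε : Fin 4 → ℂ} {x y : Matrix (Fin 4) (Fin 4) ℂ}

theorem IsHarmonic.waveChristoffel_trace (hx : IsHarmonic ξ x) (n : Fin 4) :
    ∑ j, sign j * waveChristoffel ξ x n j j = 0 := by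
  have h := hx.2 n
  simp only [apply, mtrace, waveChristoffel, Fin.sum_univ_four] at h ⊢
  rw [hx.1 0 n, hx.1 1 n, hx.1 2 n, hx.1 3 n]
  linear_combination 2 * h

/-- The tensor ε ⊗ ε is trace-free because ε is null and is annihilated by η because ε is
transverse, so both sides of the harmonicity condition vanish. -/
theorem isHarmonic_null (hεε : dot ε ε = 0) (hεη : dot ε η = 0) :
    IsHarmonic η (Matrix.of fun i j => ε i * ε j) := by
  refine ⟨fun i j => mul_comm _ _, fun j => ?_⟩
  simp only [apply, mtrace, dot, Matrix.of_apply, Fin.sum_univ_four] at hεε hεη ⊢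
  linear_combination ε j * hεη - 1 / 2 * η j * hεε

/-- The first of five contractions that reduce the bilinear nonlinearity to `absorb`. Harmonicity
replaces x ξ by a multiple of ξ, and nullity and transversality of ε remove most terms. -/
theorem sum_momentum_christoffel (hx : IsHarmonic ξ x) (hξη : dot ξ η = 0) (hεη : dot ε η = 0)
    (hy : ∀ i j, y i j = ε i * ε j) (j k : Fin 4) :
    ∑ p, (ξ p + η p) * ∑ l, sign p * sign l * (x p l * waveChristoffel η y l j k
            + y p l * waveChristoffel ξ x l j k)
      = (1 / 2 * mtrace x * dot ε ξ + dot ε (apply x η)) * (η j * ε k + η k * ε j)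
        - dot η (apply x η) * (ε j * ε k) + dot ε ξ * (ξ j * apply x ε k + ξ k * apply x ε j)
        - dot ε ξ ^ 2 * x j k := by
  have h1 : ∀ l, ∑ p, (ξ p + η p) * (sign p * sign l * (x p l * waveChristoffel η y l j k
            + y p l * waveChristoffel ξ x l j k))
      = sign l * ((1 / 2 * mtrace x * ξ l + apply x η l) * waveChristoffel η y l j k
        + dot ε ξ * ε l * waveChristoffel ξ x l j k) := by
    intro l
    rw [← hx.2 l]
    simp only [apply, dot, hy, hx.1 l, Fin.sum_univ_four] at hεη ⊢
    linear_combination sign l * ε l * waveChristoffel ξ x l j k * hεη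
  simp only [Finset.mul_sum]
  rw [Finset.sum_comm]
  simp only [h1]
  have h2 : ∀ q : Fin 4 → ℂ, ∑ l, sign l * (q l * waveChristoffel η y l j k)
      = dot ε q * (η j * ε k + η k * ε j) - dot η q * (ε j * ε k) := by
    intro q
    simp only [waveChristoffel, hy, dot, Fin.sum_univ_four]
    ring
  have h3 : ∑ l, sign l * (ε l * waveChristoffel ξ x l j k)
      = ξ j * apply x ε k + ξ k * apply x ε j - dot ε ξ * x j k := by
    simp only [waveChristoffel, apply, dot, Fin.sum_univ_four]
    ring
  have h4 : ∀ p : Fin 4 → ℂ, dot p (fun l => 1 / 2 * mtrace x * ξ l + apply x η l)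
      = 1 / 2 * mtrace x * dot p ξ + dot p (apply x η) := by
    intro p
    simp only [dot, Fin.sum_univ_four]
    ring
  have h5 : dot η ξ = 0 := by
    rw [← hξη, dot, dot]
    exact Finset.sum_congr rfl fun i _ => by ring
  simp only [mul_add, Finset.sum_add_distrib, mul_assoc (dot ε ξ)]
  rw [h2, h4, h4, h5]
  simp only [mul_left_comm _ (dot ε ξ)]
  rw [← Finset.mul_sum, h3]
  ring

theorem sum_christoffel_trace (hx : IsHarmonic ξ x)
    (hy : ∀ i j, y i j = ε i * ε j) (j k : Fin 4) :
    ∑ p, (ξ k + η k) * ∑ l, sign p * sign l * (x p l * waveChristoffel η y l j p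
            + y p l * waveChristoffel ξ x l j p)
      = dot ε (apply x ε) * ((ξ j + η j) * (ξ k + η k)) := by
  simp only [waveChristoffel, apply, dot, hy, Fin.sum_univ_four]
  rw [hx.1 1 0, hx.1 2 0, hx.1 3 0, hx.1 2 1, hx.1 3 1, hx.1 3 2]
  ring

theorem sum_harmonicity (hx : IsHarmonic ξ x)
    (hy : ∀ i j, y i j = ε i * ε j) (j : Fin 4) :
    ∑ p, ∑ q, sign p * sign q * (x p q * waveChristoffel η y j p q
          + y p q * waveChristoffel ξ x j p q)
      = 2 * (dot ε (apply x η) * ε j + dot ε ξ * apply x ε j)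
        - dot ε (apply x ε) * (ξ j + η j) := by
  simp only [waveChristoffel, apply, dot, hy, Fin.sum_univ_four]
  rw [hx.1 1 0, hx.1 2 0, hx.1 3 0, hx.1 2 1, hx.1 3 1, hx.1 3 2, hx.1 0 j, hx.1 1 j, hx.1 2 j,
    hx.1 3 j]
  ring

theorem sum_christoffel_trace_mul (hx : IsHarmonic ξ x) (hξη : dot ξ η = 0) (hεε : dot ε ε = 0)
    (hy : ∀ i j, y i j = ε i * ε j) (j k : Fin 4) :
    ∑ p, ∑ q, sign p * sign q * (waveChristoffel ξ x p p q * waveChristoffel η y q j k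
            + waveChristoffel η y p p q * waveChristoffel ξ x q j k)
      = mtrace x * dot ε ξ * (η j * ε k + η k * ε j) := by
  have h1 : ∀ q, ∑ p, sign p * waveChristoffel ξ x p p q = mtrace x * ξ q := by
    intro q
    simp only [waveChristoffel, mtrace, Fin.sum_univ_four, hx.1 q]
    ring
  have h2 : ∀ q, ∑ p, sign p * waveChristoffel η y p p q = 0 := by
    intro q
    simp only [waveChristoffel, hy, dot, Fin.sum_univ_four] at hεε ⊢
    linear_combination η q * hεε
  have h3 : ∀ q, ∑ p, sign p * sign q * (waveChristoffel ξ x p p q * waveChristoffel η y q j k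
            + waveChristoffel η y p p q * waveChristoffel ξ x q j k)
      = sign q * (mtrace x * ξ q * waveChristoffel η y q j k) := by
    intro q
    have e1 : sign q * (mtrace x * ξ q * waveChristoffel η y q j k)
      = sign q * waveChristoffel η y q j k * ∑ p, sign p * waveChristoffel ξ x p p q
        + sign q * waveChristoffel ξ x q j k * ∑ p, sign p * waveChristoffel η y p p q := by
      rw [h1, h2]
      ring
    rw [e1, Finset.mul_sum, Finset.mul_sum, ← Finset.sum_add_distrib]
    exact Finset.sum_congr rfl fun p _ => by ring
  rw [Finset.sum_comm]
  simp only [h3]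
  simp only [waveChristoffel, hy, dot, Fin.sum_univ_four] at hξη ⊢
  linear_combination - mtrace x * ε j * ε k * hξη

theorem sum_christoffel_mul (hx : IsHarmonic ξ x) (hξη : dot ξ η = 0)
    (hy : ∀ i j, y i j = ε i * ε j) (j k : Fin 4) :
    ∑ p, ∑ q, sign p * sign q * (waveChristoffel ξ x p k q * waveChristoffel η y q j p)
      = dot ε (apply x ε) * (η j * ξ k) + 2 * dot ε ξ * (ε j * apply x η k) := by
  simp only [waveChristoffel, apply, dot, hy, Fin.sum_univ_four] at hξη ⊢
  rw [hx.1 1 0, hx.1 2 0, hx.1 3 0, hx.1 2 1, hx.1 3 1, hx.1 3 2]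
  linear_combination -2 * ε j *
    (sign 0 * x k 0 * ε 0 + sign 1 * x k 1 * ε 1 + sign 2 * x k 2 * ε 2 + sign 3 * x k 3 * ε 3) * hξη

theorem momSource_insert_eq_absorb {a t : Fin 4} {S : Finset (Fin 4)} {ζ : Fin 4 → Fin 4 → ℂ}
    {u : Matrix (Fin 4) (Fin 4) (MvPowerSeries (Fin 4) ℂ)}
    (ha : a ∈ S) (ht : t ∉ S) (hu : ∀ i j, u i j ∈ blockSubmodule ℂ a t S)
    (hu0 : ∀ i j, MvPowerSeries.coeff (epsExp ∅) (u i j) = 0)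
    (hξ : ∀ k, totalMom ζ S k = ξ k) (hη : ∀ k, ζ t k = η k)
    (hux : ∀ i j, MvPowerSeries.coeff (epsExp S) (u i j) = x i j)
    (huy : ∀ i j, MvPowerSeries.coeff (epsExp {t}) (u i j) = ε i * ε j)
    (hxy : ∀ i j, MvPowerSeries.coeff (epsExp (insert t S)) (u i j) = 0)
    (hx : IsHarmonic ξ x) (hξη : dot ξ η = 0) (hεε : dot ε ε = 0) (hεη : dot ε η = 0) :
    momSource ζ (insert t S) u = absorb ξ η ε x := by
  ext j k
  have hy : ∀ i j, (Matrix.of fun i j => ε i * ε j : Matrix (Fin 4) (Fin 4) ℂ) i j = ε i * ε j :=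
    fun _ _ => rfl
  have e : ∀ A B C D : Fin 4 → Fin 4 → ℂ, ∑ p, ∑ q, sign p * sign q *
      (A p q + B p q - C p q - D p q)
      = ∑ p, ∑ q, sign p * sign q * (A p q + B p q) - ∑ p, ∑ q, sign p * sign q * C p q
        - ∑ p, ∑ q, sign p * sign q * D p q := by
    intro A B C D
    simp only [← Finset.sum_sub_distrib]
    exact Finset.sum_congr rfl fun p _ => Finset.sum_congr rfl fun q _ => by ring
  have e' : ∑ p, ∑ q, sign p * sign q *
      (waveChristoffel η (Matrix.of fun i j => ε i * ε j) p k q * waveChristoffel ξ x q j p)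
      = dot ε (apply x ε) * (η k * ξ j) + 2 * dot ε ξ * (ε k * apply x η j) := by
    rw [← sum_christoffel_mul hx hξη hy, Finset.sum_comm]
    exact Finset.sum_congr rfl fun p _ => Finset.sum_congr rfl fun q _ => by ring
  rw [momSource_insert ha ht hu hu0 hξ hη hux (y := Matrix.of fun i j => ε i * ε j) huy hxy
    hx.waveChristoffel_trace (isHarmonic_null hεε hεη).waveChristoffel_trace,
    Finset.sum_sub_distrib, sum_momentum_christoffel hx hξη hεη hy, sum_christoffel_trace hx hy,
    e, sum_christoffel_trace_mul hx hξη hεε hy, sum_christoffel_mul hx hξη hy, e',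
    sum_harmonicity hx hy, sum_harmonicity hx hy, absorb, Matrix.of_apply]
  ring

/-! ### Properties of the interaction -/

/-- Contracting `absorb` with an arbitrary covector gives its divergence, and also the equations
from which its kernel is computed. -/
theorem apply_absorb (ξ η ε : Fin 4 → ℂ) (x : Matrix (Fin 4) (Fin 4) ℂ) (p : Fin 4 → ℂ)
    (j : Fin 4) : apply (absorb ξ η ε x) p j = dot ε ξ ^ 2 * apply x p j
        + dot ε ξ * (η j * dot p (apply x ε) + dot p η * apply x ε j)
        - dot ε ξ * (ε j * dot p (apply x η) + dot p ε * apply x η j)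
        + dot ε (apply x η) * (ξ j * dot p ε + dot p ξ * ε j)
        + dot η (apply x η) * (ε j * dot p ε)
        - 1 / 2 * dot ε (apply x ε) * (η j * dot p ξ + dot p η * ξ j) := by
  -- The scalar and vector contractions of `x` are replaced by free variables, so that the identity
  -- becomes a small polynomial one.
  have key : ∀ A B C D : ℂ, ∀ e h : Fin 4 → ℂ, ∑ k, sign k * (A ^ 2 * x j k
      + A * (η j * e k + η k * e j) - A * (ε j * h k + ε k * h j)
      + B * (ξ j * ε k + ξ k * ε j) + C * (ε j * ε k)
      - 1 / 2 * D * (η j * ξ k + η k * ξ j)) * p k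
      = A ^ 2 * apply x p j + A * (η j * dot p e + dot p η * e j)
        - A * (ε j * dot p h + dot p ε * h j) + B * (ξ j * dot p ε + dot p ξ * ε j)
        + C * (ε j * dot p ε) - 1 / 2 * D * (η j * dot p ξ + dot p η * ξ j) := by
    intro A B C D e h
    simp only [apply, dot, Fin.sum_univ_four]
    ring
  exact key _ _ _ _ _ _

theorem dot_comm (p q : Fin 4 → ℂ) : dot p q = dot q p :=
  Finset.sum_congr rfl fun i _ => by ring

theorem dot_apply_comm (hx : ∀ i j, x i j = x j i) (p q : Fin 4 → ℂ) :
    dot p (apply x q) = dot q (apply x p) := by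
  simp only [dot, apply, Fin.sum_univ_four]
  rw [hx 1 0, hx 2 0, hx 3 0, hx 2 1, hx 3 1, hx 3 2]
  ring

/-- The source is again harmonic at the total momentum, so it can serve as input of the next
meeting. -/
theorem isHarmonic_absorb (hx : IsHarmonic ξ x) (hξξ : dot ξ ξ = 0) (hηη : dot η η = 0)
    (hξη : dot ξ η = 0) (hεε : dot ε ε = 0) (hεη : dot ε η = 0) :
    IsHarmonic (ξ + η) (absorb ξ η ε x) := by
  have h1 : dot η (apply x ε) = dot ε (apply x η) := dot_apply_comm hx.1 _ _
  have h2 : ∀ p : Fin 4 → ℂ, dot ξ (apply x p) = 1 / 2 * mtrace x * dot ξ p := by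
    intro p
    rw [dot_apply_comm hx.1]
    simp only [hx.2, dot, Finset.mul_sum]
    exact Finset.sum_congr rfl fun j _ => by ring
  refine ⟨fun i j => ?_, fun j => ?_⟩
  · simp only [absorb, Matrix.of_apply, hx.1 i j]
    ring
  · have ht : mtrace (absorb ξ η ε x) = dot ε ξ ^ 2 * mtrace x
        + 2 * dot ε ξ * dot η (apply x ε) - 2 * dot ε ξ * dot ε (apply x η)
        + 2 * dot ε (apply x η) * dot ε ξ + dot η (apply x η) * dot ε ε
        - dot ε (apply x ε) * dot ξ η := by
      have key : ∀ A B C D : ℂ, ∀ e h : Fin 4 → ℂ, ∑ i, sign i * (A ^ 2 * x i i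
          + A * (η i * e i + η i * e i) - A * (ε i * h i + ε i * h i)
          + B * (ξ i * ε i + ξ i * ε i) + C * (ε i * ε i)
          - 1 / 2 * D * (η i * ξ i + η i * ξ i))
          = A ^ 2 * mtrace x + 2 * A * dot η e - 2 * A * dot ε h + 2 * B * dot ε ξ + C * dot ε ε
            - D * dot ξ η := by
        intro A B C D e h
        simp only [mtrace, dot, Fin.sum_univ_four]
        ring
      exact key _ _ _ _ _ _
    have h3 := fun p => apply_absorb ξ η ε x p j
    have h4 : apply (absorb ξ η ε x) (ξ + η) j
        = apply (absorb ξ η ε x) ξ j + apply (absorb ξ η ε x) η j := by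
      simp only [apply, Pi.add_apply, mul_add, Finset.sum_add_distrib]
    rw [h4, h3, h3, ht, hx.2, h2, h2, h1, dot_comm η ξ, dot_comm η ε, dot_comm ξ ε, hξξ, hηη, hξη, hεε, hεη,
      Pi.add_apply]
    ring

/-- The interaction does not lose information. -/
theorem eq_zero_of_absorb_eq_zero (hx : ∀ i j, x i j = x j i) (hηη : dot η η = 0)
    (hξη : dot ξ η = 0) (hεε : dot ε ε = 0) (hεη : dot ε η = 0) (hεξ : dot ε ξ ≠ 0)
    (h : absorb ξ η ε x = 0) : x = 0 := by
  have h0 : ∀ p j, apply (absorb ξ η ε x) p j = 0 := fun p j => by simp [h, apply]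
  have hα : dot ε ξ ^ 2 ≠ 0 := pow_ne_zero 2 hεξ
  have hηε : dot η ε = 0 := by rw [dot_comm, hεη]
  have hηξ : dot η ξ = 0 := by rw [dot_comm, hξη]
  have hγ' : dot η (apply x ε) = dot ε (apply x η) := dot_apply_comm hx _ _
  -- Contracting the equation with ε and with η shows that x ε and x η lie in the span of ε and η.
  -- This plane is totally isotropic, so the scalars ε·xε, ε·xη and η·xη vanish, then x ε and x η
  -- themselves, and finally (ε·ξ)² x = 0.
  have hε : ∀ j, dot ε ξ ^ 2 * apply x ε j + dot ε ξ * η j * dot ε (apply x ε)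
      - dot ε ξ * ε j * dot ε (apply x η) + dot ε (apply x η) * dot ε ξ * ε j
      - 1 / 2 * dot ε (apply x ε) * η j * dot ε ξ = 0 := fun j => by
    have := h0 ε j
    rw [apply_absorb, hεη, hεε] at this
    linear_combination this
  have hη : ∀ j, dot ε ξ ^ 2 * apply x η j + dot ε ξ * η j * dot ε (apply x η)
      - dot ε ξ * ε j * dot η (apply x η) = 0 := fun j => by
    have := h0 η j
    rw [apply_absorb, hηε, hηξ, hηη, hγ'] at this
    linear_combination this
  have key : ∀ (p e : Fin 4 → ℂ) (c d : ℂ), dot p η = 0 → dot p ε = 0 →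
      (∀ j, dot ε ξ ^ 2 * e j + c * η j + d * ε j = 0) → dot p e = 0 := by
    intro p e c d h1 h2 h3
    refine (mul_eq_zero.mp (?_ : dot ε ξ ^ 2 * dot p e = 0)).resolve_left hα
    have h4 : dot ε ξ ^ 2 * dot p e = ∑ j, sign j * p j * (dot ε ξ ^ 2 * e j + c * η j + d * ε j)
        - c * dot p η - d * dot p ε := by
      simp only [dot.eq_1 p, Finset.mul_sum, ← Finset.sum_sub_distrib]
      exact Finset.sum_congr rfl fun j _ => by ring
    rw [h4, h1, h2]
    simp [h3]
  have hβ : dot ε (apply x ε) = 0 := key ε (apply x ε) (1 / 2 * dot ε ξ * dot ε (apply x ε)) 0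
    hεη hεε fun j => by linear_combination hε j
  have hγ : dot ε (apply x η) = 0 := key ε (apply x η) (dot ε ξ * dot ε (apply x η))
    (-(dot ε ξ * dot η (apply x η))) hεη hεε fun j => by linear_combination hη j
  have hκ : dot η (apply x η) = 0 := key η (apply x η) (dot ε ξ * dot ε (apply x η))
    (-(dot ε ξ * dot η (apply x η))) hηη hηε fun j => by linear_combination hη j
  have he : ∀ j, apply x ε j = 0 := fun j => by
    have := hε j
    rw [hβ, hγ] at this
    exact (mul_eq_zero.mp (by linear_combination this)).resolve_left hα
  have hh : ∀ j, apply x η j = 0 := fun j => by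
    have := hη j
    rw [hκ, hγ] at this
    exact (mul_eq_zero.mp (by linear_combination this)).resolve_left hα
  ext j k
  have := congrFun (congrFun h j) k
  simp only [absorb, Matrix.of_apply, he, hh, hβ, hγ, hκ, Matrix.zero_apply] at this
  exact (mul_eq_zero.mp (by linear_combination this)).resolve_left hα

end Absorb

end

end FourWave

namespace FourWave

noncomputable section

open Filter Topology

/-! ### The amplitude without its poles -/

section Regularized

variable {ζ : Fin 4 → Fin 4 → ℂ} {x : Fin 4 → Matrix (Fin 4) (Fin 4) ℂ}

/-- The polarizations `x`, with the first one multiplied by the inverse propagator of the product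
of the first two waves. -/
def regWave (ζ : Fin 4 → Fin 4 → ℂ) (x : Fin 4 → Matrix (Fin 4) (Fin 4) ℂ) (j : Fin 4) :
    Matrix (Fin 4) (Fin 4) ℂ :=
  (if j = 0 then 2 * dot (ζ 0) (ζ 1) else 1) • x j

/-- The waves produced by two-wave interactions of the waves with polarizations `regWave`. -/
def regPair (ζ : Fin 4 → Fin 4 → ℂ) (x : Fin 4 → Matrix (Fin 4) (Fin 4) ℂ) (i j : Fin 4) :
    Matrix (Fin 4) (Fin 4) ℂ :=
  if i < j then
    (if i = 0 then if j = 1 then 1 else dot (ζ 0) (ζ 1) / dot (ζ i) (ζ j)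
      else 1 / (2 * dot (ζ i) (ζ j))) • momSource ζ {i, j} (linField x)
  else 0

/-- The amplitude of the waves with polarizations `regWave`, multiplied by the inverse propagator
of the fourth wave and the test wave. -/
def regAmp (ζ : Fin 4 → Fin 4 → ℂ) (x : Fin 4 → Matrix (Fin 4) (Fin 4) ℂ) (w : Tensor) : ℂ :=
  contractMom w (tripleTerm ζ (regWave ζ x) (regPair ζ x) 3)
    - 2 * dot (ζ 3) (∑ l, ζ l) * contractMom w (quarticTerm ζ (regWave ζ x) (regPair ζ x))
    + ∑ j : Fin 3, dot (ζ 3) (∑ l, ζ l) / dot (ζ j.castSucc) (∑ l, ζ l) *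
      contractMom w (tripleTerm ζ (regWave ζ x) (regPair ζ x) j.castSucc)

theorem quadField_congr {P P' : Fin 4 → Fin 4 → Matrix (Fin 4) (Fin 4) ℂ}
    (h : ∀ i j, i < j → P i j = P' i j) : quadField x P = quadField x P' := by
  rw [quadField, quadField]
  congr 1
  refine Finset.sum_congr rfl fun i _ => Finset.sum_congr rfl fun j hj => ?_
  rw [h i j (Finset.mem_Ioi.mp hj)]

/-- The factor 2 ζ₀·ζ₁ on wave 0 appears once in each pair containing that wave. It cancels the
propagator of the pair (0, 1), which is thus the only such pair surviving when ζ₀·ζ₁ tends to zero.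
-/
theorem pairTensor_regWave (hζ : ∀ i j, i < j → dot (ζ i) (ζ j) ≠ 0) (i j : Fin 4) (hij : i < j) :
    pairTensor ζ (fun i j => (2 * dot (ζ i) (ζ j))⁻¹) (regWave ζ x) i j = regPair ζ x i j := by
  have h1 : ∀ k l, momSource ζ {i, j} (linField (regWave ζ x)) k l
      = (if 0 ∈ ({i, j} : Finset (Fin 4)) then 2 * dot (ζ 0) (ζ 1) else 1)
        * momSource ζ {i, j} (linField x) k l := by
    refine momSource_scale ζ _ (linField x) _ (coeff_empty_linField x) (fun k l S => ?_) _
    rw [coeff_linField, coeff_linField, Finset.mul_sum]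
    refine Finset.sum_congr rfl fun m _ => ?_
    by_cases h : S = {m}
    · subst h
      simp [regWave, eq_comm (a := (0 : Fin 4))]
    · simp [h]
  have hd := hζ i j hij
  ext k l
  rw [pairTensor, regPair, if_pos hij, Matrix.smul_apply, Matrix.smul_apply, h1, smul_eq_mul,
    smul_eq_mul]
  by_cases hi : i = 0
  · subst hi
    by_cases hj : j = 1
    · subst hj
      simp only [if_true, Finset.mem_insert, true_or]
      field_simp
    · simp only [if_true, Finset.mem_insert, true_or, if_neg hj]
      field_simp
  · have h0 : (0 : Fin 4) ∉ ({i, j} : Finset (Fin 4)) := by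
      simp only [Finset.mem_insert, Finset.mem_singleton, not_or]
      exact ⟨Ne.symm hi, fun h => absurd (h ▸ hij) (by simp)⟩
    rw [if_neg h0, if_neg hi]
    field_simp

/-- Away from the poles, `regAmp` is the actual amplitude with a rescaled first wave, times a
non-zero factor. The two therefore vanish together. -/
theorem regAmp_eq (hζ : ∀ i j, i < j → dot (ζ i) (ζ j) ≠ 0)
    (hβ : ∀ j, dot (ζ j) (∑ l, ζ l) ≠ 0) (w : Tensor) :
    regAmp ζ x w = 2 * dot (ζ 3) (∑ l, ζ l) * indicatorAmp ζ (fun i j => (2 * dot (ζ i) (ζ j))⁻¹)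
      (fun j => (2 * dot (ζ j) (∑ l, ζ l))⁻¹) (regWave ζ x) w := by
  have hq : quadField (regWave ζ x) (pairTensor ζ (fun i j => (2 * dot (ζ i) (ζ j))⁻¹) (regWave ζ x))
      = quadField (regWave ζ x) (regPair ζ x) := quadField_congr (pairTensor_regWave hζ)
  rw [regAmp, indicatorAmp, quarticTerm, quarticTerm]
  simp only [tripleTerm, hq]
  generalize ∑ l, ζ l = β at hβ ⊢
  rw [Fin.sum_univ_castSucc (n := 3), mul_add, mul_add, Finset.mul_sum]
  have h3 : (2 * dot (ζ 3) β) * ((2 * dot (ζ (Fin.last 3)) β)⁻¹ *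
      contractMom w (momSource ζ Finset.univ (epsTensor {Fin.last 3} (regWave ζ x (Fin.last 3))
        + epsTensor {Fin.last 3}ᶜ (momSource ζ {Fin.last 3}ᶜ (quadField (regWave ζ x) (regPair ζ x))))))
      = contractMom w (momSource ζ Finset.univ (epsTensor {3} (regWave ζ x 3)
        + epsTensor {3}ᶜ (momSource ζ {3}ᶜ (quadField (regWave ζ x) (regPair ζ x))))) := by
    rw [← mul_assoc]
    have : (2 * dot (ζ 3) β) * (2 * dot (ζ (Fin.last 3)) β)⁻¹ = 1 :=
      mul_inv_cancel₀ (mul_ne_zero two_ne_zero (hβ 3))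
    rw [this, one_mul]
    rfl
  rw [h3]
  have h4 : ∀ j : Fin 3, ∀ c : ℂ, 2 * dot (ζ 3) β *
      ((2 * dot (ζ j.castSucc) β)⁻¹ * c)
      = dot (ζ 3) β / dot (ζ j.castSucc) β * c := by
    intro j c
    have := hβ j.castSucc
    field_simp
  simp only [h4]
  ring

theorem contractMom_tendsto {X : Type} {F : Filter X} {f : X → Matrix (Fin 4) (Fin 4) ℂ}
    {m : Matrix (Fin 4) (Fin 4) ℂ} (w : Tensor)
    (h : ∀ i j, Tendsto (fun t => f t i j) F (𝓝 (m i j))) :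
    Tendsto (fun t => contractMom w (f t)) F (𝓝 (contractMom w m)) :=
  tendsto_finsetSum _ fun i _ => tendsto_finsetSum _ fun j _ => (h i j).const_smul _

theorem dot_tendsto {X : Type} {F : Filter X} {p q : X → Fin 4 → ℂ} {p₀ q₀ : Fin 4 → ℂ}
    (hp : ∀ k, Tendsto (fun t => p t k) F (𝓝 (p₀ k)))
    (hq : ∀ k, Tendsto (fun t => q t k) F (𝓝 (q₀ k))) :
    Tendsto (fun t => dot (p t) (q t)) F (𝓝 (dot p₀ q₀)) :=
  tendsto_finsetSum _ fun i _ => ((hp i).const_mul _).mul (hq i)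

/-- The denominators left in `regAmp` are those listed in `hd` and `hβ`; the pair (0, 1) and wave 3
with the test wave are not among them. -/
theorem regAmp_tendsto {X : Type} {F : Filter X} {ζ' : X → Fin 4 → Fin 4 → ℂ}
    {x' : X → Fin 4 → Matrix (Fin 4) (Fin 4) ℂ}
    (hζ : ∀ j k, Tendsto (fun t => ζ' t j k) F (𝓝 (ζ j k)))
    (hx : ∀ j i l, Tendsto (fun t => x' t j i l) F (𝓝 (x j i l)))
    (hd : ∀ i j, i < j → (i, j) ≠ (0, 1) → dot (ζ i) (ζ j) ≠ 0)
    (hβ : ∀ j : Fin 3, dot (ζ j.castSucc) (∑ l, ζ l) ≠ 0) (w : Tensor) :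
    Tendsto (fun t => regAmp (ζ' t) (x' t) w) F (𝓝 (regAmp ζ x w)) := by
  have hdot : ∀ i j, Tendsto (fun t => dot (ζ' t i) (ζ' t j)) F (𝓝 (dot (ζ i) (ζ j))) :=
    fun i j => dot_tendsto (hζ i) (hζ j)
  have hsum : ∀ j, Tendsto (fun t => dot (ζ' t j) (∑ l, ζ' t l)) F (𝓝 (dot (ζ j) (∑ l, ζ l))) :=
    fun j => dot_tendsto (hζ j) fun k => by
      simp only [Finset.sum_apply]
      exact tendsto_finsetSum _ fun l _ => hζ l k
  have hW : ∀ j i l, Tendsto (fun t => regWave (ζ' t) (x' t) j i l) F (𝓝 (regWave ζ x j i l)) := by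
    intro j i l
    simp only [regWave, Matrix.smul_apply, smul_eq_mul]
    refine Tendsto.mul ?_ (hx j i l)
    split_ifs
    · exact (hdot 0 1).const_mul 2
    · exact tendsto_const_nhds
  have hP : ∀ j k i l, Tendsto (fun t => regPair (ζ' t) (x' t) j k i l) F
      (𝓝 (regPair ζ x j k i l)) := by
    intro j k i l
    simp only [regPair]
    by_cases hjk : j < k
    · simp only [if_pos hjk, Matrix.smul_apply, smul_eq_mul]
      refine Tendsto.mul ?_ ((isNatural_pair {j, k} i l).tendsto (P := fun _ _ _ => 0)
        (P₀ := fun _ _ => 0) hζ hx fun _ _ _ _ => tendsto_const_nhds)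
      by_cases h1 : j = 0
      · by_cases h2 : k = 1
        · simp only [if_pos h1, if_pos h2]
          exact tendsto_const_nhds
        · simp only [if_pos h1, if_neg h2]
          exact (hdot 0 1).div (hdot j k) (hd j k hjk fun h => h2 (Prod.ext_iff.mp h).2)
      · simp only [if_neg h1]
        exact tendsto_const_nhds.div ((hdot j k).const_mul 2)
          (mul_ne_zero two_ne_zero (hd j k hjk fun h => h1 (Prod.ext_iff.mp h).1))
    · simp only [if_neg hjk]
      exact tendsto_const_nhds
  have hT : ∀ j, Tendsto (fun t => contractMom w
      (tripleTerm (ζ' t) (regWave (ζ' t) (x' t)) (regPair (ζ' t) (x' t)) j)) F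
      (𝓝 (contractMom w (tripleTerm ζ (regWave ζ x) (regPair ζ x) j))) := fun j =>
    contractMom_tendsto w fun i l => (isNatural_triple j i l).tendsto hζ hW hP
  refine ((hT 3).sub (((hsum 3).const_mul 2).mul (contractMom_tendsto w fun i l =>
    (isNatural_quad Finset.univ i l).tendsto hζ hW hP))).add ?_
  exact tendsto_finsetSum _ fun j _ => ((hsum 3).div (hsum _) (hβ j)).mul (hT _)

theorem meromorphicAt_dot {p q : ℂ → Fin 4 → ℂ} (hp : ∀ k t, MeromorphicAt (fun t => p t k) t)
    (hq : ∀ k t, MeromorphicAt (fun t => q t k) t) (t : ℂ) :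
    MeromorphicAt (fun t => dot (p t) (q t)) t := by
  simp only [dot, Fin.sum_univ_four]
  have h : ∀ i, MeromorphicAt (fun t => sign i * p t i * q t i) t := fun i =>
    ((MeromorphicAt.const _ _).mul (hp i t)).mul (hq i t)
  exact (((h 0).add (h 1)).add (h 2)).add (h 3)

theorem meromorphicAt_contractMom {f : ℂ → Matrix (Fin 4) (Fin 4) ℂ} {t : ℂ} (w : Tensor)
    (hf : ∀ i j, MeromorphicAt (fun t => f t i j) t) :
    MeromorphicAt (fun t => contractMom w (f t)) t := by
  have h : ∀ i j, MeromorphicAt (fun t => (minkowski * w * minkowski) i j • f t i j) t :=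
    fun i j => by
      simp only [Complex.real_smul]
      exact (MeromorphicAt.const _ _).mul (hf i j)
  simp only [contractMom, Fin.sum_univ_four]
  have h' := fun i => (((h i 0).add (h i 1)).add (h i 2)).add (h i 3)
  exact (((h' 0).add (h' 1)).add (h' 2)).add (h' 3)

theorem regAmp_meromorphic {ζ' : ℂ → Fin 4 → Fin 4 → ℂ}
    {x' : ℂ → Fin 4 → Matrix (Fin 4) (Fin 4) ℂ}
    (hζ : ∀ j k t, MeromorphicAt (fun t => ζ' t j k) t)
    (hx : ∀ j i l t, MeromorphicAt (fun t => x' t j i l) t) (w : Tensor) (t : ℂ) :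
    MeromorphicAt (fun t => regAmp (ζ' t) (x' t) w) t := by
  have hdot : ∀ i j t, MeromorphicAt (fun t => dot (ζ' t i) (ζ' t j)) t :=
    fun i j => meromorphicAt_dot (hζ i) (hζ j)
  have hsum : ∀ j t, MeromorphicAt (fun t => dot (ζ' t j) (∑ l, ζ' t l)) t :=
    fun j => meromorphicAt_dot (hζ j) fun k t => by
      simp only [Finset.sum_apply, Fin.sum_univ_four]
      exact (((hζ 0 k t).add (hζ 1 k t)).add (hζ 2 k t)).add (hζ 3 k t)
  have hW : ∀ j i l t, MeromorphicAt (fun t => regWave (ζ' t) (x' t) j i l) t := by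
    intro j i l t
    simp only [regWave, Matrix.smul_apply, smul_eq_mul]
    refine MeromorphicAt.mul ?_ (hx j i l t)
    split_ifs
    · exact (MeromorphicAt.const _ _).mul (hdot 0 1 t)
    · exact MeromorphicAt.const _ _
  have hP : ∀ j k i l t, MeromorphicAt (fun t => regPair (ζ' t) (x' t) j k i l) t := by
    intro j k i l t
    simp only [regPair]
    by_cases hjk : j < k
    · simp only [if_pos hjk, Matrix.smul_apply, smul_eq_mul]
      refine MeromorphicAt.mul ?_ ((isNatural_pair {j, k} i l).meromorphic (P := fun _ _ _ => 0)
        hζ hx (fun _ _ _ _ _ => MeromorphicAt.const _ _) t)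
      split_ifs
      · exact MeromorphicAt.const _ _
      · exact (hdot 0 1 t).div (hdot j k t)
      · exact (MeromorphicAt.const _ _).div ((MeromorphicAt.const _ _).mul (hdot j k t))
    · simp only [if_neg hjk]
      exact MeromorphicAt.const _ _
  have hT : ∀ j, MeromorphicAt (fun t => contractMom w
      (tripleTerm (ζ' t) (regWave (ζ' t) (x' t)) (regPair (ζ' t) (x' t)) j)) t := fun j =>
    meromorphicAt_contractMom w fun i l => (isNatural_triple j i l).meromorphic hζ hW hP t
  refine ((hT 3).sub (((MeromorphicAt.const _ _).mul (hsum 3 t)).mul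
    (meromorphicAt_contractMom w fun i l =>
      (isNatural_quad Finset.univ i l).meromorphic hζ hW hP t))).add ?_
  simp only [Fin.sum_univ_three]
  have h := fun j : Fin 3 => ((hsum 3 t).div (hsum j.castSucc t)).mul (hT j.castSucc)
  exact ((h 0).add (h 1)).add (h 2)

theorem linField_mem_blockSubmodule {t : Fin 4} :
    ∀ i j, linField x i j ∈ blockSubmodule ℂ 0 t {0} := by
  intro i j
  rw [mem_blockSubmodule]
  intro U _ h1 h2
  exact absurd (Finset.singleton_subset_iff.mpr h1) h2

/-- The value of the amplitude at configurations where the product of the first two waves and the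
product of the fourth wave with the test wave both are singular. -/
theorem regAmp_eq_absorb {ε₁ ε₂ ε₃ : Fin 4 → ℂ} (hx1 : ∀ i j, x 1 i j = ε₁ i * ε₁ j)
    (hx2 : ∀ i j, x 2 i j = ε₂ i * ε₂ j) (hx3 : ∀ i j, x 3 i j = ε₃ i * ε₃ j)
    (hx0 : IsHarmonic (ζ 0) (x 0)) (hζ : ∀ j, dot (ζ j) (ζ j) = 0) (h01 : dot (ζ 0) (ζ 1) = 0)
    (h012 : dot (ζ 0 + ζ 1) (ζ 2) = 0) (h0123 : dot (ζ 0 + ζ 1 + ζ 2) (ζ 3) = 0)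
    (h1 : dot ε₁ ε₁ = 0) (h1' : dot ε₁ (ζ 1) = 0) (h2 : dot ε₂ ε₂ = 0) (h2' : dot ε₂ (ζ 2) = 0)
    (h3 : dot ε₃ ε₃ = 0) (h3' : dot ε₃ (ζ 3) = 0) (w : Tensor) :
    regAmp ζ x w = contractMom w (absorb (ζ 0 + ζ 1 + ζ 2) (ζ 3) ε₃
      (absorb (ζ 0 + ζ 1) (ζ 2) ε₂ (absorb (ζ 0) (ζ 1) ε₁ (x 0)))) := by
  have hadd : ∀ p q r : Fin 4 → ℂ, dot (p + q) r = dot p r + dot q r := fun p q r => by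
    simp only [dot, Pi.add_apply, mul_add, add_mul, Finset.sum_add_distrib]
  -- This zero removes the quartic term and all triple terms except the one where wave 3 comes last.
  have hsum : dot (ζ 3) (∑ l, ζ l) = 0 := by
    rw [Fin.sum_univ_four, dot_comm, hadd, h0123, hζ, add_zero]
  -- Wave 0 survives only through its product with wave 1, which is the block structure required at
  -- the next meeting.
  have hW0 : regWave ζ x 0 = 0 := by simp [regWave, h01]
  have hW : ∀ j, j ≠ 0 → regWave ζ x j = x j := fun j hj => by simp [regWave, hj]
  have hP1 : regPair ζ x 0 1 = absorb (ζ 0) (ζ 1) ε₁ (x 0) := by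
    have := momSource_insert_eq_absorb (a := 0) (t := 1) (S := {0}) (ζ := ζ) (u := linField x)
      (x := x 0) (ε := ε₁) (ξ := ζ 0) (η := ζ 1) (by simp) (by decide) linField_mem_blockSubmodule
      (coeff_empty_linField x) (fun k => by simp [totalMom]) (fun _ => rfl)
      (fun i j => by simp [coeff_linField]) (fun i j => by simp [coeff_linField, hx1])
      (fun i j => by
        rw [coeff_linField]
        refine Finset.sum_eq_zero fun l _ => if_neg ?_
        revert l
        decide) hx0 h01 h1 h1'
    rw [regPair, if_pos (by decide), if_pos rfl, if_pos rfl, one_smul, ← this, Finset.pair_comm]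
  have hP2 : ∀ j, j ≠ 1 → regPair ζ x 0 j = 0 := fun j hj => by simp [regPair, hj, h01]
  have hH1 := isHarmonic_absorb hx0 (hζ 0) (hζ 1) h01 h1 h1'
  have h00 : dot (ζ 0 + ζ 1) (ζ 0 + ζ 1) = 0 := by
    rw [hadd, dot_comm (ζ 0), dot_comm (ζ 1), hadd, hadd, hζ, hζ, h01, dot_comm, h01]
    ring
  have hH2 := isHarmonic_absorb hH1 h00 (hζ 2) h012 h2 h2'
  have hT : momSource ζ {3}ᶜ (quadField (regWave ζ x) (regPair ζ x))
      = absorb (ζ 0 + ζ 1) (ζ 2) ε₂ (absorb (ζ 0) (ζ 1) ε₁ (x 0)) := by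
    have hS : ({3}ᶜ : Finset (Fin 4)) = insert 2 {0, 1} := by decide
    rw [hS]
    refine momSource_insert_eq_absorb (a := 0) (by simp) (by decide) ?_
      (coeff_empty_quadField _ _) (fun k => ?_) (fun _ => rfl) (fun i j => ?_) (fun i j => ?_)
      (fun i j => ?_) hH1 h012 h2 h2'
    · intro i j
      rw [mem_blockSubmodule]
      intro U hU h0 hU'
      rw [coeff_quadField, Finset.sum_eq_zero, Finset.sum_eq_zero, add_zero]
      · intro l _
        refine Finset.sum_eq_zero fun m hm => ?_
        rw [Finset.mem_Ioi] at hm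
        split_ifs with h
        · have hl : l = 0 := by
            subst h
            rcases Finset.mem_insert.mp h0 with h | h
            · exact h.symm
            · rw [Finset.mem_singleton] at h
              subst h
              exact absurd hm (by simp)
          subst hl
          rw [hP2]
          · rfl
          · rintro rfl
            exact hU' h.ge
        · rfl
      · intro l _
        split_ifs with h
        · have hl : l = 0 := by
            subst h
            rw [Finset.mem_singleton] at h0
            exact h0.symm
          rw [hl, hW0]
          rfl
        · rfl
    · simp [totalMom]
    · rw [coeff_quadField, Finset.sum_eq_zero, zero_add, Finset.sum_eq_single 0,
        Finset.sum_eq_single 1, if_pos rfl, hP1]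
      · intro l hl hl'
        refine if_neg fun h => ?_
        revert l
        decide
      · intro h
        exact absurd h (by decide)
      · intro l _ hl
        refine Finset.sum_eq_zero fun m hm => if_neg ?_
        revert l m
        decide
      · simp
      · intro l _
        refine if_neg ?_
        revert l
        decide
    · rw [coeff_quadField, Finset.sum_eq_single 2, if_pos rfl, hW 2 (by decide), hx2,
        Finset.sum_eq_zero, add_zero]
      · intro l _
        refine Finset.sum_eq_zero fun m hm => if_neg ?_
        revert l m
        decide
      · intro l _ hl
        refine if_neg ?_
        revert l
        decide
      · simp
    · rw [coeff_quadField, Finset.sum_eq_zero, Finset.sum_eq_zero, add_zero]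
      · intro l _
        refine Finset.sum_eq_zero fun m hm => if_neg ?_
        revert l m
        decide
      · intro l _
        refine if_neg ?_
        revert l
        decide
  have hF : tripleTerm ζ (regWave ζ x) (regPair ζ x) 3 = absorb (ζ 0 + ζ 1 + ζ 2) (ζ 3) ε₃
      (absorb (ζ 0 + ζ 1) (ζ 2) ε₂ (absorb (ζ 0) (ζ 1) ε₁ (x 0))) := by
    rw [tripleTerm, hT]
    have hS : (Finset.univ : Finset (Fin 4)) = insert 3 {3}ᶜ := by decide
    rw [hS]
    have hne : ({3}ᶜ : Finset (Fin 4)) ≠ {3} := by decide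
    have hne' : insert 3 ({3}ᶜ : Finset (Fin 4)) ≠ {3} := by decide
    have hne2 : insert 3 ({3}ᶜ : Finset (Fin 4)) ≠ {3}ᶜ := by decide
    refine momSource_insert_eq_absorb (a := 0) (by decide) (by decide) ?_ (fun i j => ?_)
      (fun k => ?_) (fun _ => rfl) (fun i j => ?_) (fun i j => ?_) (fun i j => ?_) hH2 h0123 h3 h3'
    · intro i j
      rw [mem_blockSubmodule]
      intro U hU h0 hU'
      rw [Matrix.add_apply, map_add, coeff_epsTensor, coeff_epsTensor, if_neg, if_neg, add_zero]
      · rintro rfl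
        exact hU' subset_rfl
      · rintro rfl
        exact absurd h0 (by decide)
    · rw [Matrix.add_apply, map_add, coeff_empty_epsTensor (by decide),
        coeff_empty_epsTensor (by decide), add_zero]
    · have hS' : ({3}ᶜ : Finset (Fin 4)) = {0, 1, 2} := by decide
      simp [totalMom, hS', add_assoc]
    · rw [Matrix.add_apply, map_add, coeff_epsTensor, coeff_epsTensor, if_neg hne, if_pos rfl,
        zero_add]
    · rw [Matrix.add_apply, map_add, coeff_epsTensor, coeff_epsTensor, if_pos rfl,
        if_neg hne.symm, add_zero, hW 3 (by decide), hx3]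
    · rw [Matrix.add_apply, map_add, coeff_epsTensor, coeff_epsTensor, if_neg hne', if_neg hne2,
        add_zero]
  rw [regAmp, hF, hsum]
  simp

end Regularized

end

end FourWave

namespace FourWave

noncomputable section

/-! ### Minors -/

section Minor

/-- Conjugation by ĝ undoes the raising of indices in `contractMom`, so every entry of a symmetric
tensor is detected by a real symmetric test tensor. -/
theorem contractMom_symm_single (F : Matrix (Fin 4) (Fin 4) ℂ) (hF : ∀ i j, F i j = F j i)
    (i j : Fin 4) :
    contractMom (minkowski * ((1 / 2 : ℝ) • (Matrix.single i j 1 + Matrix.single j i 1)) * minkowski) F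
      = F i j := by
  have hmm : minkowski * minkowski = 1 := by
    ext i j
    fin_cases i <;> fin_cases j <;> simp [minkowski]
  have h : ∀ A : Tensor, minkowski * (minkowski * A * minkowski) * minkowski = A := by
    intro A
    rw [Matrix.mul_assoc, Matrix.mul_assoc, hmm, Matrix.mul_one, ← Matrix.mul_assoc, hmm,
      Matrix.one_mul]
  have h1 : ∀ i j, ∑ k, ∑ l, (Matrix.single i j (1 : ℝ) k l) • F k l = F i j := by
    intro i j
    rw [Finset.sum_eq_single i, Finset.sum_eq_single j]
    · simp
    · intro l _ hl
      simp [hl.symm]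
    · simp
    · intro k _ hk
      refine Finset.sum_eq_zero fun l _ => ?_
      simp [hk.symm]
    · simp
  rw [contractMom, h]
  simp only [Matrix.smul_apply, Matrix.add_apply, smul_assoc, add_smul]
  simp only [← Finset.smul_sum, Finset.sum_add_distrib, h1, ← hF i j]
  rw [Complex.real_smul]
  push_cast
  ring

/-- Linearly independent symmetric tensors are separated by as many real symmetric tensors. -/
theorem exists_contractMom_det_ne_zero (M : Fin 6 → Matrix (Fin 4) (Fin 4) ℂ)
    (hM : ∀ q i j, M q i j = M q j i) (hind : LinearIndependent ℂ M) :
    ∃ W : Fin 6 → Tensor, (∀ r, (W r).IsSymm) ∧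
      (Matrix.of fun q r => contractMom (W r) (M q)).det ≠ 0 := by
  let A : Matrix (Fin 6) (Fin 4 × Fin 4) ℂ := Matrix.of fun q p => M q p.1 p.2
  have hrow : LinearIndependent ℂ A.row := by
    rw [Fintype.linearIndependent_iff] at hind ⊢
    intro g hg
    refine hind g ?_
    ext i j
    have := congrFun hg (i, j)
    simpa [A, Matrix.sum_apply] using this
  have hrank := hrow.rank_matrix
  rw [Matrix.rank_eq_finrank_span_cols, Fintype.card_fin] at hrank
  -- Flattened to rows, the six tensors have rank six. Six independent columns, that is, six entries
  -- of the tensors, give a non-vanishing minor.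
  obtain ⟨f, hf, -, hfind⟩ := Submodule.exists_fun_fin_finrank_span_eq ℂ (Set.range A.col)
  have hcast : 6 = Module.finrank ℂ (Submodule.span ℂ (Set.range A.col)) := hrank.symm
  choose p hp using hf
  let q : Fin 6 → Fin 4 × Fin 4 := fun r => p (Fin.cast hcast r)
  refine ⟨fun r => minkowski * ((1 / 2 : ℝ) •
    (Matrix.single (q r).1 (q r).2 1 + Matrix.single (q r).2 (q r).1 1)) * minkowski, fun r => ?_, ?_⟩
  · have h1 : minkowski.transpose = minkowski := Matrix.diagonal_transpose _
    rw [Matrix.IsSymm, Matrix.transpose_mul, Matrix.transpose_mul, h1, Matrix.transpose_smul,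
      Matrix.transpose_add, Matrix.transpose_single, Matrix.transpose_single,
      ← Matrix.mul_assoc, add_comm (Matrix.single (q r).2 (q r).1 1)]
  · have h2 : (Matrix.of fun k r => contractMom (minkowski * ((1 / 2 : ℝ) •
        (Matrix.single (q r).1 (q r).2 1 + Matrix.single (q r).2 (q r).1 1)) * minkowski) (M k))
        = (Matrix.of fun r => f (Fin.cast hcast r)).transpose := by
      ext k r
      rw [Matrix.of_apply, contractMom_symm_single _ (hM k), Matrix.transpose_apply,
        Matrix.of_apply, ← hp]
      rfl
    rw [h2, Matrix.det_transpose]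
    have h3 : LinearIndependent ℂ fun r => f (Fin.cast hcast r) :=
      hfind.comp _ (Fin.cast_injective hcast)
    exact ((Matrix.isUnit_iff_isUnit_det _).mp (Matrix.linearIndependent_rows_iff_isUnit
      (A := Matrix.of fun r => f (Fin.cast hcast r)).mp h3)).ne_zero

end Minor

/-! ### Parametrization of harmonic tensors -/

section Harmonic

/-- Trace reversal. -/
def traceReverse (x : Matrix (Fin 4) (Fin 4) ℂ) : Matrix (Fin 4) (Fin 4) ℂ :=
  Matrix.of fun i j => x i j - 1 / 2 * mtrace x * if i = j then sign i else 0

/-- The harmonic tensor at `ξ` obtained from `W` by a projection along `ν`. -/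
def harmonicOf (ν ξ : Fin 4 → ℂ) (W : Matrix (Fin 4) (Fin 4) ℂ) : Matrix (Fin 4) (Fin 4) ℂ :=
  traceReverse (Matrix.of fun j k => dot ν ξ ^ 2 * W j k - dot ν ξ * (ν j * apply W ξ k)
    - dot ν ξ * (apply W ξ j * ν k) + ν j * ν k * dot ξ (apply W ξ))

variable {ν ξ : Fin 4 → ℂ} {x W : Matrix (Fin 4) (Fin 4) ℂ}

theorem mtrace_traceReverse (x : Matrix (Fin 4) (Fin 4) ℂ) :
    mtrace (traceReverse x) = -mtrace x := by
  have h := sign_mul_self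
  simp only [mtrace, traceReverse, Matrix.of_apply, Fin.sum_univ_four, if_true]
  linear_combination -(1 / 2) * (sign 0 * x 0 0 + sign 1 * x 1 1 + sign 2 * x 2 2 + sign 3 * x 3 3)
    * (h 0 + h 1 + h 2 + h 3)

theorem traceReverse_traceReverse (x : Matrix (Fin 4) (Fin 4) ℂ) :
    traceReverse (traceReverse x) = x := by
  ext i j
  rw [traceReverse, Matrix.of_apply, mtrace_traceReverse, traceReverse, Matrix.of_apply]
  ring

theorem apply_traceReverse (x : Matrix (Fin 4) (Fin 4) ℂ) (p : Fin 4 → ℂ) (j : Fin 4) :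
    apply (traceReverse x) p j = apply x p j - 1 / 2 * mtrace x * p j := by
  have h : ∑ l, sign l * (1 / 2 * mtrace x * if j = l then sign j else 0) * p l
      = 1 / 2 * mtrace x * p j := by
    rw [Finset.sum_eq_single j]
    · rw [if_pos rfl]
      linear_combination 1 / 2 * mtrace x * p j * sign_mul_self j
    · intro l _ hl
      rw [if_neg hl.symm]
      ring
    · simp
  rw [← h, apply, apply, ← Finset.sum_sub_distrib]
  refine Finset.sum_congr rfl fun l _ => ?_
  rw [traceReverse, Matrix.of_apply]
  ring

/-- Harmonicity at ξ says that the trace reversal annihilates ξ. The bracketed tensor is ν·ξ times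
the projection along ν applied in both slots, hence annihilates ξ, and trace reversal is an
involution. Keeping the factor (ν·ξ)² makes the expression polynomial in ξ. -/
theorem isHarmonic_harmonicOf (ν ξ : Fin 4 → ℂ) (hW : ∀ i j, W i j = W j i) :
    IsHarmonic ξ (harmonicOf ν ξ W) := by
  refine ⟨fun i j => ?_, fun j => ?_⟩
  · simp only [harmonicOf, traceReverse, Matrix.of_apply, hW i j]
    by_cases h : i = j
    · subst h
      ring
    · rw [if_neg h, if_neg (Ne.symm h)]
      ring
  · rw [harmonicOf, apply_traceReverse, mtrace_traceReverse]
    generalize mtrace _ = s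
    have key : ∀ N c : ℂ, ∀ e : Fin 4 → ℂ, ∑ k, sign k * (N ^ 2 * W j k - N * (ν j * e k)
        - N * (e j * ν k) + ν j * ν k * c) * ξ k
        = N ^ 2 * apply W ξ j - N * ν j * dot ξ e - N * e j * dot ν ξ + ν j * c * dot ν ξ := by
      intro N c e
      simp only [apply, dot, Fin.sum_univ_four]
      ring
    have h : apply (Matrix.of fun j k => dot ν ξ ^ 2 * W j k - dot ν ξ * (ν j * apply W ξ k)
        - dot ν ξ * (apply W ξ j * ν k) + ν j * ν k * dot ξ (apply W ξ)) ξ j = 0 := by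
      refine (key _ _ _).trans ?_
      ring
    rw [h]
    ring

theorem harmonicOf_eq_self (hx : IsHarmonic ξ x) (hN : dot ν ξ ≠ 0) :
    harmonicOf ν ξ ((dot ν ξ ^ 2)⁻¹ • traceReverse x) = x := by
  have h0 : ∀ j, apply ((dot ν ξ ^ 2)⁻¹ • traceReverse x) ξ j = 0 := by
    intro j
    have h1 : apply ((dot ν ξ ^ 2)⁻¹ • traceReverse x) ξ j
        = (dot ν ξ ^ 2)⁻¹ * apply (traceReverse x) ξ j := by
      simp only [apply, Matrix.smul_apply, smul_eq_mul, Finset.mul_sum]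
      exact Finset.sum_congr rfl fun l _ => by ring
    rw [h1, apply_traceReverse, hx.2]
    ring
  have h1 : dot ξ (apply ((dot ν ξ ^ 2)⁻¹ • traceReverse x) ξ) = 0 := by
    rw [dot.eq_1 ξ]
    exact Finset.sum_eq_zero fun j _ => by rw [h0, mul_zero]
  rw [harmonicOf]
  conv_rhs => rw [← traceReverse_traceReverse x]
  congr 1
  ext j k
  rw [Matrix.of_apply, h0, h0, h1, Matrix.smul_apply, smul_eq_mul, ← mul_assoc,
    mul_inv_cancel₀ (pow_ne_zero 2 hN)]
  ring

theorem harmonicOf_add (W W' : Matrix (Fin 4) (Fin 4) ℂ) :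
    harmonicOf ν ξ (W + W') = harmonicOf ν ξ W + harmonicOf ν ξ W' := by
  ext i j
  simp only [harmonicOf, traceReverse, mtrace, apply, dot, Matrix.of_apply, Matrix.add_apply,
    Fin.sum_univ_four]
  ring

theorem harmonicOf_smul (c : ℂ) (W : Matrix (Fin 4) (Fin 4) ℂ) :
    harmonicOf ν ξ (c • W) = c • harmonicOf ν ξ W := by
  ext i j
  simp only [harmonicOf, traceReverse, mtrace, apply, dot, Matrix.of_apply, Matrix.smul_apply,
    Fin.sum_univ_four, smul_eq_mul]
  ring

theorem absorb_add (ξ η ε : Fin 4 → ℂ) (x y : Matrix (Fin 4) (Fin 4) ℂ) :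
    absorb ξ η ε (x + y) = absorb ξ η ε x + absorb ξ η ε y := by
  ext i j
  simp only [absorb, apply, dot, Matrix.of_apply, Matrix.add_apply, Fin.sum_univ_four]
  ring

theorem absorb_smul (ξ η ε : Fin 4 → ℂ) (c : ℂ) (x : Matrix (Fin 4) (Fin 4) ℂ) :
    absorb ξ η ε (c • x) = c • absorb ξ η ε x := by
  ext i j
  simp only [absorb, apply, dot, Matrix.of_apply, Matrix.smul_apply, Fin.sum_univ_four, smul_eq_mul]
  ring

/-- The unit covector in the time direction. -/
def timeCovector : Fin 4 → ℂ := Pi.single 0 1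

theorem dot_timeCovector (ξ : Fin 4 → ℂ) : dot timeCovector ξ = -ξ 0 := by
  simp [dot, timeCovector, Fin.sum_univ_four, sign, minkowski]

/-- Parametrizing harmonic tensors by spatial tensors is injective. -/
theorem eq_zero_of_harmonicOf_eq_zero (hξ : ξ 0 ≠ 0) (hW : ∀ i j, i = 0 ∨ j = 0 → W i j = 0)
    (h : harmonicOf timeCovector ξ W = 0) : W = 0 := by
  have h1 := congrArg traceReverse h
  rw [harmonicOf, traceReverse_traceReverse] at h1
  ext i j
  by_cases hij : i = 0 ∨ j = 0
  · exact hW i j hij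
  · rw [not_or] at hij
    have h2 := congrFun (congrFun h1 i) j
    have h3 : ∀ k : Fin 4, k ≠ 0 → timeCovector k = 0 := fun k hk => by simp [timeCovector, hk]
    have h4 : traceReverse (0 : Matrix (Fin 4) (Fin 4) ℂ) i j = 0 := by
      simp [traceReverse, mtrace]
    rw [Matrix.of_apply, h3 i hij.1, h3 j hij.2, h4, dot_timeCovector] at h2
    exact (mul_eq_zero.mp (by linear_combination h2 : (-ξ 0) ^ 2 * W i j = 0)).resolve_left
      (pow_ne_zero 2 (neg_ne_zero.mpr hξ))

/-- A basis of the symmetric spatial tensors. -/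
def spatialBasis (q : Fin 6) : Tensor :=
  Matrix.single ((![1, 2, 3, 1, 1, 2] : Fin 6 → Fin 4) q) ((![1, 2, 3, 2, 3, 3] : Fin 6 → Fin 4) q) 1
    + Matrix.single ((![1, 2, 3, 2, 3, 3] : Fin 6 → Fin 4) q) ((![1, 2, 3, 1, 1, 2] : Fin 6 → Fin 4) q) 1

theorem spatialBasis_symm (q : Fin 6) (i j : Fin 4) : spatialBasis q i j = spatialBasis q j i := by
  simp only [spatialBasis, Matrix.add_apply, Matrix.single_apply]
  rw [add_comm]
  congr 2 <;> rw [and_comm]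

theorem spatialBasis_eq_zero (q : Fin 6) (i j : Fin 4) (h : i = 0 ∨ j = 0) :
    spatialBasis q i j = 0 := by
  rcases h with rfl | rfl <;> fin_cases q <;> simp [spatialBasis]

/-- Complex version of a real tensor. -/
def complexify (w : Tensor) : Matrix (Fin 4) (Fin 4) ℂ := w.map fun t => (t : ℂ)

theorem eq_zero_of_sum_spatialBasis (g : Fin 6 → ℂ)
    (h : ∑ q, g q • complexify (spatialBasis q) = 0) : g = 0 := by
  have h1 := fun i j => congrFun (congrFun h i) j
  simp only [complexify, Fin.sum_univ_six, Matrix.add_apply, Matrix.smul_apply, Matrix.map_apply,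
    spatialBasis, Matrix.zero_apply, Matrix.single_apply, smul_eq_mul] at h1
  have e0 := h1 1 1
  have e1 := h1 2 2
  have e2 := h1 3 3
  have e3 := h1 1 2
  have e4 := h1 1 3
  have e5 := h1 2 3
  ext q
  fin_cases q <;> simp at e0 e1 e2 e3 e4 e5 ⊢ <;> assumption

/-- The polarizations used for the first wave. -/
def firstPolarization (q : Fin 6) (ξ : Fin 4 → ℂ) : Matrix (Fin 4) (Fin 4) ℂ :=
  harmonicOf timeCovector ξ (complexify (spatialBasis q))

theorem isHarmonic_firstPolarization (q : Fin 6) (ξ : Fin 4 → ℂ) :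
    IsHarmonic ξ (firstPolarization q ξ) :=
  isHarmonic_harmonicOf _ _ fun i j => by simp [complexify, spatialBasis_symm q i j]

theorem absorb_symm {ξ η ε : Fin 4 → ℂ} (hx : ∀ i j, x i j = x j i) (i j : Fin 4) :
    absorb ξ η ε x i j = absorb ξ η ε x j i := by
  simp only [absorb, Matrix.of_apply, hx i j]
  ring

/-- The composition of the parametrization with three meetings is linear, and each stage is
injective: the parametrization on spatial symmetric tensors because ζ₀ has a non-zero time
component, the meetings because ε_j is not orthogonal to the incoming momentum. -/
theorem linearIndependent_absorb {ζ : Fin 4 → Fin 4 → ℂ} {ε₁ ε₂ ε₃ : Fin 4 → ℂ}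
    (hζ : ∀ j, dot (ζ j) (ζ j) = 0) (h01 : dot (ζ 0) (ζ 1) = 0)
    (h012 : dot (ζ 0 + ζ 1) (ζ 2) = 0) (h0123 : dot (ζ 0 + ζ 1 + ζ 2) (ζ 3) = 0)
    (h1 : dot ε₁ ε₁ = 0) (h1' : dot ε₁ (ζ 1) = 0) (h2 : dot ε₂ ε₂ = 0) (h2' : dot ε₂ (ζ 2) = 0)
    (h3 : dot ε₃ ε₃ = 0) (h3' : dot ε₃ (ζ 3) = 0) (hα₁ : dot ε₁ (ζ 0) ≠ 0)
    (hα₂ : dot ε₂ (ζ 0 + ζ 1) ≠ 0) (hα₃ : dot ε₃ (ζ 0 + ζ 1 + ζ 2) ≠ 0) (h0 : ζ 0 0 ≠ 0) :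
    LinearIndependent ℂ fun q => absorb (ζ 0 + ζ 1 + ζ 2) (ζ 3) ε₃
      (absorb (ζ 0 + ζ 1) (ζ 2) ε₂ (absorb (ζ 0) (ζ 1) ε₁ (firstPolarization q (ζ 0)))) := by
  let L : Matrix (Fin 4) (Fin 4) ℂ →ₗ[ℂ] Matrix (Fin 4) (Fin 4) ℂ :=
    { toFun := fun W => absorb (ζ 0 + ζ 1 + ζ 2) (ζ 3) ε₃
        (absorb (ζ 0 + ζ 1) (ζ 2) ε₂ (absorb (ζ 0) (ζ 1) ε₁ (harmonicOf timeCovector (ζ 0) W)))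
      map_add' := fun W W' => by rw [harmonicOf_add, absorb_add, absorb_add, absorb_add]
      map_smul' := fun c W => by
        rw [harmonicOf_smul, absorb_smul, absorb_smul, absorb_smul, RingHom.id_apply] }
  rw [Fintype.linearIndependent_iff]
  intro g hg
  refine congrFun (eq_zero_of_sum_spatialBasis g ?_)
  set W := ∑ q, g q • complexify (spatialBasis q) with hWdef
  have hL : L W = 0 := by
    rw [hWdef, map_sum, ← hg]
    exact Finset.sum_congr rfl fun q _ => map_smul L _ _
  have hWs : ∀ i j, W i j = W j i := fun i j => by
    simp [hWdef, Matrix.sum_apply, complexify, spatialBasis_symm _ i j]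
  have hW0 : ∀ i j, i = 0 ∨ j = 0 → W i j = 0 := fun i j h => by
    simp [hWdef, Matrix.sum_apply, complexify, spatialBasis_eq_zero _ i j h]
  have hs0 := (isHarmonic_harmonicOf timeCovector (ζ 0) hWs).1
  have hs1 := absorb_symm (ξ := ζ 0) (η := ζ 1) (ε := ε₁) hs0
  have hs2 := absorb_symm (ξ := ζ 0 + ζ 1) (η := ζ 2) (ε := ε₂) hs1
  exact eq_zero_of_harmonicOf_eq_zero h0 hW0
    (eq_zero_of_absorb_eq_zero hs0 (hζ 1) h01 h1 h1' hα₁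
      (eq_zero_of_absorb_eq_zero hs1 (hζ 2) h012 h2 h2' hα₂
        (eq_zero_of_absorb_eq_zero hs2 (hζ 3) h0123 h3 h3' hα₃ hL)))

end Harmonic

end

end FourWave

namespace FourWave

noncomputable section

open ComplexConjugate

/-! ### Null covectors as products of spinors -/

section Spinors

/-- The null covector that is the product of two spinors. -/
def spinMul (p q : Fin 2 → ℂ) : Fin 4 → ℂ :=
  ![(p 0 * q 0 + p 1 * q 1) / 2, (p 0 * q 1 + p 1 * q 0) / 2,
    -Complex.I * (p 0 * q 1 - p 1 * q 0) / 2, (p 0 * q 0 - p 1 * q 1) / 2]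

/-- The symplectic form on spinors. -/
def bracket (p q : Fin 2 → ℂ) : ℂ := p 0 * q 1 - p 1 * q 0

theorem sign_zero : sign 0 = -1 := by simp [sign, minkowski]

theorem sign_one : sign 1 = 1 := by simp [sign, minkowski]

theorem sign_two : sign 2 = 1 := by simp [sign, minkowski]

theorem sign_three : sign 3 = 1 := by simp [sign, minkowski]

/-- The Minkowski product factorizes into symplectic forms of spinors. Sharing one spinor factor
makes null covectors orthogonal without making them proportional. -/
theorem dot_spinMul (p q p' q' : Fin 2 → ℂ) :
    dot (spinMul p q) (spinMul p' q') = -(1 / 2) * (bracket p p' * bracket q q') := by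
  simp only [dot, Fin.sum_univ_four, sign_zero, sign_one, sign_two, sign_three]
  simp only [spinMul, bracket, Matrix.cons_val_zero, Matrix.cons_val_one, Matrix.cons_val]
  linear_combination (p 0 * q 1 - p 1 * q 0) * (p' 0 * q' 1 - p' 1 * q' 0) / 4 * Complex.I_mul_I

theorem spinMul_add_left (p p' q : Fin 2 → ℂ) :
    spinMul (p + p') q = spinMul p q + spinMul p' q := by
  ext k
  fin_cases k <;> simp [spinMul] <;> ring

theorem spinMul_add_right (p q q' : Fin 2 → ℂ) :
    spinMul p (q + q') = spinMul p q + spinMul p q' := by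
  ext k
  fin_cases k <;> simp [spinMul] <;> ring

/-- A future or past directed light-like covector is the square of a spinor, up to sign. -/
theorem IsLightlike.exists_spinor {b : Covector} (hb : IsLightlike b) :
    ∃ (s : ℝ) (ψ : Fin 2 → ℂ), s * s = 1 ∧ ψ ≠ 0 ∧
      ∀ k, (b k : ℂ) = s * spinMul ψ (fun i => conj (ψ i)) k := by
  have hq : b 1 ^ 2 + b 2 ^ 2 + b 3 ^ 2 = b 0 ^ 2 := by
    have := hb.2
    simp [pairing, minkowski, Fin.sum_univ_four, Matrix.diagonal_apply] at this
    linear_combination this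
  have h0 : b 0 ≠ 0 := by
    intro h0
    refine hb.1 (funext fun k => ?_)
    rw [h0] at hq
    have h1 : b 1 = 0 := by nlinarith [sq_nonneg (b 1), sq_nonneg (b 2), sq_nonneg (b 3)]
    have h2 : b 2 = 0 := by nlinarith [sq_nonneg (b 1), sq_nonneg (b 2), sq_nonneg (b 3)]
    have h3 : b 3 = 0 := by nlinarith [sq_nonneg (b 1), sq_nonneg (b 2), sq_nonneg (b 3)]
    fin_cases k
    exacts [h0, h1, h2, h3]
  obtain ⟨s, hs, hpos⟩ : ∃ s : ℝ, s * s = 1 ∧ 0 < s * b 0 := by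
    rcases lt_or_gt_of_ne h0 with h | h
    · exact ⟨-1, by norm_num, by linarith⟩
    · exact ⟨1, by norm_num, by linarith⟩
  obtain ⟨n, hn⟩ : ∃ n : Covector, ∀ k, n k = s * b k := ⟨fun k => s * b k, fun _ => rfl⟩
  have hbn : ∀ k, b k = s * n k := fun k => by
    rw [hn, ← mul_assoc, hs, one_mul]
  have hnq : n 1 ^ 2 + n 2 ^ 2 + n 3 ^ 2 = n 0 ^ 2 := by
    simp only [hn]
    linear_combination s ^ 2 * hq
  have hn0 : 0 < n 0 := by rw [hn]; exact hpos
  suffices h : ∃ ψ : Fin 2 → ℂ, ∀ k, (n k : ℂ) = spinMul ψ (fun i => conj (ψ i)) k by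
    obtain ⟨ψ, hψ⟩ := h
    refine ⟨s, ψ, hs, ?_, fun k => by rw [hbn, Complex.ofReal_mul, hψ]⟩
    rintro rfl
    have := hψ 0
    simp [spinMul] at this
    exact hn0.ne' this
  -- The spinor is (r, (n₁ - i n₂) / r) with r² = n₀ + n₃. It degenerates for the single null
  -- direction with n₃ = -n₀, where (0, r) with r² = 2 n₀ is used.
  by_cases hp : n 0 + n 3 = 0
  · have h3 : n 3 = -n 0 := by linarith
    have h1 : n 1 = 0 := by
      rw [h3] at hnq
      nlinarith [sq_nonneg (n 1), sq_nonneg (n 2)]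
    have h2 : n 2 = 0 := by
      rw [h3] at hnq
      nlinarith [sq_nonneg (n 1), sq_nonneg (n 2)]
    obtain ⟨r, hr⟩ : ∃ r : ℝ, (r : ℂ) * r = 2 * n 0 := by
      refine ⟨Real.sqrt (2 * n 0), ?_⟩
      rw [← Complex.ofReal_mul, Real.mul_self_sqrt (by linarith)]
      push_cast
      ring
    refine ⟨![0, r], fun k => ?_⟩
    fin_cases k
    · simp [spinMul, hr]
    · simp [spinMul, h1]
    · simp [spinMul, h2]
    · simp [spinMul, h3, hr]
      ring
  · have hp' : 0 < n 0 + n 3 := by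
      refine lt_of_le_of_ne ?_ (Ne.symm hp)
      nlinarith [sq_nonneg (n 1), sq_nonneg (n 2), abs_le_of_sq_le_sq' (by
        nlinarith [sq_nonneg (n 1), sq_nonneg (n 2)] : n 3 ^ 2 ≤ n 0 ^ 2) hn0.le]
    set r : ℝ := Real.sqrt (n 0 + n 3) with hrdef
    have hrr : r * r = n 0 + n 3 := Real.mul_self_sqrt hp'.le
    have hr0 : (r : ℂ) ≠ 0 := by
      exact_mod_cast (Real.sqrt_pos.mpr hp').ne'
    have hr : (r : ℂ) * r = n 0 + n 3 := by exact_mod_cast congrArg (fun t : ℝ => (t : ℂ)) hrr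
    have hz : ((n 1 : ℂ) - Complex.I * n 2) * (n 1 + Complex.I * n 2) = (n 0 - n 3) * (r * r) := by
      rw [hr]
      have : (n 1 : ℂ) ^ 2 + (n 2 : ℂ) ^ 2 + (n 3 : ℂ) ^ 2 = (n 0 : ℂ) ^ 2 := by exact_mod_cast hnq
      linear_combination this - (n 2 : ℂ) ^ 2 * Complex.I_mul_I
    refine ⟨![r, ((n 1 : ℂ) - Complex.I * n 2) / r], fun k => ?_⟩
    fin_cases k
    · simp [spinMul]
      field_simp
      linear_combination -hz - r ^ 2 * hr
    · simp [spinMul]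
      field_simp
      ring
    · simp [spinMul]
      field_simp
      linear_combination 2 * (n 2 : ℂ) * Complex.I_mul_I
    · simp [spinMul]
      field_simp
      linear_combination hz - r ^ 2 * hr

theorem conj_spinMul_conj (p : Fin 2 → ℂ) (k : Fin 4) :
    conj (spinMul p (fun i => conj (p i)) k) = spinMul p (fun i => conj (p i)) k := by
  fin_cases k <;> simp [spinMul, Complex.conj_ofNat] <;> ring

end Spinors

/-! ### A configuration where the amplitude is singular -/

section Witness

/-- Momenta `P_j ⊗ Q_j` and polarizations `ε_j ⊗ ε_j` (for `j ≠ 0`) at which the product of the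
first two waves and the product of the fourth wave with the test wave are singular. -/
structure IsSingular (P Q : Fin 4 → Fin 2 → ℂ) (ε : Fin 4 → Fin 4 → ℂ) : Prop where
  dot_ne_zero : ∀ i j, i < j → (i, j) ≠ (0, 1) →
    dot (spinMul (P i) (Q i)) (spinMul (P j) (Q j)) ≠ 0
  dot_sum_ne_zero : ∀ j : Fin 3, dot (spinMul (P j.castSucc) (Q j.castSucc))
    (∑ l, spinMul (P l) (Q l)) ≠ 0
  bracket_ne_zero : bracket (P 0) (P 1) ≠ 0
  det_ne_zero : (Matrix.of fun j => spinMul (P j) (Q j)).det ≠ 0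
  dot_zero_one : dot (spinMul (P 0) (Q 0)) (spinMul (P 1) (Q 1)) = 0
  dot_two : dot (spinMul (P 0) (Q 0) + spinMul (P 1) (Q 1)) (spinMul (P 2) (Q 2)) = 0
  dot_three : dot (spinMul (P 0) (Q 0) + spinMul (P 1) (Q 1) + spinMul (P 2) (Q 2))
    (spinMul (P 3) (Q 3)) = 0
  null : ∀ j, dot (ε j) (ε j) = 0
  transverse : ∀ j, dot (ε j) (spinMul (P j) (Q j)) = 0
  one_ne_zero : dot (ε 1) (spinMul (P 0) (Q 0)) ≠ 0
  two_ne_zero : dot (ε 2) (spinMul (P 0) (Q 0) + spinMul (P 1) (Q 1)) ≠ 0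
  three_ne_zero : dot (ε 3)
    (spinMul (P 0) (Q 0) + spinMul (P 1) (Q 1) + spinMul (P 2) (Q 2)) ≠ 0

/-- The partial sums of the momenta stay products of two spinors: (l₁+l₂) ⊗ t₁, then (l₁+l₂) ⊗
(t₁+t₃), then (2l₁+3l₂) ⊗ (t₁+t₃). Each new momentum shares one factor with the previous sum, so all
three meetings are on the null cone. Each ε_j shares one factor with its own momentum, and neither
of its factors is proportional to the corresponding one of the incoming sum. The entry 0 for wave 0
is a placeholder. -/
theorem isSingular_of_bracket {l₁ l₂ t₁ t₃ : Fin 2 → ℂ} (hl : bracket l₁ l₂ ≠ 0)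
    (ht : bracket t₁ t₃ ≠ 0) :
    IsSingular ![l₁, l₂, l₁ + l₂, l₁ + l₂ + l₂] ![t₁, t₁, t₃, t₁ + t₃]
      ![0, spinMul l₂ t₃, spinMul l₁ t₃, spinMul (l₁ + l₂ + l₂) t₁] := by
  have hne : ∀ z c : ℂ, c ≠ 0 → z = c * (bracket l₁ l₂ * bracket t₁ t₃) → z ≠ 0 :=
    fun z c hc hz => by
      rw [hz]
      exact mul_ne_zero hc (mul_ne_zero hl ht)
  have hsum : spinMul l₁ t₁ + spinMul l₂ t₁ + spinMul (l₁ + l₂) t₃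
      + spinMul (l₁ + l₂ + l₂) (t₁ + t₃) = spinMul (l₁ + l₁ + l₂ + l₂ + l₂) (t₁ + t₃) := by
    simp only [spinMul_add_left, spinMul_add_right]
    abel
  have hsum2 : spinMul l₁ t₁ + spinMul l₂ t₁ = spinMul (l₁ + l₂) t₁ := by
    rw [spinMul_add_left]
  have hsum3 : spinMul l₁ t₁ + spinMul l₂ t₁ + spinMul (l₁ + l₂) t₃
      = spinMul (l₁ + l₂) (t₁ + t₃) := by
    rw [spinMul_add_right, hsum2]
  have hself : ∀ p : Fin 2 → ℂ, bracket p p = 0 := fun p => by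
    rw [bracket]
    ring
  have h00 : dot (spinMul l₁ t₁) (spinMul l₁ t₁) = 0 := by
    simp [dot_spinMul, hself]
  have h01 : dot (spinMul l₁ t₁) (spinMul l₂ t₁) = 0 := by
    simp [dot_spinMul, hself]
  have h02 : dot (spinMul l₁ t₁) (spinMul (l₁ + l₂) t₃)
      = -(1 / 2) * (bracket l₁ l₂ * bracket t₁ t₃) := by
    rw [dot_spinMul]
    simp only [bracket, Pi.add_apply]
    ring
  have h03 : dot (spinMul l₁ t₁) (spinMul (l₁ + l₂ + l₂) (t₁ + t₃))
      = -1 * (bracket l₁ l₂ * bracket t₁ t₃) := by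
    rw [dot_spinMul]
    simp only [bracket, Pi.add_apply]
    ring
  have h11 : dot (spinMul l₂ t₁) (spinMul l₂ t₁) = 0 := by
    simp [dot_spinMul, hself]
  have h12 : dot (spinMul l₂ t₁) (spinMul (l₁ + l₂) t₃)
      = (1 / 2) * (bracket l₁ l₂ * bracket t₁ t₃) := by
    rw [dot_spinMul]
    simp only [bracket, Pi.add_apply]
    ring
  have h13 : dot (spinMul l₂ t₁) (spinMul (l₁ + l₂ + l₂) (t₁ + t₃))
      = (1 / 2) * (bracket l₁ l₂ * bracket t₁ t₃) := by
    rw [dot_spinMul]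
    simp only [bracket, Pi.add_apply]
    ring
  have h22 : dot (spinMul (l₁ + l₂) t₃) (spinMul (l₁ + l₂) t₃) = 0 := by
    simp [dot_spinMul, hself]
  have h23 : dot (spinMul (l₁ + l₂) t₃) (spinMul (l₁ + l₂ + l₂) (t₁ + t₃))
      = (1 / 2) * (bracket l₁ l₂ * bracket t₁ t₃) := by
    rw [dot_spinMul]
    simp only [bracket, Pi.add_apply]
    ring
  have h33 : dot (spinMul (l₁ + l₂ + l₂) (t₁ + t₃)) (spinMul (l₁ + l₂ + l₂) (t₁ + t₃)) = 0 := by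
    simp [dot_spinMul, hself]
  refine ⟨?_, ?_, hl, ?_, ?_, ?_, ?_, ?_, ?_, ?_, ?_, ?_⟩
  · intro i j hij hne01
    fin_cases i <;> fin_cases j <;>
      first | exact absurd hij (by decide) | exact absurd rfl hne01 | skip
    · exact hne _ _ (by norm_num) h02
    · exact hne _ _ (by norm_num) h03
    · exact hne _ _ (by norm_num) h12
    · exact hne _ _ (by norm_num) h13
    · exact hne _ _ (by norm_num) h23
  · intro j
    simp only [Fin.sum_univ_four, Matrix.cons_val_zero, Matrix.cons_val_one, Matrix.cons_val, hsum]
    fin_cases j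
    · refine hne _ (-(3 / 2)) (by norm_num) ((dot_spinMul _ _ _ _).trans ?_)
      simp [bracket]
      ring
    · refine hne _ 1 (by norm_num) ((dot_spinMul _ _ _ _).trans ?_)
      simp [bracket]
      ring
    · refine hne _ (1 / 2) (by norm_num) ((dot_spinMul _ _ _ _).trans ?_)
      simp [bracket]
      ring
  -- A linear relation between the rows is contracted with each of the four momenta; the Gram matrix
  -- is an invertible multiple of the product of the two brackets.
  · intro hdet
    obtain ⟨v, hv, hv'⟩ := Matrix.exists_vecMul_eq_zero_iff.mpr hdet
    have hD : bracket l₁ l₂ * bracket t₁ t₃ ≠ 0 := mul_ne_zero hl ht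
    have hv2 : ∀ k, v 0 * spinMul l₁ t₁ k + v 1 * spinMul l₂ t₁ k + v 2 * spinMul (l₁ + l₂) t₃ k
        + v 3 * spinMul (l₁ + l₂ + l₂) (t₁ + t₃) k = 0 := fun k => by
      have := congrFun hv' k
      simpa [Matrix.vecMul, dotProduct, Fin.sum_univ_four] using this
    have hv3 : ∀ p, v 0 * dot p (spinMul l₁ t₁) + v 1 * dot p (spinMul l₂ t₁)
        + v 2 * dot p (spinMul (l₁ + l₂) t₃)
        + v 3 * dot p (spinMul (l₁ + l₂ + l₂) (t₁ + t₃)) = 0 := fun p => by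
      have : ∑ k, sign k * p k * (v 0 * spinMul l₁ t₁ k + v 1 * spinMul l₂ t₁ k
        + v 2 * spinMul (l₁ + l₂) t₃ k + v 3 * spinMul (l₁ + l₂ + l₂) (t₁ + t₃) k) = 0 := by
        simp [hv2]
      rw [← this]
      simp only [dot, Fin.sum_univ_four]
      ring
    have e0 := hv3 (spinMul l₁ t₁)
    have e1 := hv3 (spinMul l₂ t₁)
    have e2 := hv3 (spinMul (l₁ + l₂) t₃)
    have e3 := hv3 (spinMul (l₁ + l₂ + l₂) (t₁ + t₃))
    rw [h00, h01, h02, h03] at e0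
    rw [dot_comm, h01, h11, h12, h13] at e1
    rw [dot_comm, h02, dot_comm _ (spinMul l₂ t₁), h12, h22, h23] at e2
    rw [dot_comm, h03, dot_comm _ (spinMul l₂ t₁), h13, dot_comm _ (spinMul (l₁ + l₂) t₃), h23,
      h33] at e3
    have z3 : v 3 = 0 := (mul_eq_zero.mp (by linear_combination -2 * e0 - 2 * e1 :
      bracket l₁ l₂ * bracket t₁ t₃ * v 3 = 0)).resolve_left hD
    have z2 : v 2 = 0 := (mul_eq_zero.mp (by
      rw [z3] at e0
      linear_combination -2 * e0 : bracket l₁ l₂ * bracket t₁ t₃ * v 2 = 0)).resolve_left hD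
    rw [z2, z3] at e2 e3
    have z0 : v 0 = 0 := (mul_eq_zero.mp (by linear_combination -2 * e3 + 2 * e2 :
      bracket l₁ l₂ * bracket t₁ t₃ * v 0 = 0)).resolve_left hD
    have z1 : v 1 = 0 := (mul_eq_zero.mp (by
      rw [z0] at e2
      linear_combination 2 * e2 : bracket l₁ l₂ * bracket t₁ t₃ * v 1 = 0)).resolve_left hD
    refine hv (funext fun k => ?_)
    fin_cases k
    exacts [z0, z1, z2, z3]
  · simp [dot_spinMul, hself]
  · simp [hsum2, dot_spinMul, hself]
  · simp [hsum3, dot_spinMul, hself]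
  · intro j
    fin_cases j <;> simp [dot_spinMul, hself]
    simp [dot]
  · intro j
    fin_cases j <;> simp [dot_spinMul, hself]
    simp [dot]
  · simp only [Matrix.cons_val_zero, Matrix.cons_val_one, dot_spinMul]
    refine hne _ (-1/2) (by norm_num) ?_
    simp only [bracket]
    ring
  · simp only [Matrix.cons_val_zero, Matrix.cons_val_one, Matrix.cons_val, hsum2, dot_spinMul]
    refine hne _ (1/2) (by norm_num) ?_
    simp only [bracket, Pi.add_apply]
    ring
  · simp only [Matrix.cons_val_zero, Matrix.cons_val_one, Matrix.cons_val, hsum3, dot_spinMul]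
    refine hne _ (1/2) (by norm_num) ?_
    simp only [bracket, Pi.add_apply]
    ring

theorem exists_isSingular {κ : Fin 2 → ℂ} (hκ : κ ≠ 0) {s : ℝ} (hs : s * s = 1) :
    ∃ (P Q : Fin 4 → Fin 2 → ℂ) (ε : Fin 4 → Fin 4 → ℂ), IsSingular P Q ε ∧
      (∀ k, ∑ l, spinMul (P l) (Q l) k = s * spinMul κ (fun i => conj (κ i)) k) ∧
      bracket (P 3) κ ≠ 0 ∧ spinMul (P 0) (Q 0) 0 ≠ 0 := by
  have hnorm : conj (κ 0) * κ 0 + conj (κ 1) * κ 1 ≠ 0 := by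
    intro h
    have h1 : Complex.normSq (κ 0) + Complex.normSq (κ 1) = 0 := by
      have : ((Complex.normSq (κ 0) + Complex.normSq (κ 1) : ℝ) : ℂ) = 0 := by
        rw [Complex.ofReal_add, Complex.normSq_eq_conj_mul_self, Complex.normSq_eq_conj_mul_self, h]
      exact_mod_cast this
    have h2 := Complex.normSq_nonneg (κ 0)
    have h3 := Complex.normSq_nonneg (κ 1)
    refine hκ (funext fun k => ?_)
    fin_cases k
    · exact Complex.normSq_eq_zero.mp (by linarith : Complex.normSq (κ 0) = 0)
    · exact Complex.normSq_eq_zero.mp (by linarith : Complex.normSq (κ 1) = 0)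
  have hs0 : (s : ℂ) ≠ 0 := by
    intro h
    rw [Complex.ofReal_eq_zero] at h
    rw [h] at hs
    norm_num at hs
  have hs3 : (s : ℂ) + 3 ≠ 0 := by
    intro h
    have : s = -3 := by
      have : s + 3 = 0 := by exact_mod_cast h
      linarith
    rw [this] at hs
    norm_num at hs
  -- The choices solve 2 l₁ + 3 l₂ = s κ and t₁ + t₃ = conj κ, so that the momenta add up to s κ ⊗
  -- conj κ. The free vectors l₂ and t₃ are taken such that both brackets are non-zero multiples of
  -- |κ₀|² + |κ₁|².
  let l₂ : Fin 2 → ℂ := ![-conj (κ 1), conj (κ 0)]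
  let l₁ : Fin 2 → ℂ := ![(s * κ 0 + 3 * conj (κ 1)) / 2, (s * κ 1 - 3 * conj (κ 0)) / 2]
  let t₃ : Fin 2 → ℂ := ![-κ 1, κ 0]
  let t₁ : Fin 2 → ℂ := ![conj (κ 0) + κ 1, conj (κ 1) - κ 0]
  have hl : bracket l₁ l₂ = s / 2 * (conj (κ 0) * κ 0 + conj (κ 1) * κ 1) := by
    simp [bracket, l₁, l₂]
    ring
  have ht : bracket t₁ t₃ = conj (κ 0) * κ 0 + conj (κ 1) * κ 1 := by
    simp [bracket, t₁, t₃]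
    ring
  refine ⟨_, _, _, isSingular_of_bracket (l₁ := l₁) (l₂ := l₂) (t₁ := t₁) (t₃ := t₃) ?_ ?_,
    fun k => ?_, ?_, ?_⟩
  · rw [hl]
    exact mul_ne_zero (div_ne_zero hs0 two_ne_zero) hnorm
  · rw [ht]
    exact hnorm
  · fin_cases k <;> simp [Fin.sum_univ_four, spinMul, l₁, l₂, t₁, t₃] <;> ring
  · have : bracket (l₁ + l₂ + l₂) κ = -(1 / 2) * (conj (κ 0) * κ 0 + conj (κ 1) * κ 1) := by
      simp [bracket, l₁, l₂]
      ring
    simp only [Matrix.cons_val]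
    rw [this]
    exact mul_ne_zero (by norm_num) hnorm
  · have : spinMul l₁ t₁ 0 = (s + 3) / 4 * (conj (κ 0) * κ 0 + conj (κ 1) * κ 1) := by
      simp [spinMul, l₁, t₁]
      ring
    simp only [Matrix.cons_val_zero]
    rw [this]
    exact mul_ne_zero (div_ne_zero hs3 (by norm_num)) hnorm

end Witness

end

end FourWave

namespace FourWave

noncomputable section

open Filter Topology

/-! ### The Gram determinant of the amplitude -/

section Coordinates

variable {B : Matrix (Fin 4) (Fin 4) ℂ} {β : Fin 4 → ℂ}

/-- The coordinates of `β` with respect to the rows of `B`. -/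
def rowCoord (B : Matrix (Fin 4) (Fin 4) ℂ) (β : Fin 4 → ℂ) (j : Fin 4) : ℂ :=
  (B.updateRow j β).det / B.det

/-- Cramer's rule; it shows the coordinates as quotients of polynomials in the entries, as needed
for meromorphy. -/
theorem sum_rowCoord (hB : B.det ≠ 0) (k : Fin 4) : ∑ j, rowCoord B β j * B j k = β k := by
  have h := congrFun (Matrix.mulVec_cramer B.transpose β) k
  simp only [Matrix.mulVec, dotProduct, Matrix.transpose_apply, Matrix.cramer_transpose_apply,
    Matrix.det_transpose, Pi.smul_apply, smul_eq_mul] at h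
  have h2 : ∑ j, rowCoord B β j * B j k = (∑ j, B j k * (B.updateRow j β).det) / B.det := by
    rw [Finset.sum_div]
    exact Finset.sum_congr rfl fun j _ => by rw [rowCoord]; ring
  rw [h2, h, mul_div_cancel_left₀ _ hB]

theorem rowCoord_eq (hB : B.det ≠ 0) {c : Fin 4 → ℂ} (hc : ∀ k, ∑ j, c j * B j k = β k)
    (j : Fin 4) : rowCoord B β j = c j := by
  have h : Matrix.vecMul (rowCoord B β - c) B = 0 := by
    ext k
    simp only [Matrix.vecMul, dotProduct, Pi.sub_apply, sub_mul, Finset.sum_sub_distrib,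
      sum_rowCoord hB, hc, sub_self, Pi.zero_apply]
  have h2 := Matrix.eq_zero_of_vecMul_eq_zero hB h
  exact sub_eq_zero.mp (congrFun h2 j)

/-- The rows of `B`, scaled such that their sum is `β`. -/
def scaledMom (B : Matrix (Fin 4) (Fin 4) ℂ) (β : Fin 4 → ℂ) (j k : Fin 4) : ℂ :=
  rowCoord B β j * B j k

theorem sum_scaledMom (hB : B.det ≠ 0) : ∑ j, scaledMom B β j = β := by
  ext k
  rw [Finset.sum_apply]
  exact sum_rowCoord hB k

theorem dot_scaledMom (i j : Fin 4) : dot (scaledMom B β i) (scaledMom B β j)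
    = rowCoord B β i * rowCoord B β j * dot (B i) (B j) := by
  simp only [dot, scaledMom, Finset.mul_sum]
  exact Finset.sum_congr rfl fun k _ => by ring

theorem dot_scaledMom_left (j : Fin 4) :
    dot (scaledMom B β j) β = rowCoord B β j * dot (B j) β := by
  simp only [dot, scaledMom, Finset.mul_sum]
  exact Finset.sum_congr rfl fun k _ => by ring

/-- The polarizations in momentum space, with the `q`-th choice for the first wave. -/
def scaledPol (a : ℕ) (β : Fin 4 → ℂ) (B : Matrix (Fin 4) (Fin 4) ℂ)
    (v : Fin 4 → Matrix (Fin 4) (Fin 4) ℂ) (q : Fin 6) (j : Fin 4) : Matrix (Fin 4) (Fin 4) ℂ :=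
  if j = 0 then firstPolarization q (scaledMom B β 0)
  else ((a.factorial : ℂ) / rowCoord B β j ^ a) • v j

/-- The determinant that controls whether the amplitudes with test polarizations `W` are
independent. -/
def gramDet (a : ℕ) (β : Fin 4 → ℂ) (W : Fin 6 → Tensor) (B : Matrix (Fin 4) (Fin 4) ℂ)
    (v : Fin 4 → Matrix (Fin 4) (Fin 4) ℂ) : ℂ :=
  (Matrix.of fun q r => regAmp (scaledMom B β) (scaledPol a β B v q) (W r)).det

/-- The covectors `B j` are independent, and no two of them together with `β` are
orthogonal or dependent. -/
structure Nondegenerate (β : Fin 4 → ℂ) (B : Matrix (Fin 4) (Fin 4) ℂ) : Prop where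
  det_ne_zero : B.det ≠ 0
  updateRow_ne_zero : ∀ j, (B.updateRow j β).det ≠ 0
  dot_ne_zero : ∀ i j, i < j → dot (B i) (B j) ≠ 0
  dot_right_ne_zero : ∀ j, dot (B j) β ≠ 0

theorem Nondegenerate.rowCoord_ne_zero (h : Nondegenerate β B) (j : Fin 4) : rowCoord B β j ≠ 0 :=
  div_ne_zero (h.updateRow_ne_zero j) h.det_ne_zero

theorem Nondegenerate.dot_scaledMom_ne_zero (h : Nondegenerate β B) (i j : Fin 4) (hij : i < j) :
    dot (scaledMom B β i) (scaledMom B β j) ≠ 0 := by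
  rw [dot_scaledMom]
  exact mul_ne_zero (mul_ne_zero (h.rowCoord_ne_zero i) (h.rowCoord_ne_zero j))
    (h.dot_ne_zero i j hij)

theorem Nondegenerate.dot_sum_ne_zero (h : Nondegenerate β B) (j : Fin 4) :
    dot (scaledMom B β j) (∑ l, scaledMom B β l) ≠ 0 := by
  rw [sum_scaledMom h.det_ne_zero, dot_scaledMom_left]
  exact mul_ne_zero (h.rowCoord_ne_zero j) (h.dot_right_ne_zero j)

end Coordinates

/-! ### Continuity of the determinant, also at singular configurations -/

section Limits

variable {X : Type} {F : Filter X} {β : Fin 4 → ℂ}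

theorem det_tendsto {n : ℕ} {M' : X → Matrix (Fin n) (Fin n) ℂ} {M : Matrix (Fin n) (Fin n) ℂ}
    (h : ∀ i j, Tendsto (fun t => M' t i j) F (𝓝 (M i j))) :
    Tendsto (fun t => (M' t).det) F (𝓝 M.det) :=
  ((continuous_id.matrix_det).tendsto M).comp
    (tendsto_pi_nhds.mpr fun i => tendsto_pi_nhds.mpr fun j => h i j)

theorem det_updateRow_tendsto {B' : X → Matrix (Fin 4) (Fin 4) ℂ} {B : Matrix (Fin 4) (Fin 4) ℂ}
    (h : ∀ i j, Tendsto (fun t => B' t i j) F (𝓝 (B i j))) (i : Fin 4) :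
    Tendsto (fun t => ((B' t).updateRow i β).det) F (𝓝 (B.updateRow i β).det) := by
  refine det_tendsto fun k l => ?_
  by_cases hk : k = i
  · subst hk
    simp only [Matrix.updateRow_self]
    exact tendsto_const_nhds
  · simp only [Matrix.updateRow_ne hk]
    exact h k l

theorem continuous_harmonicOf (ν : Fin 4 → ℂ) (i j : Fin 4) :
    Continuous fun p : (Fin 4 → ℂ) × Matrix (Fin 4) (Fin 4) ℂ => harmonicOf ν p.1 p.2 i j := by
  have h1 : ∀ i j, Continuous fun p : (Fin 4 → ℂ) × Matrix (Fin 4) (Fin 4) ℂ => p.2 i j :=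
    fun i j => continuous_snd.matrix_elem i j
  have h2 : ∀ i, Continuous fun p : (Fin 4 → ℂ) × Matrix (Fin 4) (Fin 4) ℂ => p.1 i :=
    fun i => (continuous_apply i).comp continuous_fst
  simp only [harmonicOf, traceReverse, mtrace, apply, dot, Matrix.of_apply]
  fun_prop

theorem tendsto_of_continuous_pair {H : (Fin 4 → ℂ) → Matrix (Fin 4) (Fin 4) ℂ → ℂ}
    (hH : Continuous fun p : (Fin 4 → ℂ) × Matrix (Fin 4) (Fin 4) ℂ => H p.1 p.2)
    {ξ' : X → Fin 4 → ℂ} {ξ : Fin 4 → ℂ}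
    {W' : X → Matrix (Fin 4) (Fin 4) ℂ} {W : Matrix (Fin 4) (Fin 4) ℂ}
    (hξ : ∀ k, Tendsto (fun t => ξ' t k) F (𝓝 (ξ k)))
    (hW : ∀ i j, Tendsto (fun t => W' t i j) F (𝓝 (W i j))) :
    Tendsto (fun t => H (ξ' t) (W' t)) F (𝓝 (H ξ W)) := by
  have h2 : Tendsto (fun t => (ξ' t, W' t)) F (𝓝 (ξ, W)) :=
    Tendsto.prodMk_nhds (tendsto_pi_nhds.mpr hξ)
      (tendsto_pi_nhds.mpr fun i => tendsto_pi_nhds.mpr fun j => hW i j)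
  exact (hH.tendsto (ξ, W)).comp h2

/-- The hypotheses leave out the pair (0, 1) and the last wave, so the statement covers limits at
singular configurations as well as continuity at nondegenerate ones. -/
theorem gramDet_tendsto (a : ℕ) (W : Fin 6 → Tensor) {B' : X → Matrix (Fin 4) (Fin 4) ℂ}
    {B : Matrix (Fin 4) (Fin 4) ℂ} {v' : X → Fin 4 → Matrix (Fin 4) (Fin 4) ℂ}
    {v : Fin 4 → Matrix (Fin 4) (Fin 4) ℂ}
    (hB : ∀ i j, Tendsto (fun t => B' t i j) F (𝓝 (B i j)))
    (hv : ∀ l i j, l ≠ 0 → Tendsto (fun t => v' t l i j) F (𝓝 (v l i j)))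
    (hdet : B.det ≠ 0) (hc : ∀ j, rowCoord B β j ≠ 0)
    (hd : ∀ i j, i < j → (i, j) ≠ (0, 1) → dot (scaledMom B β i) (scaledMom B β j) ≠ 0)
    (hβ : ∀ j : Fin 3, dot (scaledMom B β j.castSucc) (∑ l, scaledMom B β l) ≠ 0) :
    Tendsto (fun t => gramDet a β W (B' t) (v' t)) F (𝓝 (gramDet a β W B v)) := by
  have h1 : ∀ j, Tendsto (fun t => rowCoord (B' t) β j) F (𝓝 (rowCoord B β j)) := fun j =>
    (det_updateRow_tendsto hB j).div (det_tendsto hB) hdet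
  have h2 : ∀ j k, Tendsto (fun t => scaledMom (B' t) β j k) F (𝓝 (scaledMom B β j k)) :=
    fun j k => (h1 j).mul (hB j k)
  refine det_tendsto fun q r => regAmp_tendsto h2 (fun l i j => ?_) hd hβ (W r)
  by_cases hl : l = 0
  · subst hl
    simp only [scaledPol, if_true, firstPolarization]
    exact tendsto_of_continuous_pair
      (H := fun ξ W => harmonicOf timeCovector ξ W i j) (W' := fun _ => complexify (spatialBasis q))
      (continuous_harmonicOf timeCovector i j) (h2 0) fun _ _ => tendsto_const_nhds
  · simp only [scaledPol, if_neg hl, Matrix.smul_apply, smul_eq_mul]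
    exact (tendsto_const_nhds.div ((h1 l).pow a) (pow_ne_zero a (hc l))).mul (hv l i j hl)

end Limits

/-! ### Meromorphy of the determinant and the identity theorem -/

section Meromorphic

variable {β : Fin 4 → ℂ}

theorem meromorphicAt_det {n : ℕ} {M : ℂ → Matrix (Fin n) (Fin n) ℂ} {t : ℂ}
    (h : ∀ i j, MeromorphicAt (fun t => M t i j) t) : MeromorphicAt (fun t => (M t).det) t := by
  simp only [Matrix.det_apply]
  refine MeromorphicAt.fun_sum fun σ _ => ?_
  have h1 : MeromorphicAt (fun t => ∏ i, M t (σ i) i) t := MeromorphicAt.fun_prod fun i _ => h _ _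
  have h2 := (MeromorphicAt.const ((Equiv.Perm.sign σ : ℤ) : ℂ) t).mul h1
  refine h2.congr (Eventually.of_forall fun t => ?_)
  simp [Units.smul_def]

theorem meromorphicAt_det_updateRow {B : ℂ → Matrix (Fin 4) (Fin 4) ℂ} {t : ℂ}
    (h : ∀ i j, MeromorphicAt (fun t => B t i j) t) (i : Fin 4) :
    MeromorphicAt (fun t => ((B t).updateRow i β).det) t := by
  refine meromorphicAt_det fun k l => ?_
  by_cases hk : k = i
  · subst hk
    simp only [Matrix.updateRow_self]
    exact MeromorphicAt.const _ _
  · simp only [Matrix.updateRow_ne hk]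
    exact h k l

theorem meromorphicAt_harmonicOf {ν : Fin 4 → ℂ} {ξ : ℂ → Fin 4 → ℂ}
    {W : ℂ → Matrix (Fin 4) (Fin 4) ℂ} {t : ℂ}
    (hξ : ∀ k, MeromorphicAt (fun t => ξ t k) t)
    (hW : ∀ i j, MeromorphicAt (fun t => W t i j) t) (i j : Fin 4) :
    MeromorphicAt (fun t => harmonicOf ν (ξ t) (W t) i j) t := by
  simp only [harmonicOf, traceReverse, mtrace, apply, dot, Matrix.of_apply, Fin.sum_univ_four]
  fun_prop

theorem meromorphicAt_gramDet (a : ℕ) (W : Fin 6 → Tensor) {B : ℂ → Matrix (Fin 4) (Fin 4) ℂ}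
    {v : ℂ → Fin 4 → Matrix (Fin 4) (Fin 4) ℂ}
    (hB : ∀ i j t, MeromorphicAt (fun t => B t i j) t)
    (hv : ∀ l i j t, MeromorphicAt (fun t => v t l i j) t) (t : ℂ) :
    MeromorphicAt (fun t => gramDet a β W (B t) (v t)) t := by
  have h1 : ∀ j t, MeromorphicAt (fun t => rowCoord (B t) β j) t := fun j t =>
    (meromorphicAt_det_updateRow (fun i j => hB i j t) j).div
      (meromorphicAt_det fun i j => hB i j t)
  have h2 : ∀ j k t, MeromorphicAt (fun t => scaledMom (B t) β j k) t :=
    fun j k t => (h1 j t).mul (hB j k t)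
  refine meromorphicAt_det fun q r => regAmp_meromorphic h2 (fun l i j t => ?_) (W r) t
  by_cases hl : l = 0
  · subst hl
    simp only [scaledPol, if_true, firstPolarization]
    exact meromorphicAt_harmonicOf (ν := timeCovector) (ξ := fun t => scaledMom (B t) β 0)
      (W := fun _ => complexify (spatialBasis q)) (fun k => h2 0 k t)
      (fun _ _ => MeromorphicAt.const _ _) i j
  · simp only [scaledPol, if_neg hl, Matrix.smul_apply, smul_eq_mul]
    exact ((MeromorphicAt.const _ _).div ((h1 l t).pow a)).mul (hv l i j t)

/-- A meromorphic function that has a non-zero limit somewhere has isolated zeros. -/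
theorem eventually_ne_zero_of_tendsto {f : ℂ → ℂ} (hf : ∀ t, MeromorphicAt f t) {t₀ c : ℂ}
    (hc : c ≠ 0) (h : Tendsto f (𝓝[≠] t₀) (𝓝 c)) (t₁ : ℂ) : ∀ᶠ t in 𝓝[≠] t₁, f t ≠ 0 := by
  rw [← meromorphicOrderAt_ne_top_iff_eventually_ne_zero (hf t₁)]
  refine MeromorphicOn.meromorphicOrderAt_ne_top_of_isPreconnected (U := Set.univ)
    (fun t _ => hf t) isPreconnected_univ (Set.mem_univ t₀) (Set.mem_univ t₁) ?_
  rw [meromorphicOrderAt_ne_top_iff_eventually_ne_zero (hf t₀)]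
  exact h.eventually_ne hc

end Meromorphic

end

end FourWave

namespace FourWave

noncomputable section

open Filter Topology ComplexConjugate

/-! ### Real and complex configurations -/

section Reality

/-- Complex version of a real covector. -/
def toC (ξ : Covector) (k : Fin 4) : ℂ := (ξ k : ℂ)

theorem conj_sign (i : Fin 4) : conj (sign i) = sign i := Complex.conj_ofReal _

theorem dot_toC (ξ ζ : Covector) : dot (toC ξ) (toC ζ) = (pairing ξ ζ : ℝ) := by
  rw [pairing, Complex.ofReal_sum, dot]
  refine Finset.sum_congr rfl fun j _ => ?_
  have : ∀ k, minkowski j k * ξ j * ζ k = minkowski j k • (ξ j * ζ k) := fun k => by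
    rw [smul_eq_mul, mul_assoc]
  simp only [this]
  rw [sum_minkowski_smul, smul_eq_mul]
  push_cast
  rw [sign, toC, toC]
  ring

theorem isPolarization_iff {ξ : Covector} {v : Tensor} :
    IsPolarization ξ v ↔ IsHarmonic (toC ξ) (complexify v) := by
  have h1 : ∀ j, apply (complexify v) (toC ξ) j
      = ((∑ l, minkowski l l * v j l * ξ l : ℝ) : ℂ) := fun j => by
    rw [apply, Complex.ofReal_sum]
    refine Finset.sum_congr rfl fun l _ => ?_
    rw [sign, complexify, toC, Matrix.map_apply]
    push_cast
    rfl
  have h2 : mtrace (complexify v) = ((∑ l, minkowski l l * v l l : ℝ) : ℂ) := by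
    rw [mtrace, Complex.ofReal_sum]
    refine Finset.sum_congr rfl fun l _ => ?_
    rw [sign, complexify, Matrix.map_apply]
    push_cast
    rfl
  have h3 : ∀ j, ∑ m, ∑ n, minkowski m n * ξ m * v n j = ∑ l, minkowski l l * v l j * ξ l := by
    intro j
    refine Finset.sum_congr rfl fun m _ => ?_
    have := sum_minkowski_smul m fun n => ξ m * v n j
    simp only [smul_eq_mul, ← mul_assoc] at this
    rw [this]
    ring
  have h4 : ∑ p, ∑ q, minkowski p q * v p q = ∑ l, minkowski l l * v l l :=
    Finset.sum_congr rfl fun m _ => sum_minkowski_smul m fun n => v m n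
  rw [IsPolarization, IsHarmonic]
  simp only [h1, h2, h3, h4]
  have hs : v.IsSymm ↔ ∀ i j, complexify v i j = complexify v j i := by
    rw [Matrix.IsSymm.ext_iff]
    simp only [complexify, Matrix.map_apply, Complex.ofReal_inj]
    exact ⟨fun h i j => h j i, fun h i j => h j i⟩
  rw [hs]
  refine and_congr_right fun h => forall_congr' fun j => ?_
  have hs' : ∀ l, v l j = v j l := fun l => by
    have := h l j
    simpa [complexify] using this
  simp only [hs', toC]
  rw [← Complex.ofReal_inj]
  push_cast
  constructor
  · intro h
    linear_combination -h
  · intro h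
    linear_combination -h

theorem complexify_map_re {x : Matrix (Fin 4) (Fin 4) ℂ} (hx : ∀ i j, conj (x i j) = x i j) :
    complexify (x.map Complex.re) = x := by
  ext i j
  exact Complex.conj_eq_iff_re.mp (hx i j)

theorem conj_harmonicOf {ν ξ : Fin 4 → ℂ} {W : Matrix (Fin 4) (Fin 4) ℂ}
    (hν : ∀ k, conj (ν k) = ν k) (hξ : ∀ k, conj (ξ k) = ξ k) (hW : ∀ i j, conj (W i j) = W i j)
    (i j : Fin 4) : conj (harmonicOf ν ξ W i j) = harmonicOf ν ξ W i j := by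
  simp only [harmonicOf, traceReverse, mtrace, apply, dot, Matrix.of_apply, map_add, map_sub,
    map_mul, map_sum, map_pow, map_div₀, map_one, Complex.conj_ofNat, apply_ite conj, map_zero,
    conj_sign, hν, hξ, hW]

/-- A quadratic curve of tensors. -/
def quadPath (W : Fin 3 → Tensor) (t : ℂ) : Matrix (Fin 4) (Fin 4) ℂ :=
  complexify (W 0) + t • complexify (W 1) + t ^ 2 • complexify (W 2)

theorem IsHarmonic.smul {ξ : Fin 4 → ℂ} {x : Matrix (Fin 4) (Fin 4) ℂ} (hx : IsHarmonic ξ x)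
    (c d : ℂ) : IsHarmonic (c • ξ) (d • x) := by
  refine ⟨fun i j => by simp [hx.1 i j], fun j => ?_⟩
  have h := hx.2 j
  have h1 : apply (d • x) (c • ξ) j = d * c * apply x ξ j := by
    simp only [apply, Matrix.smul_apply, Pi.smul_apply, smul_eq_mul, Finset.mul_sum]
    exact Finset.sum_congr rfl fun l _ => by ring
  have h2 : mtrace (d • x) = d * mtrace x := by
    simp only [mtrace, Matrix.smul_apply, smul_eq_mul, Finset.mul_sum]
    exact Finset.sum_congr rfl fun l _ => by ring
  rw [h1, h2, h, Pi.smul_apply, smul_eq_mul]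
  ring

/-- A single real ν must serve for the projections at both ends of a curve of polarizations. A basis
covector, or a sum of two, is enough. -/
theorem exists_dot_ne_zero {b : Covector} (hb : b ≠ 0) {ζ : Fin 4 → ℂ} (hζ : ζ ≠ 0) :
    ∃ ν : Covector, dot (toC ν) (toC b) ≠ 0 ∧ dot (toC ν) ζ ≠ 0 := by
  obtain ⟨k, hk⟩ := Function.ne_iff.mp hb
  obtain ⟨l, hl⟩ := Function.ne_iff.mp hζ
  have hsg : ∀ i, sign i ≠ 0 := fun i h => by
    have := sign_mul_self i
    rw [h] at this
    simp at this
  have hd : ∀ (i : Fin 4) (ξ : Fin 4 → ℂ), dot (toC (Pi.single i 1)) ξ = sign i * ξ i := by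
    intro i ξ
    rw [dot, Finset.sum_eq_single i]
    · simp [toC]
    · intro j _ hj
      simp [toC, hj]
    · simp
  have hb' : toC b k ≠ 0 := by
    rw [toC]
    exact_mod_cast hk
  have hadd : ∀ (i j : Fin 4) (ξ : Fin 4 → ℂ),
      dot (toC (Pi.single i 1 + Pi.single j 1)) ξ = sign i * ξ i + sign j * ξ j := by
    intro i j ξ
    rw [← hd, ← hd]
    simp only [dot, toC, Pi.add_apply, Complex.ofReal_add, mul_add, add_mul,
      Finset.sum_add_distrib]
  by_cases h1 : ζ k = 0
  · by_cases h2 : toC b l = 0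
    · refine ⟨Pi.single k 1 + Pi.single l 1, ?_, ?_⟩
      · rw [hadd, h2, mul_zero, add_zero]
        exact mul_ne_zero (hsg k) hb'
      · rw [hadd, h1, mul_zero, zero_add]
        exact mul_ne_zero (hsg l) hl
    · refine ⟨Pi.single l 1, ?_, ?_⟩
      · rw [hd]
        exact mul_ne_zero (hsg l) h2
      · rw [hd]
        exact mul_ne_zero (hsg l) hl
  · refine ⟨Pi.single k 1, ?_, ?_⟩
    · rw [hd]
      exact mul_ne_zero (hsg k) hb'
    · rw [hd]
      exact mul_ne_zero (hsg k) h1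

/-- A curve of polarizations that joins a real polarization at time `0` to a complex one at
time `i`. -/
theorem exists_quadPath {b : Covector} (hb : b ≠ 0) {v : Tensor} (hv : IsPolarization b v)
    {ζ : Fin 4 → ℂ} (hζ : ζ ≠ 0) {y : Matrix (Fin 4) (Fin 4) ℂ} (hy : IsHarmonic ζ y) :
    ∃ (ν : Covector) (W : Fin 3 → Tensor), (∀ l, (W l).IsSymm) ∧
      harmonicOf (toC ν) (toC b) (quadPath W 0) = complexify v ∧
      harmonicOf (toC ν) ζ (quadPath W Complex.I) = y := by
  obtain ⟨ν, hν1, hν2⟩ := exists_dot_ne_zero hb hζ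
  have hvc := isPolarization_iff.mp hv
  set V := ((dot (toC ν) (toC b) ^ 2)⁻¹ • traceReverse (complexify v)) with hV
  set Z := ((dot (toC ν) ζ ^ 2)⁻¹ • traceReverse y) with hZ
  have hVr : ∀ i j, conj (V i j) = V i j := by
    intro i j
    have hc : ∀ r : ℝ, conj (r : ℂ) = r := Complex.conj_ofReal
    simp only [hV, Matrix.smul_apply, smul_eq_mul, traceReverse, mtrace, Matrix.of_apply, map_mul,
      map_inv₀, map_pow, map_sub, map_sum, map_div₀, map_one, Complex.conj_ofNat, apply_ite conj,
      map_zero, conj_sign, complexify, Matrix.map_apply, hc, dot_toC]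
  have hsymm : ∀ x : Matrix (Fin 4) (Fin 4) ℂ, (∀ i j, x i j = x j i) → ∀ i j,
      traceReverse x i j = traceReverse x j i := by
    intro x hx i j
    simp only [traceReverse, Matrix.of_apply, hx i j]
    by_cases h : i = j
    · subst h
      rfl
    · rw [if_neg h, if_neg (Ne.symm h)]
  have hVs : ∀ i j, V i j = V j i := fun i j => by
    rw [hV, Matrix.smul_apply, Matrix.smul_apply, hsymm _ hvc.1 i j]
  have hZs : ∀ i j, Z i j = Z j i := fun i j => by
    rw [hZ, Matrix.smul_apply, Matrix.smul_apply, hsymm _ hy.1 i j]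
  -- With V real, V + t Im Z + t² (V - Re Z) equals V at t = 0 and Re Z + i Im Z at t = i. Its
  -- coefficients are real, so real times give real tensors.
  refine ⟨ν, ![V.map Complex.re, Z.map Complex.im, V.map Complex.re - Z.map Complex.re], ?_, ?_, ?_⟩
  · intro l
    refine Matrix.IsSymm.ext fun i j => ?_
    fin_cases l
    · simp [hVs j i]
    · simp [hZs j i]
    · simp [hVs j i, hZs j i]
  · have : quadPath ![V.map Complex.re, Z.map Complex.im, V.map Complex.re - Z.map Complex.re] 0
        = V := by
      simp [quadPath, complexify_map_re hVr]
    rw [this, hV, harmonicOf_eq_self hvc hν1]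
  · have : quadPath ![V.map Complex.re, Z.map Complex.im, V.map Complex.re - Z.map Complex.re]
        Complex.I = Z := by
      ext i j
      simp only [quadPath, complexify, Matrix.add_apply, Matrix.smul_apply, Matrix.map_apply,
        Matrix.cons_val_zero, Matrix.cons_val_one, Matrix.cons_val, Matrix.sub_apply,
        Complex.I_sq, smul_eq_mul, Complex.ofReal_sub]
      linear_combination Complex.re_add_im (Z i j)
    rw [this, hZ, harmonicOf_eq_self hy hν2]

end Reality

end

end FourWave

namespace FourWave

noncomputable section

open Filter Topology ComplexConjugate

/-! ### Curves through real configurations and singular configurations -/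

section Curve

/-- The quadratic curve that is `ψ` at time `0`, `p` at time `i` and `conj q` at time `-i`. -/
def spinPath (ψ p q : ℂ) (t : ℂ) : ℂ :=
  ψ + t * ((p - conj q) / (2 * Complex.I)) + t ^ 2 * (ψ - (p + conj q) / 2)

/-- The quadratic curve that is `conj ψ` at time `0`, `q` at time `i` and `conj p` at time `-i`. -/
def conjSpinPath (ψ p q : ℂ) (t : ℂ) : ℂ :=
  conj ψ + t * conj ((p - conj q) / (2 * Complex.I)) + t ^ 2 * conj (ψ - (p + conj q) / 2)

variable (ψ p q : ℂ)

theorem spinPath_zero : spinPath ψ p q 0 = ψ := by simp [spinPath]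

theorem conjSpinPath_zero : conjSpinPath ψ p q 0 = conj ψ := by simp [conjSpinPath]

theorem spinPath_I : spinPath ψ p q Complex.I = p := by
  rw [spinPath, Complex.I_sq]
  have := Complex.I_ne_zero
  field_simp
  ring

theorem conjSpinPath_I : conjSpinPath ψ p q Complex.I = q := by
  rw [conjSpinPath, Complex.I_sq]
  simp only [map_sub, map_div₀, map_mul, map_add, Complex.conj_conj, Complex.conj_I,
    Complex.conj_ofNat]
  have := Complex.I_ne_zero
  field_simp
  ring

/-- The second spinor is the conjugate of the first one at the conjugate time. For real t the
momentum is therefore a real null covector, although its two factors are independent at t = i. -/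
theorem conjSpinPath_eq_conj (t : ℂ) :
    conjSpinPath ψ p q t = conj (spinPath ψ p q (conj t)) := by
  simp only [conjSpinPath, spinPath, map_add, map_mul, map_pow, Complex.conj_conj]

theorem conjSpinPath_neg_I : conjSpinPath ψ p q (-Complex.I) = conj p := by
  rw [conjSpinPath_eq_conj, map_neg, Complex.conj_I, neg_neg, spinPath_I]

theorem continuous_spinPath : Continuous (spinPath ψ p q) := by
  unfold spinPath
  fun_prop

theorem continuous_conjSpinPath : Continuous (conjSpinPath ψ p q) := by
  unfold conjSpinPath
  fun_prop

theorem meromorphicAt_spinPath (t : ℂ) : MeromorphicAt (spinPath ψ p q) t := by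
  unfold spinPath
  fun_prop

theorem meromorphicAt_conjSpinPath (t : ℂ) : MeromorphicAt (conjSpinPath ψ p q) t := by
  unfold conjSpinPath
  fun_prop

/-- A curve of null covectors. -/
def momPath (s : ℂ) (ψ p q : Fin 2 → ℂ) (t : ℂ) (k : Fin 4) : ℂ :=
  s * spinMul (fun i => spinPath (ψ i) (p i) (q i) t) (fun i => conjSpinPath (ψ i) (p i) (q i) t) k

variable {s : ℂ} {ψ p q : Fin 2 → ℂ}

theorem continuous_momPath (k : Fin 4) : Continuous fun t => momPath s ψ p q t k := by
  have h1 := fun i => continuous_spinPath (ψ i) (p i) (q i)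
  have h2 := fun i => continuous_conjSpinPath (ψ i) (p i) (q i)
  fin_cases k <;> simp [momPath, spinMul] <;> fun_prop

theorem meromorphicAt_momPath (k : Fin 4) (t : ℂ) :
    MeromorphicAt (fun t => momPath s ψ p q t k) t := by
  have h1 := fun i => meromorphicAt_spinPath (ψ i) (p i) (q i) t
  have h2 := fun i => meromorphicAt_conjSpinPath (ψ i) (p i) (q i) t
  fin_cases k <;> simp [momPath, spinMul] <;> fun_prop

theorem momPath_zero (k : Fin 4) :
    momPath s ψ p q 0 k = s * spinMul ψ (fun i => conj (ψ i)) k := by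
  simp only [momPath, spinPath_zero, conjSpinPath_zero]

theorem momPath_I (k : Fin 4) : momPath s ψ p q Complex.I k = s * spinMul p q k := by
  simp only [momPath, spinPath_I, conjSpinPath_I]

theorem dot_momPath (s' : ℂ) (ψ' p' q' : Fin 2 → ℂ) (t : ℂ) :
    dot (momPath s ψ p q t) (momPath s' ψ' p' q' t) = -(1 / 2) * s * s' *
      (bracket (fun i => spinPath (ψ i) (p i) (q i) t) (fun i => spinPath (ψ' i) (p' i) (q' i) t) *
      bracket (fun i => conjSpinPath (ψ i) (p i) (q i) t)
        (fun i => conjSpinPath (ψ' i) (p' i) (q' i) t)) := by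
  have := dot_spinMul (fun i => spinPath (ψ i) (p i) (q i) t)
    (fun i => conjSpinPath (ψ i) (p i) (q i) t) (fun i => spinPath (ψ' i) (p' i) (q' i) t)
    (fun i => conjSpinPath (ψ' i) (p' i) (q' i) t)
  have h2 : dot (momPath s ψ p q t) (momPath s' ψ' p' q' t) = s * s' *
      dot (spinMul (fun i => spinPath (ψ i) (p i) (q i) t)
      (fun i => conjSpinPath (ψ i) (p i) (q i) t)) (spinMul (fun i => spinPath (ψ' i) (p' i) (q' i) t)
      (fun i => conjSpinPath (ψ' i) (p' i) (q' i) t)) := by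
    simp only [dot, momPath, Finset.mul_sum]
    exact Finset.sum_congr rfl fun k _ => by ring
  rw [h2, this]
  ring

theorem dot_momPath_self (t : ℂ) : dot (momPath s ψ p q t) (momPath s ψ p q t) = 0 := by
  rw [dot_momPath, bracket]
  ring

theorem conj_momPath {s : ℝ} (t : ℝ) (k : Fin 4) :
    conj (momPath s ψ p q t k) = momPath s ψ p q t k := by
  have h : (fun i => conjSpinPath (ψ i) (p i) (q i) t)
      = fun i => conj (spinPath (ψ i) (p i) (q i) t) := by
    ext i
    rw [conjSpinPath_eq_conj, Complex.conj_ofReal]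
  rw [momPath, h, map_mul, Complex.conj_ofReal, conj_spinMul_conj]

theorem eventually_ne_zero_of_continuous {f : ℂ → ℂ} (hf : ∀ t, MeromorphicAt f t)
    (hc : Continuous f) {t₀ : ℂ} (h : f t₀ ≠ 0) (t₁ : ℂ) : ∀ᶠ t in 𝓝[≠] t₁, f t ≠ 0 :=
  eventually_ne_zero_of_tendsto hf h ((hc.tendsto t₀).mono_left nhdsWithin_le_nhds) t₁

theorem bracket_ne_zero_of_path {f g : ℂ → Fin 2 → ℂ} (hf : ∀ i t, MeromorphicAt (fun t => f t i) t)
    (hg : ∀ i t, MeromorphicAt (fun t => g t i) t) (hf' : ∀ i, Continuous fun t => f t i)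
    (hg' : ∀ i, Continuous fun t => g t i) {t₀ : ℂ} (h : bracket (f t₀) (g t₀) ≠ 0) (t₁ : ℂ) :
    ∀ᶠ t in 𝓝[≠] t₁, bracket (f t) (g t) ≠ 0 := by
  refine eventually_ne_zero_of_continuous (f := fun t => bracket (f t) (g t)) (fun t => ?_) ?_ h t₁
  · have h1 := fun i => hf i t
    have h2 := fun i => hg i t
    simp only [bracket]
    fun_prop
  · simp only [bracket]
    fun_prop

theorem bracket_conj (p q : Fin 2 → ℂ) :
    bracket (fun i => conj (p i)) (fun i => conj (q i)) = conj (bracket p q) := by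
  simp [bracket]

theorem continuous_quadPath (W : Fin 3 → Tensor) (i j : Fin 4) :
    Continuous fun t => quadPath W t i j := by
  simp only [quadPath, Matrix.add_apply, Matrix.smul_apply, smul_eq_mul]
  fun_prop

theorem meromorphicAt_quadPath (W : Fin 3 → Tensor) (i j : Fin 4) (t : ℂ) :
    MeromorphicAt (fun t => quadPath W t i j) t := by
  simp only [quadPath, Matrix.add_apply, Matrix.smul_apply, smul_eq_mul]
  fun_prop

theorem conj_quadPath (W : Fin 3 → Tensor) (t : ℝ) (i j : Fin 4) :
    conj (quadPath W t i j) = quadPath W t i j := by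
  simp only [quadPath, complexify, Matrix.add_apply, Matrix.smul_apply, smul_eq_mul,
    Matrix.map_apply, map_add, map_mul, map_pow, Complex.conj_ofReal]

theorem quadPath_symm {W : Fin 3 → Tensor} (hW : ∀ l, (W l).IsSymm) (t : ℂ) (i j : Fin 4) :
    quadPath W t i j = quadPath W t j i := by
  simp only [quadPath, complexify, Matrix.add_apply, Matrix.smul_apply, smul_eq_mul,
    Matrix.map_apply, (hW _).apply j i]

end Curve

/-! ### Density -/

section Density

/-- The first four covectors of a configuration. -/
def rows (b : Fin 5 → Covector) : Matrix (Fin 4) (Fin 4) ℂ :=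
  Matrix.of fun j k => (b j.castSucc k : ℂ)

/-- The polarizations of the second to fourth wave, and zero for the first one. -/
def polFamily (v : Tensor × Tensor × Tensor) : Fin 4 → Tensor := ![0, v.1, v.2.1, v.2.2]

/-- The complexified polarizations. -/
def pols (v : Tensor × Tensor × Tensor) (j : Fin 4) : Matrix (Fin 4) (Fin 4) ℂ :=
  complexify (polFamily v j)

/-- The limit of the determinant at a singular configuration. -/
theorem gramDet_singular {P Q : Fin 4 → Fin 2 → ℂ} {ε : Fin 4 → Fin 4 → ℂ}
    (hS : IsSingular P Q ε) {W : Fin 6 → Tensor}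
    (hW : (Matrix.of fun q r => contractMom (W r) (absorb
      (spinMul (P 0) (Q 0) + spinMul (P 1) (Q 1) + spinMul (P 2) (Q 2)) (spinMul (P 3) (Q 3)) (ε 3)
      (absorb (spinMul (P 0) (Q 0) + spinMul (P 1) (Q 1)) (spinMul (P 2) (Q 2)) (ε 2)
        (absorb (spinMul (P 0) (Q 0)) (spinMul (P 1) (Q 1)) (ε 1)
          (firstPolarization q (spinMul (P 0) (Q 0))))))).det ≠ 0)
    {a : ℕ} {β : Fin 4 → ℂ} {B : Matrix (Fin 4) (Fin 4) ℂ} {v : Fin 4 → Matrix (Fin 4) (Fin 4) ℂ}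
    (hB : scaledMom B β = fun j => spinMul (P j) (Q j))
    (hv : ∀ j i l, j ≠ 0 → ((a.factorial : ℂ) / rowCoord B β j ^ a) * v j i l = ε j i * ε j l) :
    gramDet a β W B v ≠ 0 := by
  have h : ∀ q j, j ≠ 0 → ∀ i l, scaledPol a β B v q j i l = ε j i * ε j l := fun q j hj i l => by
    rw [scaledPol, if_neg hj, Matrix.smul_apply, smul_eq_mul, hv j i l hj]
  have h0 : ∀ q, scaledPol a β B v q 0 = firstPolarization q (spinMul (P 0) (Q 0)) := fun q => by
    rw [scaledPol, if_pos rfl, hB]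
  have hnull : ∀ j, dot (spinMul (P j) (Q j)) (spinMul (P j) (Q j)) = 0 := fun j => by
    rw [dot_spinMul, bracket]
    ring
  have key : ∀ q r, regAmp (scaledMom B β) (scaledPol a β B v q) (W r) = contractMom (W r) (absorb
      (spinMul (P 0) (Q 0) + spinMul (P 1) (Q 1) + spinMul (P 2) (Q 2)) (spinMul (P 3) (Q 3)) (ε 3)
      (absorb (spinMul (P 0) (Q 0) + spinMul (P 1) (Q 1)) (spinMul (P 2) (Q 2)) (ε 2)
        (absorb (spinMul (P 0) (Q 0)) (spinMul (P 1) (Q 1)) (ε 1)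
          (firstPolarization q (spinMul (P 0) (Q 0)))))) := fun q r => by
    have h0' : IsHarmonic (spinMul (P 0) (Q 0)) (scaledPol a β B v q 0) := by
      rw [h0]
      exact isHarmonic_firstPolarization _ _
    rw [hB, ← h0 q]
    exact regAmp_eq_absorb (ζ := fun j => spinMul (P j) (Q j)) (h q 1 (by decide))
      (h q 2 (by decide)) (h q 3 (by decide)) h0' hnull hS.dot_zero_one hS.dot_two hS.dot_three
      (hS.null 1) (hS.transverse 1) (hS.null 2) (hS.transverse 2) (hS.null 3) (hS.transverse 3) (W r)
  rw [gramDet]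
  simp only [key]
  exact hW

end Density

end

end FourWave

namespace FourWave

noncomputable section

open Filter Topology ComplexConjugate

/-! ### Nondegenerate configurations near a given one -/

section SpinorCurves

/-- By `dot_spinMul` the product is a multiple of two brackets, and each is treated at its own
point: the first at t = i, the second at t = -i, where it is the conjugate of the same bracket of p
and p'. The spinors q and q' do not enter, so the conclusion holds even for momenta that are
orthogonal at t = i. -/
theorem eventually_dot_momPath_ne_zero {s s' : ℂ} (hs : s ≠ 0) (hs' : s' ≠ 0)
    {ψ p q ψ' p' q' : Fin 2 → ℂ} (h : bracket p p' ≠ 0) (t₁ : ℂ) :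
    ∀ᶠ t in 𝓝[≠] t₁, dot (momPath s ψ p q t) (momPath s' ψ' p' q' t) ≠ 0 := by
  have h1 := bracket_ne_zero_of_path (f := fun t i => spinPath (ψ i) (p i) (q i) t)
    (g := fun t i => spinPath (ψ' i) (p' i) (q' i) t) (t₀ := Complex.I)
    (fun i => meromorphicAt_spinPath _ _ _) (fun i => meromorphicAt_spinPath _ _ _)
    (fun i => continuous_spinPath _ _ _) (fun i => continuous_spinPath _ _ _)
    (by simpa only [spinPath_I] using h) t₁
  have h2 := bracket_ne_zero_of_path (f := fun t i => conjSpinPath (ψ i) (p i) (q i) t)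
    (g := fun t i => conjSpinPath (ψ' i) (p' i) (q' i) t) (t₀ := -Complex.I)
    (fun i => meromorphicAt_conjSpinPath _ _ _) (fun i => meromorphicAt_conjSpinPath _ _ _)
    (fun i => continuous_conjSpinPath _ _ _) (fun i => continuous_conjSpinPath _ _ _)
    (by
      simp only [conjSpinPath_neg_I, bracket_conj]
      exact (map_ne_zero _).mpr h) t₁
  filter_upwards [h1, h2] with t h1 h2
  rw [dot_momPath]
  exact mul_ne_zero (mul_ne_zero (mul_ne_zero (by norm_num) hs) hs') (mul_ne_zero h1 h2)

theorem momPath_const (s : ℂ) (κ : Fin 2 → ℂ) (t : ℂ) :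
    momPath s κ κ (fun i => conj (κ i)) t = fun k => s * spinMul κ (fun i => conj (κ i)) k := by
  ext k
  have h1 : ∀ i, spinPath (κ i) (κ i) (conj (κ i)) t = κ i := fun i => by
    rw [spinPath, Complex.conj_conj]
    ring
  have h2 : ∀ i, conjSpinPath (κ i) (κ i) (conj (κ i)) t = conj (κ i) := fun i => by
    rw [conjSpinPath_eq_conj, spinPath, Complex.conj_conj]
    congr 1
    ring
  simp only [momPath, h1, h2]

/-- A curve of configurations of four null covectors. -/
def rowPath (s : Fin 4 → ℂ) (ψ P Q : Fin 4 → Fin 2 → ℂ) (t : ℂ) : Matrix (Fin 4) (Fin 4) ℂ :=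
  Matrix.of fun j => momPath (s j) (ψ j) (P j) (Q j) t

variable {s : Fin 4 → ℂ} {ψ P Q : Fin 4 → Fin 2 → ℂ} {ε : Fin 4 → Fin 4 → ℂ} {β : Fin 4 → ℂ}

theorem rowPath_I (j k : Fin 4) : rowPath s ψ P Q Complex.I j k = s j * spinMul (P j) (Q j) k :=
  momPath_I k

theorem det_rowPath_I (hS : IsSingular P Q ε) (hs : ∀ j, s j * s j = 1) :
    (rowPath s ψ P Q Complex.I).det ≠ 0 := by
  -- The rows are the singular momenta up to the signs s_j. These signs reappear as the coordinates
  -- of β and cancel in the scaled momenta since s_j² = 1.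
  have h : rowPath s ψ P Q Complex.I
      = Matrix.of fun j k => s j * (Matrix.of fun j => spinMul (P j) (Q j)) j k := by
    ext j k
    exact rowPath_I j k
  rw [h, Matrix.det_mul_column]
  exact mul_ne_zero (Finset.prod_ne_zero_iff.mpr fun j _ => left_ne_zero_of_mul_eq_one (hs j))
    hS.det_ne_zero

theorem rowCoord_rowPath_I (hS : IsSingular P Q ε) (hs : ∀ j, s j * s j = 1)
    (hβ : ∀ k, ∑ l, spinMul (P l) (Q l) k = β k) (j : Fin 4) :
    rowCoord (rowPath s ψ P Q Complex.I) β j = s j := by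
  refine rowCoord_eq (det_rowPath_I hS hs) (fun k => ?_) j
  rw [← hβ]
  refine Finset.sum_congr rfl fun l _ => ?_
  rw [rowPath_I, ← mul_assoc, hs, one_mul]

theorem scaledMom_rowPath_I (hS : IsSingular P Q ε) (hs : ∀ j, s j * s j = 1)
    (hβ : ∀ k, ∑ l, spinMul (P l) (Q l) k = β k) :
    scaledMom (rowPath s ψ P Q Complex.I) β = fun j => spinMul (P j) (Q j) := by
  ext j k
  rw [scaledMom, rowCoord_rowPath_I hS hs hβ, rowPath_I, ← mul_assoc, hs, one_mul]

theorem continuous_rowPath (i j : Fin 4) : Continuous fun t => rowPath s ψ P Q t i j :=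
  continuous_momPath j

theorem meromorphicAt_rowPath (i j : Fin 4) (t : ℂ) :
    MeromorphicAt (fun t => rowPath s ψ P Q t i j) t :=
  meromorphicAt_momPath j t

theorem eventually_nondegenerate (hS : IsSingular P Q ε) (hs : ∀ j, s j * s j = 1)
    (hβ : ∀ k, ∑ l, spinMul (P l) (Q l) k = β k) {s' : ℂ} (hs' : s' ≠ 0) {κ : Fin 2 → ℂ}
    (hκ : ∀ k, β k = s' * spinMul κ (fun i => conj (κ i)) k) (h3 : bracket (P 3) κ ≠ 0) :
    ∀ᶠ t in 𝓝[≠] (0 : ℂ), Nondegenerate β (rowPath s ψ P Q t) := by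
  have hs0 : ∀ j, s j ≠ 0 := fun j => left_ne_zero_of_mul_eq_one (hs j)
  have hdet := det_rowPath_I (ψ := ψ) hS hs
  have hI : ∀ i j, Tendsto (fun t => rowPath s ψ P Q t i j) (𝓝[≠] Complex.I)
      (𝓝 (rowPath s ψ P Q Complex.I i j)) := fun i j =>
    ((continuous_rowPath i j).tendsto _).mono_left nhdsWithin_le_nhds
  have h1 := eventually_ne_zero_of_tendsto
    (fun t => meromorphicAt_det fun i j => meromorphicAt_rowPath (s := s) (ψ := ψ) (P := P) (Q := Q)
      i j t) hdet (det_tendsto hI) 0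
  have h2 : ∀ᶠ t in 𝓝[≠] (0 : ℂ), ∀ j, ((rowPath s ψ P Q t).updateRow j β).det ≠ 0 := by
    refine eventually_all.mpr fun j => ?_
    refine eventually_ne_zero_of_tendsto
      (fun t => meromorphicAt_det_updateRow (fun i j => meromorphicAt_rowPath i j t) j) ?_
      (det_updateRow_tendsto hI j) 0
    intro h
    have := rowCoord_rowPath_I (ψ := ψ) hS hs hβ j
    rw [rowCoord, h, zero_div] at this
    exact hs0 j this.symm
  have h4 : ∀ᶠ t in 𝓝[≠] (0 : ℂ), ∀ i j, i < j →
      dot (rowPath s ψ P Q t i) (rowPath s ψ P Q t j) ≠ 0 := by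
    refine eventually_all.mpr fun i => eventually_all.mpr fun j => ?_
    by_cases hij : i < j
    · refine (eventually_dot_momPath_ne_zero (hs0 i) (hs0 j) ?_ 0).mono fun t ht _ => ht
      by_cases h01 : (i, j) = (0, 1)
      · obtain ⟨rfl, rfl⟩ := Prod.mk.inj h01
        exact hS.bracket_ne_zero
      · have := hS.dot_ne_zero i j hij h01
        rw [dot_spinMul] at this
        exact left_ne_zero_of_mul (right_ne_zero_of_mul this)
    · exact Eventually.of_forall fun t h => absurd h hij
  have h5 : ∀ᶠ t in 𝓝[≠] (0 : ℂ), ∀ j, dot (rowPath s ψ P Q t j) β ≠ 0 := by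
    refine eventually_all.mpr fun j => ?_
    -- The fixed covector β is regarded as a constant curve, so that the statement about two curves
    -- applies.
    have hβ' : ∀ t, β = momPath s' κ κ (fun i => conj (κ i)) t := fun t => by
      rw [momPath_const]
      exact funext hκ
    have hj : bracket (P j) κ ≠ 0 := by
      have hsum : ∑ l, spinMul (P l) (Q l) = fun k => s' * spinMul κ (fun i => conj (κ i)) k := by
        ext k
        rw [Finset.sum_apply, hβ, hκ]
      have hsm : (fun k => s' * spinMul κ (fun i => conj (κ i)) k)
          = spinMul κ (s' • fun i => conj (κ i)) := by
        ext k
        fin_cases k <;> simp [spinMul] <;> ring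
      have h : ∀ l : Fin 3, bracket (P l.castSucc) κ ≠ 0 := fun l => by
        have := hS.dot_sum_ne_zero l
        rw [hsum, hsm, dot_spinMul] at this
        exact left_ne_zero_of_mul (right_ne_zero_of_mul this)
      -- For the last wave the product with β vanishes at the singular configuration, so its bracket
      -- with κ has to be supplied separately by `h3`.
      fin_cases j
      · exact h 0
      · exact h 1
      · exact h 2
      · exact h3
    refine (eventually_dot_momPath_ne_zero (ψ := ψ j) (q := Q j) (ψ' := κ)
      (q' := fun i => conj (κ i)) (hs0 j) hs' hj 0).mono fun t ht => ?_
    rw [← hβ' t] at ht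
    exact ht
  filter_upwards [h1, h2, h4, h5] with t h1 h2 h4 h5
  exact ⟨h1, h2, h4, h5⟩

/-- A curve of polarizations. -/
def polPath (s : Fin 4 → ℂ) (ψ P Q : Fin 4 → Fin 2 → ℂ) (ν : Fin 4 → Covector)
    (V : Fin 4 → Fin 3 → Tensor) (t : ℂ) (j : Fin 4) : Matrix (Fin 4) (Fin 4) ℂ :=
  harmonicOf (toC (ν j)) (rowPath s ψ P Q t j) (quadPath (V j) t)

variable {ν : Fin 4 → Covector} {V : Fin 4 → Fin 3 → Tensor}

theorem continuous_polPath (l i j : Fin 4) :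
    Continuous fun t => polPath s ψ P Q ν V t l i j := by
  rw [continuous_iff_continuousAt]
  exact fun t => tendsto_of_continuous_pair
    (H := fun ξ W => harmonicOf (toC (ν l)) ξ W i j) (ξ' := fun t => rowPath s ψ P Q t l)
    (W' := fun t => quadPath (V l) t) (continuous_harmonicOf (toC (ν l)) i j)
    (fun k => (continuous_rowPath l k).tendsto t)
    (fun i j => (continuous_quadPath (V l) i j).tendsto t)

/-- The limit at t = i is the determinant of the triple meetings, non-zero by the choice of `W`. The
identity theorem carries this to a punctured neighbourhood of t = 0, where the configuration itself
may be degenerate. -/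
theorem eventually_gramDet_ne_zero (hS : IsSingular P Q ε) (hs : ∀ j, s j * s j = 1)
    (hβ : ∀ k, ∑ l, spinMul (P l) (Q l) k = β k) {a : ℕ} {W : Fin 6 → Tensor}
    (hW : (Matrix.of fun q r => contractMom (W r) (absorb
      (spinMul (P 0) (Q 0) + spinMul (P 1) (Q 1) + spinMul (P 2) (Q 2)) (spinMul (P 3) (Q 3)) (ε 3)
      (absorb (spinMul (P 0) (Q 0) + spinMul (P 1) (Q 1)) (spinMul (P 2) (Q 2)) (ε 2)
        (absorb (spinMul (P 0) (Q 0)) (spinMul (P 1) (Q 1)) (ε 1)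
          (firstPolarization q (spinMul (P 0) (Q 0))))))).det ≠ 0)
    (hV : ∀ j i l, j ≠ 0 → ((a.factorial : ℂ) / s j ^ a) * polPath s ψ P Q ν V Complex.I j i l
      = ε j i * ε j l) :
    ∀ᶠ t in 𝓝[≠] (0 : ℂ), gramDet a β W (rowPath s ψ P Q t) (polPath s ψ P Q ν V t) ≠ 0 := by
  have hI : ∀ i j, Tendsto (fun t => rowPath s ψ P Q t i j) (𝓝[≠] Complex.I)
      (𝓝 (rowPath s ψ P Q Complex.I i j)) := fun i j =>
    ((continuous_rowPath i j).tendsto _).mono_left nhdsWithin_le_nhds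
  have hmom := scaledMom_rowPath_I (ψ := ψ) hS hs hβ
  have hc := rowCoord_rowPath_I (ψ := ψ) hS hs hβ
  refine eventually_ne_zero_of_tendsto
    (meromorphicAt_gramDet a W (fun i j t => meromorphicAt_rowPath i j t) fun l i j t =>
      meromorphicAt_harmonicOf (ν := toC (ν l)) (ξ := fun t => rowPath s ψ P Q t l)
        (W := fun t => quadPath (V l) t) (fun k => meromorphicAt_rowPath l k t)
        (fun i j => meromorphicAt_quadPath (V l) i j t) i j)
    (c := gramDet a β W (rowPath s ψ P Q Complex.I) (polPath s ψ P Q ν V Complex.I)) ?_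
    (gramDet_tendsto a W hI
      (fun l i j _ => ((continuous_polPath l i j).tendsto _).mono_left nhdsWithin_le_nhds)
      (det_rowPath_I hS hs) ?_ ?_ ?_) 0
  · exact gramDet_singular hS hW hmom fun j i l hj => by rw [hc, hV j i l hj]
  · intro j
    rw [hc]
    exact left_ne_zero_of_mul_eq_one (hs j)
  · rw [hmom]
    exact hS.dot_ne_zero
  · rw [hmom]
    exact hS.dot_sum_ne_zero

end SpinorCurves

end

end FourWave

namespace FourWave

noncomputable section

open Filter Topology ComplexConjugate

/-! ### Density of the nondegenerate configurations -/

section Density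

theorem gramDet_congr {a : ℕ} {β : Fin 4 → ℂ} {W : Fin 6 → Tensor} {B : Matrix (Fin 4) (Fin 4) ℂ}
    {v v' : Fin 4 → Matrix (Fin 4) (Fin 4) ℂ} (h : ∀ j, j ≠ 0 → v j = v' j) :
    gramDet a β W B v = gramDet a β W B v' := by
  have : scaledPol a β B v = scaledPol a β B v' := by
    ext q j : 2
    by_cases hj : j = 0
    · rw [scaledPol, scaledPol, if_pos hj, if_pos hj]
    · rw [scaledPol, scaledPol, if_neg hj, if_neg hj, h j hj]
  rw [gramDet, gramDet, this]

theorem isPolarization_polFamily {b5 : Covector}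
    {x : (Fin 5 → Covector) × Tensor × Tensor × Tensor} (hx : x ∈ configurations b5) (j : Fin 4) :
    IsPolarization (x.1 j.castSucc) (polFamily x.2 j) := by
  fin_cases j
  · exact ⟨Matrix.isSymm_zero, fun j => by simp [polFamily]⟩
  · exact hx.2.2.1
  · exact hx.2.2.2.1
  · exact hx.2.2.2.2

/-- The real part of a complex configuration. -/
def reConf (b5 : Covector) (B : Matrix (Fin 4) (Fin 4) ℂ) (v : Fin 4 → Matrix (Fin 4) (Fin 4) ℂ) :
    (Fin 5 → Covector) × Tensor × Tensor × Tensor :=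
  (![fun k => (B 0 k).re, fun k => (B 1 k).re, fun k => (B 2 k).re, fun k => (B 3 k).re, b5],
    (v 1).map Complex.re, (v 2).map Complex.re, (v 3).map Complex.re)

section

variable {b5 : Covector} {B : Matrix (Fin 4) (Fin 4) ℂ} {v : Fin 4 → Matrix (Fin 4) (Fin 4) ℂ}

theorem reConf_castSucc (j : Fin 4) : (reConf b5 B v).1 j.castSucc = fun k => (B j k).re := by
  fin_cases j <;> rfl

theorem reConf_last : (reConf b5 B v).1 4 = b5 :=
  rfl

theorem rows_reConf (hB : ∀ j k, conj (B j k) = B j k) : rows (reConf b5 B v).1 = B := by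
  ext j k
  rw [rows, Matrix.of_apply, reConf_castSucc]
  exact Complex.conj_eq_iff_re.mp (hB j k)

theorem toC_reConf (hB : ∀ j k, conj (B j k) = B j k) (j : Fin 4) :
    toC ((reConf b5 B v).1 j.castSucc) = B j := by
  ext k
  rw [toC, reConf_castSucc]
  exact Complex.conj_eq_iff_re.mp (hB j k)

theorem pols_reConf (hv : ∀ l i j, conj (v l i j) = v l i j) {j : Fin 4} (hj : j ≠ 0) :
    pols (reConf b5 B v).2 j = v j := by
  rw [← complexify_map_re (hv j), pols]
  congr 1
  fin_cases j
  · exact absurd rfl hj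
  · rfl
  · rfl
  · rfl

theorem reConf_mem (hb5 : IsLightlike b5) (hB : ∀ j k, conj (B j k) = B j k)
    (hv : ∀ l i j, conj (v l i j) = v l i j) (hdet : B.det ≠ 0) (hnull : ∀ j, dot (B j) (B j) = 0)
    (hvB : ∀ j, IsHarmonic (B j) (v j)) : reConf b5 B v ∈ configurations b5 := by
  have hpol : ∀ j, j ≠ 0 →
      IsPolarization ((reConf b5 B v).1 j.castSucc) (polFamily (reConf b5 B v).2 j) := by
    intro j hj
    rw [isPolarization_iff, toC_reConf hB]
    have := pols_reConf (b5 := b5) (B := B) hv hj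
    rw [pols] at this
    rw [this]
    exact hvB j
  refine ⟨fun j => ?_, reConf_last, hpol 1 (by decide), hpol 2 (by decide), hpol 3 (by decide)⟩
  induction j using Fin.lastCases with
  | last =>
    have := reConf_last (b5 := b5) (B := B) (v := v)
    rw [show Fin.last 4 = 4 from rfl, this]
    exact hb5
  | cast j =>
    refine ⟨fun h => hdet (Matrix.det_eq_zero_of_row_eq_zero j fun k => ?_), ?_⟩
    · rw [← toC_reConf (b5 := b5) (v := v) hB j, h, toC]
      simp
    · have := dot_toC ((reConf b5 B v).1 j.castSucc) ((reConf b5 B v).1 j.castSucc)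
      rw [toC_reConf hB, hnull] at this
      exact_mod_cast this.symm

theorem reConf_eq {x : (Fin 5 → Covector) × Tensor × Tensor × Tensor} (hx : x.1 4 = b5)
    (hB : ∀ j k, B j k = x.1 j.castSucc k) (hv : ∀ j, j ≠ 0 → v j = pols x.2 j) :
    reConf b5 B v = x := by
  have hre : ∀ j, j ≠ 0 → (v j).map Complex.re = polFamily x.2 j := by
    intro j hj
    ext i k
    rw [hv j hj, pols, complexify, Matrix.map_apply, Matrix.map_apply, Complex.ofReal_re]
  refine Prod.ext ?_ (Prod.ext (hre 1 (by decide)) (Prod.ext (hre 2 (by decide))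
    (hre 3 (by decide))))
  ext j k
  induction j using Fin.lastCases with
  | last => rw [show Fin.last 4 = 4 from rfl, reConf_last, hx]
  | cast j =>
    rw [reConf_castSucc]
    exact (congrArg Complex.re (hB j k)).trans (Complex.ofReal_re _)

theorem continuous_reConf {B : ℝ → Matrix (Fin 4) (Fin 4) ℂ}
    {v : ℝ → Fin 4 → Matrix (Fin 4) (Fin 4) ℂ} (hB : ∀ j k, Continuous fun t => B t j k)
    (hv : ∀ l i j, Continuous fun t => v t l i j) : Continuous fun t => reConf b5 (B t) (v t) := by
  have h : ∀ l, Continuous fun t => (v t l).map Complex.re := fun l =>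
    continuous_matrix fun i j => Complex.continuous_re.comp (hv l i j)
  refine Continuous.prodMk ?_ ((h 1).prodMk ((h 2).prodMk (h 3)))
  refine continuous_pi fun j => ?_
  induction j using Fin.lastCases with
  | last =>
    exact continuous_const
  | cast j =>
    have := continuous_pi fun k => Complex.continuous_re.comp (hB j k)
    refine this.congr fun t => ?_
    exact (reConf_castSucc (b5 := b5) (v := v t) j).symm

end

/-- Configurations for which the amplitudes with test polarizations `W` are independent. -/
def nondegenerateSet (a : ℕ) (b5 : Covector) (W : Fin 6 → Tensor) : Set (configurations b5) :=
  {x | Nondegenerate (toC b5) (rows x.1.1) ∧ gramDet a (toC b5) W (rows x.1.1) (pols x.1.2) ≠ 0}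

/-- The six independent images of the polarizations of wave 0 are separated by six real tensors,
chosen at the singular configuration. -/
theorem IsSingular.exists_testTensors {P Q : Fin 4 → Fin 2 → ℂ} {ε : Fin 4 → Fin 4 → ℂ}
    (hS : IsSingular P Q ε) (h00 : spinMul (P 0) (Q 0) 0 ≠ 0) :
    ∃ W : Fin 6 → Tensor, (∀ r, (W r).IsSymm) ∧
      (Matrix.of fun q r => contractMom (W r) (absorb
      (spinMul (P 0) (Q 0) + spinMul (P 1) (Q 1) + spinMul (P 2) (Q 2)) (spinMul (P 3) (Q 3)) (ε 3)
      (absorb (spinMul (P 0) (Q 0) + spinMul (P 1) (Q 1)) (spinMul (P 2) (Q 2)) (ε 2)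
        (absorb (spinMul (P 0) (Q 0)) (spinMul (P 1) (Q 1)) (ε 1)
          (firstPolarization q (spinMul (P 0) (Q 0))))))).det ≠ 0 := by
  have hnull : ∀ j, dot (spinMul (P j) (Q j)) (spinMul (P j) (Q j)) = 0 := fun j => by
    rw [dot_spinMul, bracket]
    ring
  exact exists_contractMom_det_ne_zero _
    (fun q => absorb_symm (absorb_symm (absorb_symm (isHarmonic_firstPolarization q _).1)))
    (linearIndependent_absorb (ζ := fun j => spinMul (P j) (Q j)) hnull
      hS.dot_zero_one hS.dot_two hS.dot_three (hS.null 1) (hS.transverse 1) (hS.null 2)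
      (hS.transverse 2) (hS.null 3) (hS.transverse 3) hS.one_ne_zero hS.two_ne_zero
      hS.three_ne_zero h00)

theorem exists_quadPath_family {b : Fin 4 → Covector} (hb : ∀ j, b j ≠ 0) {v : Fin 4 → Tensor}
    (hv : ∀ j, IsPolarization (b j) (v j)) {ζ : Fin 4 → Fin 4 → ℂ} (hζ : ∀ j, ζ j ≠ 0)
    {y : Fin 4 → Matrix (Fin 4) (Fin 4) ℂ} (hy : ∀ j, IsHarmonic (ζ j) (y j)) :
    ∃ (ν : Fin 4 → Covector) (V : Fin 4 → Fin 3 → Tensor), (∀ j l, (V j l).IsSymm) ∧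
      (∀ j, harmonicOf (toC (ν j)) (toC (b j)) (quadPath (V j) 0) = complexify (v j)) ∧
      ∀ j, harmonicOf (toC (ν j)) (ζ j) (quadPath (V j) Complex.I) = y j := by
  have h := fun j => exists_quadPath (hb j) (hv j) (hζ j) (hy j)
  choose ν V h1 h2 h3 using h
  exact ⟨ν, V, h1, h2, h3⟩

/-- Null covectors are moved through their spinors and polarizations through their parametrization,
so the constraints hold along the whole curve. The initial configuration is arbitrary and need not
be in general position. -/
theorem exists_curve {a : ℕ} {b5 : Covector} (hb5 : IsLightlike b5) {P Q : Fin 4 → Fin 2 → ℂ}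
    {ε : Fin 4 → Fin 4 → ℂ} (hS : IsSingular P Q ε) {s' : ℝ} (hs' : s' * s' = 1)
    {κ : Fin 2 → ℂ} (hβ : ∀ k, (b5 k : ℂ) = s' * spinMul κ (fun i => conj (κ i)) k)
    (hsum : ∀ k, ∑ l, spinMul (P l) (Q l) k = s' * spinMul κ (fun i => conj (κ i)) k)
    (h3 : bracket (P 3) κ ≠ 0) {W : Fin 6 → Tensor}
    (hWdet : (Matrix.of fun q r => contractMom (W r) (absorb
      (spinMul (P 0) (Q 0) + spinMul (P 1) (Q 1) + spinMul (P 2) (Q 2)) (spinMul (P 3) (Q 3)) (ε 3)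
      (absorb (spinMul (P 0) (Q 0) + spinMul (P 1) (Q 1)) (spinMul (P 2) (Q 2)) (ε 2)
        (absorb (spinMul (P 0) (Q 0)) (spinMul (P 1) (Q 1)) (ε 1)
          (firstPolarization q (spinMul (P 0) (Q 0))))))).det ≠ 0) (x : configurations b5) :
    ∃ y : ℝ → (Fin 5 → Covector) × Tensor × Tensor × Tensor, Continuous y ∧ y 0 = x.1 ∧
      ∀ᶠ t in 𝓝[≠] (0 : ℝ), ∃ h : y t ∈ configurations b5,
        (⟨y t, h⟩ : configurations b5) ∈ nondegenerateSet a b5 W := by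
  choose s ψ hs _ hb using fun j : Fin 4 => (x.2.1 j.castSucc).exists_spinor
  obtain ⟨sc, hsc⟩ : ∃ sc : Fin 4 → ℂ, ∀ j, sc j = s j := ⟨_, fun _ => rfl⟩
  have hsc1 : ∀ j, sc j * sc j = 1 := fun j => by
    rw [hsc]
    exact_mod_cast hs j
  have hsc0 : ∀ j, sc j ≠ 0 := fun j => left_ne_zero_of_mul_eq_one (hsc1 j)
  have ha : (a.factorial : ℂ) ≠ 0 := by exact_mod_cast a.factorial_ne_zero
  have hB0 : ∀ j, rowPath sc ψ P Q 0 j = toC (x.1.1 j.castSucc) := fun j => by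
    ext k
    rw [toC, hb, ← hsc]
    exact momPath_zero k
  have hBI : ∀ j, rowPath sc ψ P Q Complex.I j = sc j • spinMul (P j) (Q j) := fun j => by
    ext k
    exact rowPath_I j k
  have hdetI := det_rowPath_I (ψ := ψ) hS hsc1
  have hne : ∀ j, rowPath sc ψ P Q Complex.I j ≠ 0 := fun j h =>
    hdetI (Matrix.det_eq_zero_of_row_eq_zero j fun k => congrFun h k)
  -- The factor s_j ^ a / a! compensates the normalization a! / c_j ^ a in `scaledPol`, as c_j = s_j
  -- at t = i.
  have hharm : ∀ j, IsHarmonic (rowPath sc ψ P Q Complex.I j)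
      ((sc j ^ a / (a.factorial : ℂ)) • Matrix.of fun i l => ε j i * ε j l) := fun j => by
    rw [hBI]
    exact (isHarmonic_null (hS.null j) (hS.transverse j)).smul _ _
  obtain ⟨ν, V, hVs, hV0, hVI⟩ := exists_quadPath_family (fun j => (x.2.1 j.castSucc).1)
    (isPolarization_polFamily x.2) hne hharm
  have hβ' : ∀ k, ∑ l, spinMul (P l) (Q l) k = toC b5 k := fun k => by rw [hsum, toC, hβ]
  have hs'0 : (s' : ℂ) ≠ 0 := by
    have := left_ne_zero_of_mul_eq_one hs'
    exact_mod_cast this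
  have hnd := eventually_nondegenerate (ψ := ψ) hS hsc1 hβ' hs'0 hβ h3
  have hgram := eventually_gramDet_ne_zero (ψ := ψ) (ν := ν) (V := V) (a := a) hS hsc1 hβ' hWdet
    fun j i l _ => by
      rw [polPath, hVI, Matrix.smul_apply, Matrix.of_apply, smul_eq_mul, ← mul_assoc,
        div_mul_div_cancel₀' ha]
      rw [div_self (pow_ne_zero a (hsc0 j)), one_mul]
  have hreB : ∀ (t : ℝ) j k, conj (rowPath sc ψ P Q t j k) = rowPath sc ψ P Q t j k :=
    fun t j k => by
      rw [rowPath, Matrix.of_apply, hsc, conj_momPath]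
  have hrev : ∀ (t : ℝ) l i j, conj (polPath sc ψ P Q ν V t l i j) = polPath sc ψ P Q ν V t l i j :=
    fun t l i j => conj_harmonicOf (fun k => Complex.conj_ofReal _) (hreB t l)
      (fun i j => conj_quadPath (V l) t i j) i j
  have hpv : ∀ (t : ℂ) j, IsHarmonic (rowPath sc ψ P Q t j) (polPath sc ψ P Q ν V t j) :=
    fun t j => isHarmonic_harmonicOf _ _ (quadPath_symm (hVs j) t)
  refine ⟨fun t => reConf b5 (rowPath sc ψ P Q t) (polPath sc ψ P Q ν V t),
    continuous_reConf (fun j k => (continuous_rowPath j k).comp Complex.continuous_ofReal)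
      (fun l i j => (continuous_polPath l i j).comp Complex.continuous_ofReal), ?_, ?_⟩
  · refine reConf_eq x.2.2.1 (fun j k => ?_) fun j _ => ?_
    · rw [Complex.ofReal_zero, hB0, toC]
    · rw [Complex.ofReal_zero, polPath, hB0, hV0, pols]
  have hreal : Tendsto (fun t : ℝ => (t : ℂ)) (𝓝[≠] 0) (𝓝[≠] 0) := by
    refine tendsto_nhdsWithin_iff.mpr ⟨?_, ?_⟩
    · have := (Complex.continuous_ofReal.tendsto 0).mono_left
        (nhdsWithin_le_nhds (s := ({0}ᶜ : Set ℝ)))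
      rwa [Complex.ofReal_zero] at this
    · filter_upwards [self_mem_nhdsWithin] with t ht
      exact Complex.ofReal_ne_zero.mpr ht
  filter_upwards [hreal.eventually hnd, hreal.eventually hgram] with t h1 h2
  refine ⟨reConf_mem hb5 (hreB t) (hrev t) h1.det_ne_zero (fun j => dot_momPath_self _)
    (hpv t), ?_, ?_⟩
  · rw [rows_reConf (hreB t)]
    exact h1
  · rw [rows_reConf (hreB t), gramDet_congr fun j hj => pols_reConf (hrev t) hj]
    exact h2

/-- The singular configuration and the test tensors are built from a spinor of b⁽⁵⁾ alone, before
the point to be approximated is given. -/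
theorem exists_dense_nondegenerateSet (a : ℕ) {b5 : Covector} (hb5 : IsLightlike b5) :
    ∃ W : Fin 6 → Tensor, (∀ r, (W r).IsSymm) ∧ Dense (nondegenerateSet a b5 W) := by
  obtain ⟨s', κ, hs', hκ, hβ⟩ := hb5.exists_spinor
  obtain ⟨P, Q, ε, hS, hsum, h3, h00⟩ := exists_isSingular hκ hs'
  obtain ⟨W, hW, hWdet⟩ := hS.exists_testTensors h00
  refine ⟨W, hW, fun x => ?_⟩
  obtain ⟨y, hyc, hy0, hev⟩ := exists_curve (a := a) hb5 hS hs' hβ hsum h3 hWdet x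
  rw [mem_closure_iff_nhds]
  intro U hU
  rw [nhds_subtype_eq_comap, mem_comap] at hU
  obtain ⟨U', hU', hUU'⟩ := hU
  rw [← hy0] at hU'
  have := ((hyc.tendsto 0).mono_left (nhdsWithin_le_nhds (s := ({0}ᶜ : Set ℝ)))).eventually
    (eventually_mem_set.mpr hU')
  obtain ⟨t, ht, h, hmem⟩ := (this.and hev).exists
  exact ⟨⟨y t, h⟩, hUU' ht, hmem⟩

end Density

end

end FourWave

namespace FourWave

noncomputable section

open Filter Topology ComplexConjugate

/-! ### The indicator function at nondegenerate configurations -/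

section Open

theorem isOpen_nondegenerateSet (a : ℕ) (b5 : Covector) (W : Fin 6 → Tensor) :
    IsOpen (nondegenerateSet a b5 W) := by
  rw [isOpen_iff_mem_nhds]
  rintro x ⟨hx, hg⟩
  have hval : Tendsto (fun y : configurations b5 => y.1) (𝓝 x) (𝓝 x.1) :=
    continuous_subtype_val.tendsto x
  have hB : ∀ i j, Tendsto (fun y : configurations b5 => rows y.1.1 i j) (𝓝 x)
      (𝓝 (rows x.1.1 i j)) := fun i j => by
    have h : Continuous fun y : (Fin 5 → Covector) × Tensor × Tensor × Tensor =>
        ((y.1 i.castSucc j : ℝ) : ℂ) := by fun_prop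
    exact (h.tendsto x.1).comp hval
  have hv : ∀ l i j, Tendsto (fun y : configurations b5 => pols y.1.2 l i j) (𝓝 x)
      (𝓝 (pols x.1.2 l i j)) := fun l i j => by
    have h : Continuous fun y : (Fin 5 → Covector) × Tensor × Tensor × Tensor =>
        ((polFamily y.2 l i j : ℝ) : ℂ) := by
      refine Complex.continuous_ofReal.comp ?_
      fin_cases l
      · exact continuous_const
      · exact (continuous_fst.comp continuous_snd).matrix_elem i j
      · exact (continuous_fst.comp (continuous_snd.comp continuous_snd)).matrix_elem i j
      · exact (continuous_snd.comp (continuous_snd.comp continuous_snd)).matrix_elem i j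
    exact (h.tendsto x.1).comp hval
  have h1 := (det_tendsto hB).eventually_ne hx.det_ne_zero
  have h2 : ∀ᶠ y in 𝓝 x, ∀ j, ((rows y.1.1).updateRow j (toC b5)).det ≠ 0 :=
    eventually_all.mpr fun j => (det_updateRow_tendsto hB j).eventually_ne (hx.updateRow_ne_zero j)
  have h3 : ∀ᶠ y in 𝓝 x, ∀ i j, i < j → dot (rows y.1.1 i) (rows y.1.1 j) ≠ 0 := by
    refine eventually_all.mpr fun i => eventually_all.mpr fun j => ?_
    by_cases hij : i < j
    · exact ((dot_tendsto (hB i) (hB j)).eventually_ne (hx.dot_ne_zero i j hij)).mono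
        fun y hy _ => hy
    · exact Eventually.of_forall fun y h => absurd h hij
  have h4 : ∀ᶠ y in 𝓝 x, ∀ j, dot (rows y.1.1 j) (toC b5) ≠ 0 :=
    eventually_all.mpr fun j =>
      (dot_tendsto (q := fun _ => toC b5) (q₀ := toC b5) (hB j)
        fun k => tendsto_const_nhds).eventually_ne (hx.dot_right_ne_zero j)
  have h5 := (gramDet_tendsto a W hB (fun l i j _ => hv l i j) hx.det_ne_zero hx.rowCoord_ne_zero
    (fun i j hij _ => hx.dot_scaledMom_ne_zero i j hij)
    (fun j => hx.dot_sum_ne_zero j.castSucc)).eventually_ne hg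
  filter_upwards [h1, h2, h3, h4, h5] with y h1 h2 h3 h4 h5
  exact ⟨⟨h1, h2, h3, h4⟩, h5⟩

end Open

/-! ### Linearity of the amplitude in the test polarization -/

section Linear

theorem contractMom_add_left (w w' : Tensor) (F : Matrix (Fin 4) (Fin 4) ℂ) :
    contractMom (w + w') F = contractMom w F + contractMom w' F := by
  simp only [contractMom, Matrix.mul_add, Matrix.add_mul, Matrix.add_apply, add_smul,
    Finset.sum_add_distrib]

theorem contractMom_smul_left (r : ℝ) (w : Tensor) (F : Matrix (Fin 4) (Fin 4) ℂ) :
    contractMom (r • w) F = r • contractMom w F := by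
  simp only [contractMom, Matrix.mul_smul, Matrix.smul_mul, Matrix.smul_apply, smul_assoc,
    Finset.smul_sum]

/-- The amplitude as a linear function of the test polarization. -/
def regAmpLin (ζ : Fin 4 → Fin 4 → ℂ) (x : Fin 4 → Matrix (Fin 4) (Fin 4) ℂ) :
    Tensor →ₗ[ℝ] ℂ where
  toFun := regAmp ζ x
  map_add' w w' := by
    simp only [regAmp, contractMom_add_left, mul_add, Finset.sum_add_distrib]
    ring
  map_smul' r w := by
    simp only [regAmp, contractMom_smul_left, mul_smul_comm, RingHom.id_apply, smul_add, smul_sub,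
      Finset.smul_sum]

/-- By linearity the coefficient vector is in the kernel of the matrix whose determinant is
`gramDet`. This gives both the independence of the test tensors and a suitable first polarization
for each non-zero combination. -/
theorem eq_zero_of_regAmp_eq_zero {a : ℕ} {β : Fin 4 → ℂ} {W : Fin 6 → Tensor}
    {B : Matrix (Fin 4) (Fin 4) ℂ} {v : Fin 4 → Matrix (Fin 4) (Fin 4) ℂ}
    (h : gramDet a β W B v ≠ 0) (g : Fin 6 → ℝ)
    (hg : ∀ q, regAmp (scaledMom B β) (scaledPol a β B v q) (∑ r, g r • W r) = 0) : g = 0 := by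
  have h0 := Matrix.eq_zero_of_mulVec_eq_zero h (v := fun r => (g r : ℂ)) (by
    ext q
    have := hg q
    change regAmpLin _ _ _ = 0 at this
    rw [map_sum] at this
    simp only [map_smul, Complex.real_smul] at this
    simp only [Matrix.mulVec, dotProduct, Matrix.of_apply, Pi.zero_apply]
    rw [← this]
    exact Finset.sum_congr rfl fun r _ => mul_comm _ _)
  ext r
  exact Complex.ofReal_eq_zero.mp (congrFun h0 r)

end Linear

/-! ### From the determinant to the indicator function at a real configuration -/

section Point

variable {b : Fin 5 → Covector}

theorem det_rows : (rows b).det = ((waveMatrix b).det : ℝ) := by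
  have h := RingHom.map_det Complex.ofRealHom (waveMatrix b)
  rw [Complex.ofRealHom_eq_coe] at h
  rw [h]
  rfl

theorem exists_coord (hdet : (rows b).det ≠ 0) : (waveMatrix b).det ≠ 0 ∧ ∃ c : Fin 4 → ℝ,
    (∀ k, b 4 k = ∑ j, c j * b j.castSucc k) ∧ ∀ j, rowCoord (rows b) (toC (b 4)) j = c j := by
  have hd : (waveMatrix b).det ≠ 0 := by
    rw [det_rows] at hdet
    exact_mod_cast hdet
  have hc : ∀ k, b 4 k = ∑ j, Matrix.vecMul (b 4) (waveMatrix b)⁻¹ j * b j.castSucc k := by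
    intro k
    have h : Matrix.vecMul (Matrix.vecMul (b 4) (waveMatrix b)⁻¹) (waveMatrix b) = b 4 := by
      rw [Matrix.vecMul_vecMul, Matrix.nonsing_inv_mul _ (isUnit_iff_ne_zero.mpr hd),
        Matrix.vecMul_one]
    exact (congrFun h k).symm
  refine ⟨hd, _, hc, fun j => rowCoord_eq (c := fun j =>
    ((Matrix.vecMul (b 4) (waveMatrix b)⁻¹ j : ℝ) : ℂ)) hdet (fun k => ?_) j⟩
  rw [toC, hc k]
  push_cast
  rfl

/-- If b⁽⁵⁾ were in the span of the covectors other than b⁽ʲ⁾, then so would be c_j b⁽ʲ⁾, against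
independence and c_j ≠ 0. -/
theorem generalPosition_of_coord (hdet : (waveMatrix b).det ≠ 0) {c : Fin 4 → ℝ}
    (hc : ∀ k, b 4 k = ∑ j, c j * b j.castSucc k) (hc0 : ∀ j, c j ≠ 0) : GeneralPosition b := by
  have hli : LinearIndependent ℝ fun j : Fin 4 => b j.castSucc :=
    Matrix.linearIndependent_rows_of_det_ne_zero hdet
  refine ⟨hli, fun j hj => ?_⟩
  have hsum : b 4 = c j • b j.castSucc + ∑ i ∈ Finset.univ.erase j, c i • b i.castSucc := by
    rw [Finset.add_sum_erase _ (fun i => c i • b i.castSucc) (Finset.mem_univ j)]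
    ext k
    rw [hc k, Finset.sum_apply]
    rfl
  have hmem : b j.castSucc ∈ Submodule.span ℝ ((fun i : Fin 4 => b i.castSucc) '' {j}ᶜ) := by
    rw [← Submodule.smul_mem_iff _ (hc0 j), ← add_sub_cancel_right (c j • b j.castSucc), ← hsum]
    refine Submodule.sub_mem _ hj (Submodule.sum_mem _ fun i hi => Submodule.smul_mem _ _ ?_)
    exact Submodule.subset_span (Set.mem_image_of_mem (fun i : Fin 4 => b i.castSucc)
      (Set.mem_compl_singleton_iff.mpr (Finset.ne_of_mem_erase hi)))
  refine hli.notMem_span_image (s := {j}ᶜ) (x := j) ?_ hmem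
  rw [Set.mem_compl_singleton_iff, not_not]

theorem conj_firstPolarization (q : Fin 6) {ξ : Fin 4 → ℂ} (hξ : ∀ k, conj (ξ k) = ξ k)
    (i j : Fin 4) : conj (firstPolarization q ξ i j) = firstPolarization q ξ i j :=
  conj_harmonicOf (fun k => by fin_cases k <;> simp [timeCovector]) hξ
    (fun i j => Complex.conj_ofReal _) i j

/-- The momenta of a real configuration are real, so the polarization that realizes the non-zero
amplitude is real and can be used for the first wave. -/
theorem exists_hasIndicator {a : ℕ} (ha : 16 ≤ a) {v : Tensor × Tensor × Tensor}
    (hN : Nondegenerate (toC (b 4)) (rows b)) {q : Fin 6} {w : Tensor}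
    (hw : regAmp (scaledMom (rows b) (toC (b 4)))
      (scaledPol a (toC (b 4)) (rows b) (pols v) q) w ≠ 0) :
    ∃ v1 : Tensor, IsPolarization (b 0) v1 ∧
      ∃ z : ℂ, z ≠ 0 ∧ HasIndicator a b ![v1, v.1, v.2.1, v.2.2, w] z := by
  obtain ⟨hdet, c, hc, hrow⟩ := exists_coord hN.det_ne_zero
  have hc' : ∀ j, (c j : ℂ) ≠ 0 := fun j => by
    rw [← hrow]
    exact hN.rowCoord_ne_zero j
  have hc0 : ∀ j, c j ≠ 0 := fun j => by exact_mod_cast hc' j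
  have hfac : (a.factorial : ℂ) ≠ 0 := by exact_mod_cast a.factorial_ne_zero
  set ζ := scaledMom (rows b) (toC (b 4)) with hζ
  have hmom : waveMom c b = ζ := by
    ext j k
    rw [hζ, scaledMom, hrow, waveMom, rows, Matrix.of_apply]
    push_cast
    rfl
  have hdot : ∀ i j, dot (ζ i) (ζ j)
      = ((c i * c j * pairing (b i.castSucc) (b j.castSucc) : ℝ) : ℂ) := fun i j => by
    rw [hζ, dot_scaledMom, hrow, hrow]
    push_cast
    rw [← dot_toC]
    rfl
  have hpair : pairProp c b = fun i j => (2 * dot (ζ i) (ζ j))⁻¹ := by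
    ext i j
    rw [pairProp, hdot]
    push_cast
    rw [← mul_assoc, ← mul_assoc]
  have htest : testProp c b = fun j => (2 * dot (ζ j) (∑ l, ζ l))⁻¹ := by
    ext j
    rw [testProp, hζ, sum_scaledMom hN.det_ne_zero, dot_scaledMom_left, hrow]
    push_cast
    rw [← dot_toC, mul_assoc]
    rfl
  have hζr : ∀ j k, conj (ζ j k) = ζ j k := fun j k => by
    rw [← hmom]
    exact Complex.conj_ofReal _
  -- The factor 2 ζ₀·ζ₁ is the rescaling of wave 0 in `regWave`, and c₀ ^ a / a! cancels the
  -- normalization in `planeAmp`.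
  set d : ℂ := c 0 ^ a / a.factorial * (2 * dot (ζ 0) (ζ 1)) with hd
  have hdr : conj d = d := by
    rw [hd, hdot, map_mul, map_div₀, map_pow, map_mul, Complex.conj_ofReal, Complex.conj_ofReal,
      Complex.conj_ofNat, Complex.conj_natCast]
  have hre : complexify ((d • firstPolarization q (ζ 0)).map Complex.re)
      = d • firstPolarization q (ζ 0) := complexify_map_re fun i j => by
    rw [Matrix.smul_apply, smul_eq_mul, map_mul, hdr, conj_firstPolarization q (hζr 0)]
  have hb0 : toC (b 0) = (c 0 : ℂ)⁻¹ • ζ 0 := by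
    ext k
    rw [Pi.smul_apply, hζ, scaledMom, hrow, smul_eq_mul, inv_mul_cancel_left₀ (hc' 0)]
    rfl
  refine ⟨(d • firstPolarization q (ζ 0)).map Complex.re, ?_, _, ?_,
    hasIndicator_of_amp ha hdet hc hc0 _⟩
  · rw [isPolarization_iff, hre, hb0]
    exact (isHarmonic_firstPolarization q (ζ 0)).smul _ _
  · have hplane : planeAmp a c ![(d • firstPolarization q (ζ 0)).map Complex.re,
        v.1, v.2.1, v.2.2, w] = regWave ζ (scaledPol a (toC (b 4)) (rows b) (pols v) q) := by
      have hcast : ∀ (t : ℝ) j, ((a.factorial / c j ^ a * t : ℝ) : ℂ)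
          = a.factorial / (c j : ℂ) ^ a * (t : ℂ) := fun t j => by
        push_cast
        rfl
      have hj : ∀ j, j ≠ 0 → regWave ζ (scaledPol a (toC (b 4)) (rows b) (pols v) q) j
          = ((a.factorial : ℂ) / (c j : ℂ) ^ a) • complexify (polFamily v j) := fun j hj => by
        rw [regWave, if_neg hj, one_smul, scaledPol, if_neg hj, hrow, pols]
      ext j i l
      rw [planeAmp, Matrix.map_apply, hcast]
      fin_cases j
      · have h := congrFun (congrFun hre i) l
        rw [complexify, Matrix.map_apply] at h
        refine (congrArg (fun z => (a.factorial : ℂ) / (c 0 : ℂ) ^ a * z) h).trans ?_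
        change _ = regWave ζ _ 0 i l
        rw [regWave, if_pos rfl, scaledPol, if_pos rfl, Matrix.smul_apply, Matrix.smul_apply,
          smul_eq_mul, smul_eq_mul, hd, ← hζ]
        have := pow_ne_zero a (hc' 0)
        field_simp
      · exact (congrFun (congrFun (hj 1 (by decide)) i) l).symm
      · exact (congrFun (congrFun (hj 2 (by decide)) i) l).symm
      · exact (congrFun (congrFun (hj 3 (by decide)) i) l).symm
    rw [hmom, hpair, htest, hplane]
    rw [regAmp_eq hN.dot_scaledMom_ne_zero hN.dot_sum_ne_zero] at hw
    refine mul_ne_zero ?_ (right_ne_zero_of_mul hw)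
    refine Complex.ofReal_ne_zero.mpr (mul_ne_zero (inv_ne_zero (abs_ne_zero.mpr hdet)) ?_)
    exact Finset.prod_ne_zero_iff.mpr fun j _ => inv_ne_zero (hc0 j)

end Point

end

end FourWave

theorem proposition3p4 (a : ℕ) (ha : 16 ≤ a) (b5 : FourWave.Covector)
    (hb5 : FourWave.IsLightlike b5) :
    ∃ X' : Set (FourWave.configurations b5), IsOpen X' ∧ Dense X' ∧
      ∀ (b : Fin 5 → FourWave.Covector) (v2 v3 v4 : FourWave.Tensor)
        (hx : (b, v2, v3, v4) ∈ FourWave.configurations b5),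
        (⟨(b, v2, v3, v4), hx⟩ : FourWave.configurations b5) ∈ X' →
        FourWave.GeneralPosition b ∧
        ∃ v5 : Fin 6 → FourWave.Tensor, (∀ q, (v5 q).IsSymm) ∧ LinearIndependent ℝ v5 ∧
          ∀ w ∈ Submodule.span ℝ (Set.range v5), w ≠ 0 →
            ∃ v1 : FourWave.Tensor, FourWave.IsPolarization (b 0) v1 ∧
              ∃ c : ℂ, c ≠ 0 ∧ FourWave.HasIndicator a b ![v1, v2, v3, v4, w] c := by
  obtain ⟨W, hW, hdense⟩ := FourWave.exists_dense_nondegenerateSet a hb5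
  refine ⟨_, FourWave.isOpen_nondegenerateSet a b5 W, hdense, fun b v2 v3 v4 hx hmem => ?_⟩
  obtain rfl : b 4 = b5 := hx.2.1
  obtain ⟨hN, hg⟩ := hmem
  refine ⟨?_, W, hW, ?_, fun w hw hw0 => ?_⟩
  · obtain ⟨hdet, c, hc, hrow⟩ := FourWave.exists_coord hN.det_ne_zero
    refine FourWave.generalPosition_of_coord hdet hc fun j h => hN.rowCoord_ne_zero j ?_
    rw [hrow, h, Complex.ofReal_zero]
  · rw [Fintype.linearIndependent_iff]
    intro g hg0
    refine congrFun (FourWave.eq_zero_of_regAmp_eq_zero hg g fun q => ?_)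
    rw [hg0]
    exact map_zero (FourWave.regAmpLin _ _)
  · obtain ⟨g, rfl⟩ := (Submodule.mem_span_range_iff_exists_fun ℝ).mp hw
    by_contra hcon
    refine hw0 ?_
    -- If the amplitude vanished for all six polarizations of the first wave, the combination of
    -- test tensors would be zero.
    have : g = 0 := FourWave.eq_zero_of_regAmp_eq_zero hg g fun q => by
      by_contra hq
      exact hcon (FourWave.exists_hasIndicator ha (v := (v2, v3, v4)) hN hq)
    simp [this]
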